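/- **Setting.** Let $n\ge 0$, let $\omega:\mathbb R\to[0,\infty)$ and $F_1,\dots,F_n:\mathbb R\to\mathbb C$ be continuous with $$\int_{\mathbb R}\frac{|F_j(k)|^2}{\omega(k)+1}\,dk<\infty,\qquad \omega(-k)=\omega(k),\qquad F_j(-k)=\overline{F_j(k)}\qquad(k\in\mathbb R,\ 1\le j\le n).$$ Put $G(k)=F(k)F(k)^\dagger$, i.e. $G_{j\ell}(k)=F_j(k)\overline{F_\ell(k)}$, and let $\Sigma(z)=\int_{\mathbb R}\frac{G(k)}{\omega(k)-z}\,dk$ be the self-energy matrix. For $S\subset\mathbb C$ write $S^\pm=\{z\in S:\pm\operatorname{Im}z>0\}$. Let $\mathcal K\subset\mathbb C$ be open and connected with $\mathbb R\subset\mathcal K$, with smooth ($C^\infty$) boundary $\Gamma=\partial\mathcal K$, $\mathcal K$ lying locally on one side of $\Gamma$; let $\Gamma$ be oriented so that $\mathcal K$ lies on its right. Assume that $\omega$ and $G$ extend to functions on $\overline{\mathcal K}$, denoted by the same letters, which are analytic in $\mathcal K$ and continuous on $\overline{\mathcal K}$. Assume that for all $j\ge\ell$ there is $z_0\in\mathbb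 C$ such that $$\lim_{R\to\infty}\ \sup_{\kappa\in\mathcal K^+,\,|\kappa|=R}R\,\frac{|G_{j\ell}(\kappa)|}{|\omega(\kappa)-z_0|}=0,\qquad \int_{\Gamma^+}\frac{|G_{j\ell}(\kappa)|}{|\omega(\kappa)-z_0|}\,|d\kappa|<\infty .$$ Let $\mathcal A\subset\mathbb C$ be open and connected with $\mathcal A\cap\omega(\Gamma)=\emptyset$, let $\mathcal C=\{\kappa\in\mathcal K:\omega'(\kappa)=0\}$, and suppose that there are continuous functions $\hat\kappa_1,\dots,\hat\kappa_r:\mathcal A\to\mathcal K$ such that for every $z\in\mathcal A$ the solutions $\kappa\in\mathcal K$ of $\omega(\kappa)=z$ are exactly $\pm\hat\kappa_1(z),\dots,\pm\hat\kappa_r(z)$, that these are $2r$ distinct numbers if $z\notin\omega(\mathcal C)$, and that $\hat\kappa_s(z)\in\mathcal K^+$ for $z\in\mathcal A^+$. For $j\ge\ell$ put $$b_{j\ell}(z)=\int_{\Gamma^+}\frac{G_{j\ell}(\kappa)}{\omega(\kappa)-z}\,d\kappa,\qquad Z_{j\ell}(\kappa)=\frac{G_{j\ell}(\kappa)}{\omega'(\kappa)},$$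 and $b_{\ell j}=b_{j\ell}$, $Z_{\ell j}=Z_{j\ell}$. For a square matrix $M$ let $\operatorname{Re}M=\frac12(M+M^\dagger)$ and $\operatorname{Im}M=\frac12(M-M^\dagger)$ be its hermitian and anti-hermitian components, so that $M=\operatorname{Re}M+\operatorname{Im}M$. **Proposition.** The integrals defining $\Sigma(z)$, $z\in\mathcal A^+$, and $\mathsf b(z)$, $z\in\mathcal A$, converge absolutely, and: (i) For all $z\in\mathcal A^+\setminus\omega(\mathcal C)$, $$\Sigma(z)=\mathsf b(z)+2\pi i\sum_{s=1}^r\mathsf Z(\hat\kappa_s(z)),\qquad \Sigma(\overline z)=\Sigma(z)^\dagger .$$ (ii) Suppose that $\mathcal K$ is symmetric with respect to the imaginary axis, and let $E\in\mathcal A\cap\mathbb R$. Then $\operatorname{Im}\hat\kappa_s(E)\ge0$ for all $s$. Let $I^+(E)$ and $I^0(E)$ be the sets of those $s$ with $\operatorname{Im}\hat\kappa_s(E)>0$ and $\operatorname{Im}\hat\kappa_s(E)=0$, respectively. The limits $\Sigma(E\pm i0)=\lim_{\delta\downarrow0}\Sigma(E\pm i\delta)$ exist, and $$\operatorname{Re}\Sigma(E\pm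 i0)=\mathsf b(E)+2\pi i\Big(\sum_{s\in I^+(E)}\mathsf Z(\hat\kappa_s(E))+\sum_{s\in I^0(E)}\operatorname{Im}\mathsf Z(\hat\kappa_s(E))\Big),$$ $$\operatorname{Im}\Sigma(E\pm i0)=\pm2\pi i\sum_{s\in I^0(E)}\operatorname{Re}\mathsf Z(\hat\kappa_s(E)),$$ $$\Sigma(E+i0)-\Sigma(E-i0)=2\pi i\sum_{s\in I^0(E)}\big(\mathsf Z(\hat\kappa_s(E))+\mathsf Z(\hat\kappa_s(E))^\dagger\big).$$ (iii) $\Sigma$ can be continued analytically from $\mathcal A^+$ to $\mathcal A^-$: there is an analytic matrix-valued function $\Sigma^{(\mathrm{II})}$ on $\mathcal A$ which coincides with $\Sigma$ on $\mathcal A^+$ (it is unique if $\mathcal A^+\ne\emptyset$) such that, for all $z\in\mathcal A^-\setminus\omega(\mathcal C)$, $$\Sigma^{(\mathrm{II})}(z)=\mathsf b(z)+2\pi i\sum_{s=1}^r\mathsf Z(\hat\kappa_s(z)).$$ -/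

import Mathlib

open Complex Set Filter MeasureTheory
open scoped Topology Matrix ComplexConjugate ENNReal

namespace FriedrichsLee

/-- The part of a set of complex numbers in the open upper half-plane. -/
def upper (S : Set ℂ) : Set ℂ := {z | z ∈ S ∧ 0 < z.im}

/-- The part of a set of complex numbers in the open lower half-plane. -/
def lower (S : Set ℂ) : Set ℂ := {z | z ∈ S ∧ z.im < 0}

/-! ### Domains with smooth boundary and integration along the boundary -/

/-- `ρ` is a smooth function which defines the set `K` near the point `p`: near `p` the set `K` is
`{ρ < 0}`, and the gradient of `ρ` at `p` does not vanish. (If `p` is a boundary point, then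
automatically `ρ p = 0`.) -/
structure IsDefiningFunction (K : Set ℂ) (p : ℂ) (ρ : ℂ → ℝ) : Prop where
  contDiff : ContDiff ℝ ((⊤ : ℕ∞) : WithTop ℕ∞) ρ
  gradient_ne_zero : gradient ρ p ≠ 0
  mem_iff : ∀ᶠ κ in 𝓝 p, κ ∈ K ↔ ρ κ < 0

/-- The boundary of `K` is smooth, with `K` lying locally on one side of it. -/
def HasSmoothBoundary (K : Set ℂ) : Prop :=
  ∀ p ∈ frontier K, ∃ ρ : ℂ → ℝ, IsDefiningFunction K p ρ

open Classical in
/-- The outward unit normal of `K` at the boundary point `p`, namely `∇ρ / ‖∇ρ‖` for any defining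
function `ρ` (it does not depend on `ρ`, see `outwardNormal_eq`). -/
noncomputable def outwardNormal (K : Set ℂ) (p : ℂ) : ℂ :=
  if h : ∃ ρ : ℂ → ℝ, IsDefiningFunction K p ρ then
    gradient h.choose p / (‖gradient h.choose p‖ : ℂ)
  else 0

/-- The unit tangent vector at a boundary point of `K`, for the orientation of the boundary which
leaves `K` on its right-hand side. (The boundary of the strip `|Im κ| < a` is thus traversed from
left to right along its upper edge.) -/
noncomputable def boundaryTangent (K : Set ℂ) (p : ℂ) : ℂ := -I * outwardNormal K p

/-- The line integral `∫_{Γ⁺} f(κ) dκ`, where `Γ` is the boundary of `K`, oriented so that `K` is on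
its right-hand side: `dκ` is the unit tangent times the arc length. -/
noncomputable def contourIntegral (K : Set ℂ) (f : ℂ → ℂ) : ℂ :=
  ∫ κ in upper (frontier K), f κ * boundaryTangent K κ ∂(Measure.hausdorffMeasure 1)

/-- Absolute convergence of the line integral `∫_{Γ⁺} f(κ) dκ`. -/
def ContourIntegrable (K : Set ℂ) (f : ℂ → ℂ) : Prop :=
  IntegrableOn (fun κ => f κ * boundaryTangent K κ) (upper (frontier K))
    (Measure.hausdorffMeasure 1)

lemma eventually_neg_of_fderiv_neg {ρ : ℂ → ℝ} {p v : ℂ} (hρ : ContDiff ℝ ((⊤ : ℕ∞) : WithTop ℕ∞) ρ) (h0 : ρ p = 0)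
    (hv : fderiv ℝ ρ p v < 0) : ∀ᶠ t in 𝓝[>] (0 : ℝ), ρ (p + t • v) < 0 := by
  have h1 : HasFDerivAt ρ (fderiv ℝ ρ p) (p + (0 : ℝ) • v) := by
    simpa using (hρ.differentiable (by simp) p).hasFDerivAt
  have h2 : HasDerivAt (fun t : ℝ => p + t • v) v 0 := by
    simpa using ((hasDerivAt_id (0 : ℝ)).smul_const v).const_add p
  have h3 : HasDerivAt (fun t : ℝ => ρ (p + t • v)) (fderiv ℝ ρ p v) 0 :=
    h1.comp_hasDerivAt (0 : ℝ) h2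
  have h4 := (hasDerivAt_iff_tendsto_slope.1 h3).mono_left
    (nhdsWithin_mono (0 : ℝ) (fun t (ht : 0 < t) => ne_of_gt ht))
  filter_upwards [h4.eventually (gt_mem_nhds hv), self_mem_nhdsWithin] with t ht ht0
  have ht0' : (0 : ℝ) < t := ht0
  simp only [slope_def_field, zero_smul, add_zero, h0, sub_zero] at ht
  by_contra hc
  exact absurd ht (not_lt.2 (div_nonneg (not_lt.1 hc) ht0'.le))

lemma IsDefiningFunction.apply_eq_zero {K : Set ℂ} {p : ℂ} {ρ : ℂ → ℝ}
    (h : IsDefiningFunction K p ρ) (hp : p ∈ frontier K) : ρ p = 0 := by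
  rcases lt_trichotomy (ρ p) 0 with hl | hl | hl
  · exfalso
    apply hp.2
    rw [mem_interior_iff_mem_nhds]
    filter_upwards [h.mem_iff, h.contDiff.continuous.continuousAt.eventually (gt_mem_nhds hl)]
      with κ h1 h2
    exact h1.2 h2
  · exact hl
  · exfalso
    have h1 : ∀ᶠ κ in 𝓝 p, κ ∉ K := by
      filter_upwards [h.mem_iff, h.contDiff.continuous.continuousAt.eventually (lt_mem_nhds hl)]
        with κ h1 h2
      exact fun hK => absurd (h1.1 hK) (not_lt.2 h2.le)
    exact (mem_closure_iff_frequently.1 hp.1) h1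

/-- The normal direction does not depend on the defining function. -/
theorem IsDefiningFunction.normal_eq {K : Set ℂ} {p : ℂ} {ρ σ : ℂ → ℝ} (hp : p ∈ frontier K)
    (hρ : IsDefiningFunction K p ρ) (hσ : IsDefiningFunction K p σ) :
    gradient ρ p / (‖gradient ρ p‖ : ℂ) = gradient σ p / (‖gradient σ p‖ : ℂ) := by
  set a := gradient ρ p with ha
  set b := gradient σ p with hb
  have ha0 : a ≠ 0 := hρ.gradient_ne_zero
  have hb0 : b ≠ 0 := hσ.gradient_ne_zero
  have hga : ∀ v, fderiv ℝ ρ p v = inner ℝ a v := fun v => by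
    rw [ha, gradient, InnerProductSpace.toDual_symm_apply]
  have hgb : ∀ v, fderiv ℝ σ p v = inner ℝ b v := fun v => by
    rw [hb, gradient, InnerProductSpace.toDual_symm_apply]
  have key : ∀ v, inner ℝ a v < 0 → ¬ (0 < inner ℝ b v) := by
    intro v hv hv'
    have e1 := eventually_neg_of_fderiv_neg hρ.contDiff (hρ.apply_eq_zero hp)
      (v := v) (by rw [hga]; exact hv)
    have e2 : ∀ᶠ t in 𝓝[>] (0 : ℝ), -σ (p + t • v) < 0 := by
      refine eventually_neg_of_fderiv_neg (ρ := fun κ => -σ κ) hσ.contDiff.neg ?_ ?_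
      · simp [hσ.apply_eq_zero hp]
      · rw [fderiv_fun_neg]
        rw [_root_.neg_apply, hgb]
        linarith
    have hlim : Tendsto (fun t : ℝ => p + t • v) (𝓝[>] 0) (𝓝 p) := by
      have : Continuous (fun t : ℝ => p + t • v) := by fun_prop
      simpa using (this.tendsto 0).mono_left nhdsWithin_le_nhds
    obtain ⟨t, h1, h2, h3, h4⟩ := (e1.and (e2.and
      ((hlim.eventually hρ.mem_iff).and (hlim.eventually hσ.mem_iff)))).exists
    have := h4.1 (h3.2 h1)
    linarith
  have hna : (0 : ℝ) < ‖a‖ := norm_pos_iff.2 ha0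
  have hnb : (0 : ℝ) < ‖b‖ := norm_pos_iff.2 hb0
  have hle : ‖a‖ * ‖b‖ ≤ inner ℝ a b := by
    by_contra hc
    rw [not_le] at hc
    apply key (‖a‖ • b - ‖b‖ • a)
    · rw [inner_sub_right, inner_smul_right, inner_smul_right, real_inner_self_eq_norm_sq]
      nlinarith
    · rw [inner_sub_right, inner_smul_right, inner_smul_right, real_inner_self_eq_norm_sq,
        real_inner_comm]
      nlinarith
  have heq := inner_eq_norm_mul_iff_real.1 (le_antisymm (real_inner_le_norm a b) hle)
  simp only [Complex.real_smul] at heq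
  have hna' : (‖a‖ : ℂ) ≠ 0 := by exact_mod_cast hna.ne'
  have hnb' : (‖b‖ : ℂ) ≠ 0 := by exact_mod_cast hnb.ne'
  rw [div_eq_div_iff hna' hnb']
  linear_combination heq

theorem outwardNormal_eq {K : Set ℂ} {p : ℂ} {ρ : ℂ → ℝ} (hp : p ∈ frontier K)
    (hρ : IsDefiningFunction K p ρ) :
    outwardNormal K p = gradient ρ p / (‖gradient ρ p‖ : ℂ) := by
  have h : ∃ ρ : ℂ → ℝ, IsDefiningFunction K p ρ := ⟨ρ, hρ⟩
  rw [outwardNormal, dif_pos h]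
  exact IsDefiningFunction.normal_eq hp h.choose_spec hρ

/-! ### The model -/

variable {n : ℕ}

/-- The matrix `G(k) = F(k) F(k)†`, with entries `F_j(k) * conj (F_l(k))`. -/
def couplingMatrix (F : ℝ → Fin n → ℂ) (k : ℝ) : Matrix (Fin n) (Fin n) ℂ :=
  Matrix.of fun j l => F k j * conj (F k l)

/-- The self-energy matrix `Σ(z) = ∫ G(k) / (ω(k) - z) dk`. -/
noncomputable def selfEnergy (ω : ℝ → ℝ) (F : ℝ → Fin n → ℂ) (z : ℂ) :
    Matrix (Fin n) (Fin n) ℂ :=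
  Matrix.of fun j l => ∫ k : ℝ, couplingMatrix F k j l / ((ω k : ℂ) - z)

/-- A dispersion relation `ω` and form factors `F` of a Friedrichs-Lee model which is symmetric
under the reflection of the momentum. -/
structure IsSymmetricModel (ω : ℝ → ℝ) (F : ℝ → Fin n → ℂ) : Prop where
  continuous_dispersion : Continuous ω
  dispersion_nonneg : ∀ k, 0 ≤ ω k
  continuous_formFactor : ∀ j, Continuous fun k => F k j
  normalization : ∀ j, Integrable fun k : ℝ => ‖F k j‖ ^ 2 / (ω k + 1)
  dispersion_neg : ∀ k, ω (-k) = ω k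
  formFactor_neg : ∀ k j, F (-k) j = conj (F k j)

/-- `Ω` and `G` extend `ω` and `F F†` from the real line to the closure of the domain `K`, which
has smooth boundary: they are analytic in `K` and continuous on its closure. -/
structure IsAnalyticExtension (ω : ℝ → ℝ) (F : ℝ → Fin n → ℂ) (K : Set ℂ) (Ω : ℂ → ℂ)
    (G : ℂ → Matrix (Fin n) (Fin n) ℂ) : Prop where
  isOpen : IsOpen K
  isConnected : IsConnected K
  real_mem : ∀ k : ℝ, (k : ℂ) ∈ K
  smoothBoundary : HasSmoothBoundary K
  dispersion_ofReal : ∀ k : ℝ, Ω k = (ω k : ℂ)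
  coupling_ofReal : ∀ k : ℝ, G k = couplingMatrix F k
  analytic_dispersion : AnalyticOnNhd ℂ Ω K
  continuous_dispersion : ContinuousOn Ω (closure K)
  analytic_coupling : ∀ j l, AnalyticOnNhd ℂ (fun κ => G κ j l) K
  continuous_coupling : ∀ j l, ContinuousOn (fun κ => G κ j l) (closure K)

/-- The growth condition at infinity and the integrability condition at the boundary, for the
entries `G_{jl}` with `j ≥ l`. All quotients are taken in `[0, ∞]`, so that `c / 0 = ∞` for
`c ≠ 0`. -/
def BoundaryConditions (K : Set ℂ) (Ω : ℂ → ℂ) (G : ℂ → Matrix (Fin n) (Fin n) ℂ) : Prop :=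
  ∀ j l : Fin n, l ≤ j → ∃ z₀ : ℂ,
    Tendsto (fun R : ℝ => ⨆ κ ∈ {κ | κ ∈ upper K ∧ ‖κ‖ = R},
      ENNReal.ofReal R * (‖G κ j l‖ₑ / ‖Ω κ - z₀‖ₑ)) atTop (𝓝 0) ∧
    ∫⁻ κ in upper (frontier K), ‖G κ j l‖ₑ / ‖Ω κ - z₀‖ₑ ∂(Measure.hausdorffMeasure 1) < ∞

/-- The `2r` functions `κ₁, …, κᵣ, -κ₁, …, -κᵣ` at the point `z`. -/
def roots {r : ℕ} (kap : Fin r → ℂ → ℂ) (z : ℂ) : Fin r ⊕ Fin r → ℂ :=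
  Sum.elim (fun s => kap s z) (fun s => -kap s z)

/-- The critical points of `Ω` in `K`. -/
def criticalPoints (K : Set ℂ) (Ω : ℂ → ℂ) : Set ℂ := {κ | κ ∈ K ∧ deriv Ω κ = 0}

/-- For every `z ∈ A`, the solutions in `K` of the equation `Ω(κ) = z` are `±κ₁(z), …, ±κᵣ(z)`;
they depend continuously on `z`, they are `2r` distinct numbers unless `z` is a critical value, and
`κ₁(z), …, κᵣ(z)` lie in the upper half-plane if `z` does. -/
structure IsRootSystem (K : Set ℂ) (Ω : ℂ → ℂ) (A : Set ℂ) {r : ℕ} (kap : Fin r → ℂ → ℂ) :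
    Prop where
  continuousOn : ∀ s, ContinuousOn (kap s) A
  range_roots : ∀ z ∈ A, range (roots kap z) = {κ | κ ∈ K ∧ Ω κ = z}
  injective_roots : ∀ z ∈ A, z ∉ Ω '' criticalPoints K Ω → Function.Injective (roots kap z)
  im_pos : ∀ z ∈ upper A, ∀ s, 0 < (kap s z).im

/-- The integrand `G_{jl}(κ) / (Ω(κ) - z)` for `j ≥ l`, extended to all `j, l` by symmetry. -/
noncomputable def contourIntegrand (Ω : ℂ → ℂ) (G : ℂ → Matrix (Fin n) (Fin n) ℂ) (z : ℂ)
    (j l : Fin n) (κ : ℂ) : ℂ :=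
  G κ (max j l) (min j l) / (Ω κ - z)

/-- The contour term: `b_{jl}(z) = ∫_{Γ⁺} G_{jl}(κ) / (Ω(κ) - z) dκ` for `j ≥ l`, and
`b_{lj}(z) = b_{jl}(z)`. -/
noncomputable def contourTerm (K : Set ℂ) (Ω : ℂ → ℂ) (G : ℂ → Matrix (Fin n) (Fin n) ℂ) (z : ℂ) :
    Matrix (Fin n) (Fin n) ℂ :=
  Matrix.of fun j l => contourIntegral K (contourIntegrand Ω G z j l)

/-- The residue term: `Z_{jl}(κ) = G_{jl}(κ) / Ω'(κ)` for `j ≥ l`, and `Z_{lj}(κ) = Z_{jl}(κ)`. -/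
noncomputable def residueTerm (Ω : ℂ → ℂ) (G : ℂ → Matrix (Fin n) (Fin n) ℂ) (κ : ℂ) :
    Matrix (Fin n) (Fin n) ℂ :=
  Matrix.of fun j l => G κ (max j l) (min j l) / deriv Ω κ

/-- The hermitian component `(M + M†) / 2` of a matrix. -/
noncomputable def hermitianPart (M : Matrix (Fin n) (Fin n) ℂ) : Matrix (Fin n) (Fin n) ℂ :=
  (1 / 2 : ℂ) • (M + Mᴴ)

/-- The anti-hermitian component `(M - M†) / 2` of a matrix. -/
noncomputable def antihermitianPart (M : Matrix (Fin n) (Fin n) ℂ) : Matrix (Fin n) (Fin n) ℂ :=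
  (1 / 2 : ℂ) • (M - Mᴴ)

/-- `S` is analytic in `A` and coincides with the self-energy in the upper part of `A`. -/
def IsContinuation (ω : ℝ → ℝ) (F : ℝ → Fin n → ℂ) (A : Set ℂ)
    (S : ℂ → Matrix (Fin n) (Fin n) ℂ) : Prop :=
  (∀ j l, AnalyticOnNhd ℂ (fun z => S z j l) A) ∧ ∀ z ∈ upper A, S z = selfEnergy ω F z

end FriedrichsLee

open FriedrichsLee

namespace FriedrichsLee

/-! ### The one-dimensional Hausdorff measure on a smooth curve -/

/-! For `z` in the upper part of `A`, integrate `G/(ω - z)` along the boundary of the upper half of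
`K`. This boundary consists of the real line and `Γ⁺`. With the domain on the right, the line is
traversed from right to left and residues count with the sign `-2πi`. The only poles inside are the
`κ̂ₛ(z)`: the roots `-κ̂ₛ(z)` lie in the lower half-plane, `ω` is real on the line, and `A` avoids
`ω(Γ)`. The poles are simple with residue `G/ω'`, because a continuous right inverse of a
holomorphic function cannot pass through a critical point. This gives (i), see `selfEnergy_eq`.

The residue theorem is obtained for arbitrary smooth boundaries and the arc-length measure `μH¹`.
Testing against a compactly supported `φ` turns it into `∫_{∂D} φ f dκ = -2i ∫_D ∂̄φ f`
(`stokesHolds`), which a partition of unity reduces to the divergence theorem on rectangles in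
charts that shear the boundary to a line. Taking for `φ` a large radial cutoff minus small cutoffs
at the poles, each pole contributes through `∫ ∂̄χ/(κ - c) = -π`, and the large cutoff drops out
because `κ f(κ)` tends to zero (`integral_frontier_eq_residues`).

The right-hand side of (i) is analytic on all of `A`, as one sees by differentiating under the
integral and from the holomorphy of the branches. It is therefore the continuation in (iii), and its
value at `E` is the limit from above in (ii). The limit from below is the adjoint.

For the hermitian components, the reflection principle gives `ω(-κ̄) = conj ω(κ)` and the same for
`G`. Hence `b(E)` is real and symmetric, while reflection permutes the nonreal roots in the upper
half-plane and takes `Z` to `-conj Z`, so that their sum is anti-hermitian and becomes hermitian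
after multiplication by `2πi`. Only the real roots can contribute to the anti-hermitian component of
`Σ(E ± i0)`. -/

lemma measure_le_mul_of_locally {μ ν : Measure ℝ} {C : ℝ≥0∞}
    (h : ∀ x, ∃ U ∈ 𝓝 x, ∀ S ⊆ U, MeasurableSet S → μ S ≤ C * ν S) (S : Set ℝ)
    (hS : MeasurableSet S) : μ S ≤ C * ν S := by
  choose U hU hUS using h
  obtain ⟨c, hc, hcov⟩ := TopologicalSpace.countable_cover_nhds (fun x => interior_mem_nhds.2 (hU x))
  have hne : c.Nonempty := by
    by_contra hn
    rw [not_nonempty_iff_eq_empty] at hn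
    simp only [hn, mem_empty_iff_false, iUnion_of_empty, iUnion_empty] at hcov
    exact empty_ne_univ hcov
  obtain ⟨e, rfl⟩ := hc.exists_eq_range hne
  -- The countable cover is made disjoint so that both measures are additive over the pieces of `S`.
  set V : ℕ → Set ℝ := disjointed fun n => interior (U (e n)) with hV
  have hVm : ∀ n, MeasurableSet (S ∩ V n) := fun n =>
    hS.inter (MeasurableSet.disjointed (fun n => isOpen_interior.measurableSet) n)
  have hVd : Pairwise (Function.onFun Disjoint fun n => S ∩ V n) := fun i j hij =>
    (disjoint_disjointed _ hij).mono inter_subset_right inter_subset_right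
  have hcover : S = ⋃ n, S ∩ V n := by
    rw [← inter_iUnion, hV, iUnion_disjointed]
    rw [biUnion_range] at hcov
    rw [hcov, inter_univ]
  rw [hcover, measure_iUnion hVd hVm, measure_iUnion hVd hVm, ← ENNReal.tsum_mul_left]
  exact ENNReal.tsum_le_tsum fun n => hUS (e n) _
    (inter_subset_right.trans ((disjointed_subset _ n).trans interior_subset)) (hVm n)

lemma le_of_forall_one_lt_mul {a b : ℝ≥0∞} (h : ∀ C : ℝ, 1 < C → a ≤ ENNReal.ofReal C * b) :
    a ≤ b := by
  rcases eq_or_ne b ∞ with rfl | hb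
  · exact le_top
  have h1 : Tendsto (fun C : ℝ => ENNReal.ofReal C * b) (𝓝[>] 1) (𝓝 (ENNReal.ofReal 1 * b)) :=
    ENNReal.Tendsto.mul_const
      ((ENNReal.continuous_ofReal.tendsto 1).mono_left nhdsWithin_le_nhds) (Or.inr hb)
  rw [ENNReal.ofReal_one, one_mul] at h1
  exact ge_of_tendsto h1 (by filter_upwards [self_mem_nhdsWithin] with C hC using h C hC)

/-- A continuously differentiable immersion of the line is locally almost a similarity. -/
lemma exists_nhds_bilipschitz {γ γ' : ℝ → ℂ} (hd : ∀ x, HasDerivAt γ (γ' x) x)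
    (hc : Continuous γ') (h0 : ∀ x, γ' x ≠ 0) {C : ℝ} (hC : 1 < C) (x₀ : ℝ) :
    ∃ U ∈ 𝓝 x₀, ∃ m : ℝ, 0 < m ∧ (∀ x ∈ U, m ≤ ‖γ' x‖ ∧ ‖γ' x‖ ≤ C * m) ∧
      ∀ x ∈ U, ∀ y ∈ U, m * ‖x - y‖ ≤ ‖γ x - γ y‖ ∧ ‖γ x - γ y‖ ≤ C * m * ‖x - y‖ := by
  set c := ‖γ' x₀‖ with hcdef
  have hcpos : 0 < c := norm_pos_iff.2 (h0 x₀)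
  -- This `δ` solves `c + δ = C (c - δ)`; the lower constant is then `m = c - δ`.
  set δ := c * (C - 1) / (C + 1) with hδ
  have hδpos : 0 < δ := by rw [hδ]; exact div_pos (mul_pos hcpos (by linarith)) (by linarith)
  have hm : c - δ = 2 * c / (C + 1) := by rw [hδ]; field_simp; ring
  have hM : c + δ = C * (2 * c / (C + 1)) := by rw [hδ]; field_simp; ring
  obtain ⟨r, hr, hball⟩ := Metric.continuousAt_iff.1 (hc.continuousAt (x := x₀)) δ hδpos
  have hclose : ∀ x ∈ Metric.ball x₀ r, ‖γ' x - γ' x₀‖ ≤ δ := fun x hx => by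
    rw [← dist_eq_norm]; exact (hball hx).le
  refine ⟨Metric.ball x₀ r, Metric.ball_mem_nhds _ hr, 2 * c / (C + 1), by positivity, ?_, ?_⟩
  · intro x hx
    have h1 := hclose x hx
    have h2 := norm_sub_norm_le (γ' x) (γ' x₀)
    have h3 := norm_sub_norm_le (γ' x₀) (γ' x)
    rw [norm_sub_rev] at h3
    constructor <;> linarith
  · intro x hx y hy
    -- Mean value inequality for the deviation of `γ` from its linearization at `x₀`.
    have key : ‖(γ x - x * γ' x₀) - (γ y - y * γ' x₀)‖ ≤ δ * ‖x - y‖ := by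
      refine (convex_ball x₀ r).norm_image_sub_le_of_norm_hasDerivWithin_le
        (f := fun t : ℝ => γ t - t * γ' x₀) (f' := fun t => γ' t - γ' x₀)
        (fun t _ => ?_) hclose hy hx
      have := ((hd t).sub (((hasDerivAt_id t).ofReal_comp).mul_const (γ' x₀)))
      simpa using! this.hasDerivWithinAt
    have hlin : ‖((x : ℂ) - y) * γ' x₀‖ = c * ‖x - y‖ := by
      rw [norm_mul, ← ofReal_sub, norm_real, mul_comm]
    have e : (γ x - x * γ' x₀) - (γ y - y * γ' x₀) = (γ x - γ y) - ((x : ℂ) - y) * γ' x₀ := by ring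
    rw [e] at key
    have h2 := norm_sub_norm_le (γ x - γ y) (((x : ℂ) - y) * γ' x₀)
    have h3 := norm_sub_norm_le (((x : ℂ) - y) * γ' x₀) (γ x - γ y)
    rw [norm_sub_rev (((x : ℂ) - y) * γ' x₀)] at h3
    rw [← hM, ← hm]
    constructor <;> nlinarith

/-- Where `γ` is almost a similarity of ratio `m`, both the pulled-back Hausdorff measure and the
arc length lie between `m |S|` and `C m |S|`, so each is at most `C` times the other. These local
bounds globalize, and `C` decreases to `1`. -/
theorem hausdorffMeasure_image_curve {γ γ' : ℝ → ℂ} (hd : ∀ x, HasDerivAt γ (γ' x) x)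
    (hc : Continuous γ') (h0 : ∀ x, γ' x ≠ 0) (hinj : Function.Injective γ) (S : Set ℝ)
    (hS : MeasurableSet S) :
    Measure.hausdorffMeasure 1 (γ '' S) = ∫⁻ x in S, ‖γ' x‖ₑ := by
  have hγc : Continuous γ := continuous_iff_continuousAt.2 fun x => (hd x).continuousAt
  have hemb : MeasurableEmbedding γ := hγc.measurableEmbedding hinj
  set μ : Measure ℝ := (Measure.hausdorffMeasure 1).comap γ with hμ
  set ν : Measure ℝ := volume.withDensity fun x => ‖γ' x‖ₑ with hν
  have hμS : ∀ S, μ S = Measure.hausdorffMeasure 1 (γ '' S) := fun S => hemb.comap_apply _ S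
  have hνS : ∀ S, MeasurableSet S → ν S = ∫⁻ x in S, ‖γ' x‖ₑ := fun S hS =>
    withDensity_apply _ hS
  rw [← hμS, ← hνS S hS]
  have bounds : ∀ C : ℝ, 1 < C → ∀ x₀, ∃ U ∈ 𝓝 x₀, ∀ S ⊆ U, MeasurableSet S →
      μ S ≤ ENNReal.ofReal C * ν S ∧ ν S ≤ ENNReal.ofReal C * μ S := by
    intro C hC x₀
    obtain ⟨U, hU, m, hm, hder, hlip⟩ := exists_nhds_bilipschitz hd hc h0 hC x₀
    refine ⟨U, hU, fun S hSU hS => ?_⟩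
    have hCm : 0 ≤ C * m := by positivity
    have e1 : ENNReal.ofReal m * volume S ≤ ν S := by
      rw [hνS S hS, ← setLIntegral_const]
      refine setLIntegral_mono' hS fun x hx => ?_
      rw [← ofReal_norm]
      exact ENNReal.ofReal_le_ofReal (hder x (hSU hx)).1
    have e2 : ν S ≤ ENNReal.ofReal (C * m) * volume S := by
      rw [hνS S hS, ← setLIntegral_const]
      refine setLIntegral_mono' hS fun x hx => ?_
      rw [← ofReal_norm]
      exact ENNReal.ofReal_le_ofReal (hder x (hSU hx)).2
    have e3 : μ S ≤ ENNReal.ofReal (C * m) * volume S := by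
      have hL : LipschitzOnWith (C * m).toNNReal γ S := by
        refine LipschitzOnWith.of_dist_le_mul fun x hx y hy => ?_
        rw [Real.coe_toNNReal _ hCm, dist_eq_norm, dist_eq_norm]
        exact (hlip x (hSU hx) y (hSU hy)).2
      have := hL.hausdorffMeasure_image_le zero_le_one
      rwa [ENNReal.rpow_one, hausdorffMeasure_real, ← hμS] at this
    -- The lower bound comes from the inverse of `γ`, which is Lipschitz with constant `1/m`.
    have e4 : ENNReal.ofReal m * volume S ≤ μ S := by
      have hL : LipschitzOnWith (m⁻¹).toNNReal (Function.invFun γ) (γ '' S) := by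
        refine LipschitzOnWith.of_dist_le_mul ?_
        rintro _ ⟨x, hx, rfl⟩ _ ⟨y, hy, rfl⟩
        rw [Real.coe_toNNReal _ (by positivity), dist_eq_norm, dist_eq_norm,
          Function.leftInverse_invFun hinj, Function.leftInverse_invFun hinj,
          le_inv_mul_iff₀ hm]
        exact (hlip x (hSU hx) y (hSU hy)).1
      have h1 := hL.hausdorffMeasure_image_le zero_le_one
      rw [← image_comp, Function.invFun_comp hinj, image_id, ENNReal.rpow_one,
        hausdorffMeasure_real, ← hμS] at h1
      calc ENNReal.ofReal m * volume S
          ≤ ENNReal.ofReal m * (ENNReal.ofReal m⁻¹ * μ S) := by gcongr; exact h1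
        _ = μ S := by
          rw [← mul_assoc, ← ENNReal.ofReal_mul hm.le, mul_inv_cancel₀ hm.ne',
            ENNReal.ofReal_one, one_mul]
    have hsplit : ENNReal.ofReal (C * m) * volume S
        = ENNReal.ofReal C * (ENNReal.ofReal m * volume S) := by
      rw [ENNReal.ofReal_mul (by linarith), mul_assoc]
    rw [hsplit] at e2 e3
    exact ⟨e3.trans (by gcongr), e2.trans (by gcongr)⟩
  refine le_antisymm (le_of_forall_one_lt_mul fun C hC => ?_)
    (le_of_forall_one_lt_mul fun C hC => ?_)
  · refine measure_le_mul_of_locally (fun x => ?_) S hS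
    obtain ⟨U, hU, h⟩ := bounds C hC x
    exact ⟨U, hU, fun S h1 h2 => (h S h1 h2).1⟩
  · refine measure_le_mul_of_locally (fun x => ?_) S hS
    obtain ⟨U, hU, h⟩ := bounds C hC x
    exact ⟨U, hU, fun S h1 h2 => (h S h1 h2).2⟩

lemma measurableEmbedding_curve {γ γ' : ℝ → ℂ} (hd : ∀ x, HasDerivAt γ (γ' x) x)
    (hinj : Function.Injective γ) : MeasurableEmbedding γ :=
  (continuous_iff_continuousAt.2 fun x => (hd x).continuousAt).measurableEmbedding hinj

lemma restrict_hausdorffMeasure_curve {γ γ' : ℝ → ℂ} (hd : ∀ x, HasDerivAt γ (γ' x) x)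
    (hc : Continuous γ') (h0 : ∀ x, γ' x ≠ 0) (hinj : Function.Injective γ)
    {S : Set ℝ} (hS : MeasurableSet S) :
    (Measure.hausdorffMeasure 1).restrict (γ '' S) =
      ((volume.restrict S).withDensity fun x => (‖γ' x‖₊ : ℝ≥0∞)).map γ := by
  have hemb := measurableEmbedding_curve hd hinj
  ext B hB
  rw [hemb.map_apply, Measure.restrict_apply hB, inter_comm, image_inter_preimage γ S B |>.symm,
    hausdorffMeasure_image_curve hd hc h0 hinj _ (hS.inter (hemb.measurable hB)),
    withDensity_apply _ (hemb.measurable hB), Measure.restrict_restrict (hemb.measurable hB),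
    inter_comm]
  rfl

theorem integrableOn_curve_iff {γ γ' : ℝ → ℂ} (hd : ∀ x, HasDerivAt γ (γ' x) x)
    (hc : Continuous γ') (h0 : ∀ x, γ' x ≠ 0) (hinj : Function.Injective γ)
    {S : Set ℝ} (hS : MeasurableSet S) (f : ℂ → ℂ) :
    IntegrableOn f (γ '' S) (Measure.hausdorffMeasure 1) ↔
      IntegrableOn (fun x => (‖γ' x‖ : ℂ) * f (γ x)) S := by
  rw [IntegrableOn, restrict_hausdorffMeasure_curve hd hc h0 hinj hS,
    (measurableEmbedding_curve hd hinj).integrable_map_iff,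
    integrable_withDensity_iff_integrable_smul₀ (by fun_prop)]
  rfl

theorem setIntegral_curve {γ γ' : ℝ → ℂ} (hd : ∀ x, HasDerivAt γ (γ' x) x)
    (hc : Continuous γ') (h0 : ∀ x, γ' x ≠ 0) (hinj : Function.Injective γ)
    {S : Set ℝ} (hS : MeasurableSet S) (f : ℂ → ℂ) :
    ∫ κ in γ '' S, f κ ∂(Measure.hausdorffMeasure 1) = ∫ x in S, (‖γ' x‖ : ℂ) * f (γ x) := by
  rw [restrict_hausdorffMeasure_curve hd hc h0 hinj hS,
    (measurableEmbedding_curve hd hinj).integral_map,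
    integral_withDensity_eq_integral_smul₀ (by fun_prop)]
  rfl

/-! ### Charts at smooth boundary points -/

/-- The coordinates which shear the graph of `g`, in a rotated frame at `p`, to the real axis. -/
noncomputable def shear (p T : ℂ) (g : ℝ → ℝ) (q : ℝ × ℝ) : ℂ :=
  p + T * ((q.1 : ℂ) + ((g q.1 + q.2 : ℝ) : ℂ) * I)

section Shear

variable {p T : ℂ} {g : ℝ → ℝ}

lemma continuous_shear (hg : Continuous g) : Continuous (shear p T g) := by
  unfold shear; fun_prop

/-- The shear as a homeomorphism. -/
noncomputable def shearHomeomorph (p : ℂ) {T : ℂ} (hT : ‖T‖ = 1) {g : ℝ → ℝ} (hg : Continuous g) :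
    ℝ × ℝ ≃ₜ ℂ where
  toFun := shear p T g
  invFun κ := (((κ - p) / T).re, ((κ - p) / T).im - g ((κ - p) / T).re)
  left_inv q := by
    have hT0 : T ≠ 0 := norm_pos_iff.1 (by rw [hT]; exact one_pos)
    have : (shear p T g q - p) / T = (q.1 : ℂ) + ((g q.1 + q.2 : ℝ) : ℂ) * I := by
      rw [shear]; field_simp; ring
    ext <;> simp [this]
  right_inv κ := by
    have hT0 : T ≠ 0 := norm_pos_iff.1 (by rw [hT]; exact one_pos)
    simp only [shear, add_sub_cancel, re_add_im]
    field_simp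
    ring
  continuous_toFun := continuous_shear hg
  continuous_invFun := by fun_prop

lemma coe_shearHomeomorph (hT : ‖T‖ = 1) (hg : Continuous g) :
    ⇑(shearHomeomorph p hT hg) = shear p T g := rfl

/-- The shear is a composition of fibrewise translations, the identification of the plane with `ℂ`,
a rotation and a translation. -/
lemma measurePreserving_shear (hT : ‖T‖ = 1) (hg : Continuous g) :
    MeasurePreserving (shear p T g) volume volume := by
  have h1 : MeasurePreserving (fun q : ℝ × ℝ => (q.1, g q.1 + q.2)) volume volume := by
    refine (MeasurePreserving.id volume).skew_product (g := fun x t => g x + t)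
      (by fun_prop) (Eventually.of_forall fun x => ?_)
    exact (measurePreserving_add_left volume (g x)).map_eq
  have h2 : MeasurePreserving Complex.measurableEquivRealProd.symm volume volume :=
    Complex.volume_preserving_equiv_real_prod.symm
  have h3 : MeasurePreserving
      (rotation (⟨T, by simpa [Submonoid.unitSphere] using hT⟩ : Circle)) volume volume :=
    LinearIsometryEquiv.measurePreserving _
  have h4 := ((measurePreserving_add_left volume p).comp h3).comp (h2.comp h1)
  convert! h4 using 1
  funext q
  simp only [shear, Function.comp_apply, measurableEquivRealProd_symm_apply, mk_eq_add_mul_I]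
  rfl

lemma hasDerivAt_shear_fst (hg : ContDiff ℝ 2 g) (x t : ℝ) :
    HasDerivAt (fun x => shear p T g (x, t)) (T * (1 + ((deriv g x : ℝ) : ℂ) * I)) x := by
  have h1 : HasDerivAt g (deriv g x) x := (hg.differentiable (by norm_num) x).hasDerivAt
  have h2 := (((hasDerivAt_id x).ofReal_comp.add
    (((h1.add_const t).ofReal_comp).mul_const I)).const_mul T).const_add p
  simpa [shear] using! h2

lemma hasDerivAt_shear_snd (x t : ℝ) :
    HasDerivAt (fun t => shear p T g (x, t)) (T * I) t := by
  have h2 := (((((hasDerivAt_id t).const_add (g x)).ofReal_comp.mul_const I).const_add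
    (x : ℂ)).const_mul T).const_add p
  simpa [shear] using! h2

end Shear

/-- Frontiers are local and commute with homeomorphisms, and inside the box the preimage of `D`
coincides with a half-plane. -/
lemma frontier_shear_iff {D : Set ℂ} {p T : ℂ} {g : ℝ → ℝ} {a c : ℝ} (hT : ‖T‖ = 1)
    (hg : Continuous g)
    (h : ∀ x t, |x| < a → |t| < c → (shear p T g (x, t) ∈ D ↔ t < 0)) (x t : ℝ) (hx : |x| < a)
    (ht : |t| < c) : shear p T g (x, t) ∈ frontier D ↔ t = 0 := by
  set B : Set (ℝ × ℝ) := {q | |q.1| < a ∧ |q.2| < c} with hB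
  have hBo : IsOpen B :=
    (isOpen_lt (continuous_abs.comp continuous_fst) continuous_const).inter
      (isOpen_lt (continuous_abs.comp continuous_snd) continuous_const)
  have hxt : (x, t) ∈ B := ⟨hx, ht⟩
  have h1 : shear p T g (x, t) ∈ frontier D ↔ (x, t) ∈ frontier (shear p T g ⁻¹' D) ∩ B := by
    rw [← coe_shearHomeomorph hT hg, ← (shearHomeomorph p hT hg).preimage_frontier]
    simp [hxt]
  have h2 : shear p T g ⁻¹' D ∩ B = (univ ×ˢ Iio 0) ∩ B := by
    ext ⟨y, s⟩
    constructor
    · rintro ⟨h3, h4⟩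
      exact ⟨⟨mem_univ _, (h y s h4.1 h4.2).1 h3⟩, h4⟩
    · rintro ⟨h3, h4⟩
      exact ⟨(h y s h4.1 h4.2).2 h3.2, h4⟩
  rw [h1, ← frontier_inter_open_inter hBo, h2, frontier_inter_open_inter hBo, frontier_univ_prod_eq,
    frontier_Iio]
  simp [hxt]

/-- In the coordinates `shear p T g`, the set `D` is the lower half-plane near `p`. -/
structure IsBoundaryChart (D : Set ℂ) (p T : ℂ) (g : ℝ → ℝ) (a c : ℝ) : Prop where
  norm_eq : ‖T‖ = 1
  contDiff : ContDiff ℝ 2 g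
  apply_zero : g 0 = 0
  width_pos : 0 < a
  height_pos : 0 < c
  mem_iff : ∀ x t, |x| < a → |t| < c → (shear p T g (x, t) ∈ D ↔ t < 0)
  tangent : ∀ x, |x| < a →
    (‖T * (1 + ((deriv g x : ℝ) : ℂ) * I)‖ : ℂ) * boundaryTangent D (shear p T g (x, 0)) =
      T * (1 + ((deriv g x : ℝ) : ℂ) * I)

lemma fderiv_eq_inner_gradient (ρ : ℂ → ℝ) (p v : ℂ) : fderiv ℝ ρ p v = inner ℝ (gradient ρ p) v := by
  rw [gradient, InnerProductSpace.toDual_symm_apply]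

/-- A vector which is orthogonal to `m` and has a positive component along `I * m / |m|^2`. -/
lemma tangent_of_orthogonal {a m T : ℂ} (hm : m = T * (1 + (m / T).im * I)) (hT : ‖T‖ = 1)
    (h1 : inner ℝ a m = 0) (h2 : 0 < inner ℝ a (T * I)) :
    (‖m‖ : ℂ) * (-I * (a / ‖a‖)) = m := by
  have hT0 : T ≠ 0 := norm_pos_iff.1 (by rw [hT]; exact one_pos)
  obtain ⟨s, hs⟩ : ∃ s : ℝ, m = T * (1 + s * I) := ⟨_, hm⟩
  obtain ⟨b, hb⟩ : ∃ b : ℂ, a = T * b := ⟨a / T, by field_simp⟩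
  have hTT : T.re * T.re + T.im * T.im = 1 := by
    rw [← normSq_apply, normSq_eq_norm_sq, hT, one_pow]
  -- As `|T| = 1`, division by `T` is a rotation and preserves inner products.
  have key : ∀ w : ℂ, inner ℝ a (T * w) = b.re * w.re + b.im * w.im := by
    intro w
    rw [Complex.inner, hb]
    simp only [mul_re, mul_im, conj_re, conj_im]
    linear_combination (b.re * w.re + b.im * w.im) * hTT
  rw [hs, key] at h1
  rw [key] at h2
  simp at h1 h2
  -- Orthogonality to `1 + s i` makes `b` a real multiple of `i (1 + s i)`, and `h2` says that the
  -- factor is positive.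
  have hb' : b = b.im * (I * (1 + s * I)) := by
    apply Complex.ext
    · simp; linarith
    · simp
  have hna : ‖a‖ = b.im * ‖m‖ := by
    rw [hb, norm_mul, hT, one_mul, hb', norm_mul, norm_mul, norm_I, hs, norm_mul, hT]
    simp [abs_of_pos h2]
  have hm0 : m ≠ 0 := by
    intro h0
    rw [hs] at h0
    have := congrArg Complex.re ((mul_eq_zero.1 h0).resolve_left hT0)
    simp at this
  have hm0' : (‖m‖ : ℂ) ≠ 0 := by simpa using hm0
  have hbi : (b.im : ℂ) ≠ 0 := by exact_mod_cast h2.ne'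
  have ha : a = b.im * (I * m) := by rw [hb, hs]; nth_rewrite 1 [hb']; ring
  rw [hna, ha]
  push_cast
  field_simp
  rw [I_sq]; ring

/-- The implicit function is smooth only near `0`. Multiplying it by a bump function makes it
globally `C²` without changing it near `0`. -/
lemma exists_implicit_graph {σ : ℝ × ℝ → ℝ} (hσ : ContDiff ℝ 2 σ) (h0 : σ (0, 0) = 0)
    (hd : fderiv ℝ σ (0, 0) (0, 1) ≠ 0) :
    ∃ g : ℝ → ℝ, ContDiff ℝ 2 g ∧ g 0 = 0 ∧ ∀ᶠ x in 𝓝 0, σ (x, g x) = 0 := by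
  have hcd : ContDiffAt ℝ 2 σ (0, 0) := hσ.contDiffAt
  have hinv : (fderiv ℝ σ (0, 0) ∘L .inr ℝ ℝ ℝ).IsInvertible := by
    refine ⟨ContinuousLinearEquiv.unitsEquivAut ℝ (Units.mk0 _ hd), ?_⟩
    ext
    simp
  set ψ := hcd.implicitFunction two_ne_zero hinv with hψ
  have hψ0 : ψ 0 = 0 := hcd.implicitFunction_apply_self two_ne_zero hinv
  have hψc : ContDiffAt ℝ 2 ψ 0 := hcd.contDiffAt_implicitFunction two_ne_zero hinv
  have hψe : ∀ᶠ x in 𝓝 (0 : ℝ), σ (x, ψ x) = σ (0, 0) :=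
    hcd.eventually_apply_implicitFunction two_ne_zero hinv
  obtain ⟨r, hr, hball⟩ := Metric.eventually_nhds_iff_ball.1 (hψc.eventually (by simp))
  let χ : ContDiffBump (0 : ℝ) := ⟨r / 3, r / 2, by positivity, by linarith⟩
  refine ⟨fun x => χ x * ψ x, contDiff_iff_contDiffAt.2 fun x => ?_, by simp [hψ0], ?_⟩
  · by_cases hx : x ∈ Metric.ball (0 : ℝ) r
    · exact χ.contDiffAt.mul (hball x hx)
    · have : (fun x => χ x * ψ x) =ᶠ[𝓝 x] fun _ => 0 := by
        have hmem : (Metric.closedBall (0 : ℝ) (r / 2))ᶜ ∈ 𝓝 x := by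
          refine Metric.isClosed_closedBall.isOpen_compl.mem_nhds fun h => hx ?_
          exact Metric.closedBall_subset_ball (by linarith) h
        filter_upwards [hmem] with y hy
        rw [χ.zero_of_le_dist (le_of_lt (by simpa using hy)), zero_mul]
      exact contDiffAt_const.congr_of_eventuallyEq this
  · filter_upwards [hψe, χ.eventuallyEq_one] with x h1 h2
    rw [h2, Pi.one_apply, one_mul, h1, h0]

/-- Choose `T` so that `T i` is the outward normal `N`. The zero set of `ρ` is then a graph over the
tangent line, and near `p` the function `ρ` increases strictly along `N`, so its sign at height `t`
above the graph is that of `t`. -/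
theorem exists_isBoundaryChart {D : Set ℂ} {p : ℂ} {ρ : ℂ → ℝ} (hp : p ∈ frontier D)
    (hρ : IsDefiningFunction D p ρ) : ∃ T g a c, IsBoundaryChart D p T g a c := by
  set N : ℂ := gradient ρ p / (‖gradient ρ p‖ : ℂ) with hN
  have hgpos : 0 < ‖gradient ρ p‖ := norm_pos_iff.2 hρ.gradient_ne_zero
  have hN1 : ‖N‖ = 1 := by rw [hN, norm_div, norm_real, norm_norm, div_self hgpos.ne']
  set T : ℂ := -I * N with hT
  have hT1 : ‖T‖ = 1 := by rw [hT, norm_mul, norm_neg, norm_I, hN1, one_mul]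
  have hTI : T * I = N := by rw [hT]; linear_combination (-N) * I_mul_I
  have hρN : 0 < fderiv ℝ ρ p N := by
    rw [fderiv_eq_inner_gradient, hN, div_eq_inv_mul, ← ofReal_inv, ← real_smul, inner_smul_right,
      real_inner_self_eq_norm_sq]
    positivity
  have hρ2 : ContDiff ℝ 2 ρ := hρ.contDiff.of_le (WithTop.coe_le_coe.2 (le_top : (2 : ℕ∞) ≤ ⊤))
  have hρd : ∀ κ, HasFDerivAt ρ (fderiv ℝ ρ κ) κ := fun κ =>
    (hρ2.differentiable (by norm_num) κ).hasFDerivAt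
  have hρ0 := hρ.apply_eq_zero hp
  set σ : ℝ × ℝ → ℝ := fun q => ρ (p + T * ((q.1 : ℂ) + (q.2 : ℂ) * I)) with hσ
  have hσc : ContDiff ℝ 2 σ := by
    refine hρ2.comp ?_
    have h1 : ContDiff ℝ 2 fun q : ℝ × ℝ => (q.1 : ℂ) := ofRealCLM.contDiff.comp contDiff_fst
    have h2 : ContDiff ℝ 2 fun q : ℝ × ℝ => (q.2 : ℂ) := ofRealCLM.contDiff.comp contDiff_snd
    exact contDiff_const.add (contDiff_const.mul (h1.add (h2.mul contDiff_const)))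
  have hσd : fderiv ℝ σ (0, 0) (0, 1) ≠ 0 := by
    have h1 : HasDerivAt (fun t : ℝ => σ (0, t)) (fderiv ℝ σ (0, 0) (0, 1)) 0 :=
      (hσc.differentiable (by norm_num) (0, 0)).hasFDerivAt.comp_hasDerivAt (0 : ℝ)
        ((hasDerivAt_const (0 : ℝ) (0 : ℝ)).prodMk (hasDerivAt_id (0 : ℝ)))
    have h2 : HasDerivAt (fun t : ℝ => σ (0, t)) (fderiv ℝ ρ p N) 0 := by
      have h3 := hasDerivAt_shear_snd (p := p) (T := T) (g := fun _ => 0) 0 0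
      have h4 : shear p T (fun _ => 0) (0, 0) = p := by simp [shear]
      have h5 := (hρd (shear p T (fun _ => 0) (0, 0))).comp_hasDerivAt (0 : ℝ) h3
      rw [h4, hTI] at h5
      refine h5.congr_of_eventuallyEq (Eventually.of_forall fun t => ?_)
      simp [σ, shear]
    rw [h1.unique h2]
    exact hρN.ne'
  obtain ⟨g, hg, hg0, hge⟩ := exists_implicit_graph hσc (by simp [hσ, hρ0]) hσd
  have hgcont : Continuous g := hg.continuous
  have hΨc := continuous_shear (p := p) (T := T) hgcont
  have hΨ0 : shear p T g (0, 0) = p := by simp [shear, hg0]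
  have hcontN : Continuous fun κ => fderiv ℝ ρ κ N :=
    (hρ2.continuous_fderiv (by norm_num)).clm_apply continuous_const
  have hnear : ∀ᶠ κ in 𝓝 p, 0 < fderiv ℝ ρ κ N ∧ ∀ᶠ κ' in 𝓝 κ, κ' ∈ D ↔ ρ κ' < 0 :=
    (hcontN.continuousAt.eventually (lt_mem_nhds hρN)).and hρ.mem_iff.eventually_nhds
  have hnear' : ∀ᶠ q in 𝓝 ((0 : ℝ), (0 : ℝ)), 0 < fderiv ℝ ρ (shear p T g q) N ∧
      ∀ᶠ κ' in 𝓝 (shear p T g q), κ' ∈ D ↔ ρ κ' < 0 :=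
    hΨc.continuousAt.eventually (by rw [hΨ0]; exact hnear)
  obtain ⟨r, hr, hball⟩ := Metric.eventually_nhds_iff_ball.1 hnear'
  obtain ⟨s, hs, hsball⟩ := Metric.eventually_nhds_iff_ball.1 hge
  set a := min r s with ha
  have hbox : ∀ x t : ℝ, |x| < a → |t| < r → 0 < fderiv ℝ ρ (shear p T g (x, t)) N ∧
      ∀ᶠ κ' in 𝓝 (shear p T g (x, t)), κ' ∈ D ↔ ρ κ' < 0 := fun x t hx ht => by
    refine hball (x, t) ?_
    rw [mem_ball_iff_norm, sub_eq_add_neg]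
    simp only [Prod.norm_def, sup_lt_iff, Prod.neg_mk, neg_zero, Prod.mk_add_mk, add_zero]
    exact ⟨hx.trans_le (min_le_left _ _), ht⟩
  have hzero : ∀ x : ℝ, |x| < a → ρ (shear p T g (x, 0)) = 0 := fun x hx => by
    have := hsball x (by rw [mem_ball_zero_iff]; exact hx.trans_le (min_le_right _ _))
    simpa [hσ, shear] using this
  have hmem : ∀ x t, |x| < a → |t| < r → (shear p T g (x, t) ∈ D ↔ t < 0) := by
    intro x t hx ht
    have hmono : StrictMonoOn (fun t => ρ (shear p T g (x, t))) (Ioo (-r) r) := by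
      have hder : ∀ t, HasDerivAt (fun t => ρ (shear p T g (x, t)))
          (fderiv ℝ ρ (shear p T g (x, t)) N) t := fun t => by
        rw [← hTI]
        exact (hρd _).comp_hasDerivAt t (hasDerivAt_shear_snd x t)
      refine strictMonoOn_of_deriv_pos (convex_Ioo _ _)
        (fun t _ => (hder t).continuousAt.continuousWithinAt) fun t ht => ?_
      rw [interior_Ioo] at ht
      rw [(hder t).deriv]
      exact (hbox x t hx (abs_lt.2 ht)).1
    rw [(hbox x t hx ht).2.self_of_nhds, ← hmono.lt_iff_lt (abs_lt.1 ht)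
      (⟨by linarith, hr⟩ : (0 : ℝ) ∈ Ioo (-r) r), hzero x hx]
  refine ⟨T, g, a, r, hT1, hg, hg0, lt_min hr hs, hr, hmem, fun x hx => ?_⟩
  have hfr : shear p T g (x, 0) ∈ frontier D :=
    (frontier_shear_iff hT1 hgcont hmem x 0 hx (by simpa using hr)).2 rfl
  have hbx := hbox x 0 hx (by simpa using hr)
  -- The same `ρ` defines `D` at the neighbouring boundary points and so computes the tangent there
  -- as well.
  have hρ' : IsDefiningFunction D (shear p T g (x, 0)) ρ := by
    refine ⟨hρ.contDiff, fun h => ?_, hbx.2⟩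
    have := hbx.1
    rw [fderiv_eq_inner_gradient, h, inner_zero_left] at this
    exact lt_irrefl _ this
  rw [boundaryTangent, outwardNormal_eq hfr hρ']
  have hT0 : T ≠ 0 := norm_pos_iff.1 (by rw [hT1]; exact one_pos)
  refine tangent_of_orthogonal (T := T) ?_ hT1 ?_ ?_
  · rw [mul_div_cancel_left₀ _ hT0]; simp
  · rw [← fderiv_eq_inner_gradient]
    -- Since `ρ` vanishes along the boundary curve, its differential annihilates the velocity of the
    -- curve.
    have h1 := (hρd (shear p T g (x, 0))).comp_hasDerivAt x (hasDerivAt_shear_fst hg x 0)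
    refine h1.unique ((hasDerivAt_const x (0 : ℝ)).congr_of_eventuallyEq ?_)
    have : ∀ᶠ y in 𝓝 x, |y| < a := continuous_abs.continuousAt.eventually (gt_mem_nhds hx)
    filter_upwards [this] with y hy using hzero y hy
  · rw [← fderiv_eq_inner_gradient, hTI]
    exact hbx.1

/-! ### Stokes' theorem for a domain with smooth boundary -/

/-- The Wirtinger derivative with respect to the conjugate variable. -/
noncomputable def dbar (φ : ℂ → ℂ) (κ : ℂ) : ℂ := (fderiv ℝ φ κ 1 + I * fderiv ℝ φ κ I) / 2

lemma contDiff_shear {p T : ℂ} {g : ℝ → ℝ} (hg : ContDiff ℝ 2 g) : ContDiff ℝ 2 (shear p T g) := by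
  have h1 : ContDiff ℝ 2 fun q : ℝ × ℝ => (q.1 : ℂ) := ofRealCLM.contDiff.comp contDiff_fst
  have h2 : ContDiff ℝ 2 fun q : ℝ × ℝ => ((g q.1 + q.2 : ℝ) : ℂ) :=
    ofRealCLM.contDiff.comp ((hg.comp contDiff_fst).add contDiff_snd)
  exact contDiff_const.add (contDiff_const.mul (h1.add (h2.mul contDiff_const)))

lemma linearMap_eq_re_im (L : ℂ →L[ℝ] ℂ) (v : ℂ) : L v = v.re * L 1 + v.im * L I := by
  conv_lhs => rw [← re_add_im v]
  have h1 : ((v.re : ℂ) + v.im * I) = v.re • (1 : ℂ) + v.im • I := by simp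
  rw [h1, map_add, map_smul, map_smul, real_smul, real_smul]

/-- This is `d(u dκ) = 2i ∂̄u dx ∧ dy` evaluated on the frame of the shear, whose determinant is
`1`. -/
lemma wirtinger_identity (L : ℂ →L[ℝ] ℂ) {T : ℂ} (hT : ‖T‖ = 1) (s : ℝ) :
    L (T * I) * (T * (1 + s * I)) - L (T * (1 + s * I)) * (T * I) =
      -2 * I * ((L 1 + I * L I) / 2) := by
  have h2 : L (T * (1 + s * I)) = L T + s * L (T * I) := by
    have : T * (1 + s * I) = T + s • (T * I) := by rw [real_smul]; ring
    rw [this, map_add, map_smul, real_smul]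
  have hTT : T * conj T = 1 := by rw [mul_conj, normSq_eq_norm_sq, hT]; norm_num
  have hTc : conj T = T.re - T.im * I := by
    apply Complex.ext <;> simp
  have hTr : T = T.re + T.im * I := (re_add_im T).symm
  rw [h2, linearMap_eq_re_im L T, linearMap_eq_re_im L (T * I)]
  have e1 : (T * I).re = - T.im := by simp
  have e2 : (T * I).im = T.re := by simp
  rw [e1, e2]
  push_cast
  rw [hTc] at hTT
  linear_combination (-I * L 1 + L I) * hTT + (-(T.im : ℂ) * L 1 * T + L I) * I_sq

section Rectangle

variable {p T : ℂ} {g : ℝ → ℝ}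

/-- Stokes' theorem for a rectangle in sheared coordinates. -/
theorem integral_shear_rectangle (hT : ‖T‖ = 1) (hg : ContDiff ℝ 2 g) {a c₁ c₂ : ℝ} (ha : 0 ≤ a)
    (hc : c₁ ≤ c₂) {u h : ℂ → ℂ}
    (hu : ContinuousOn (fun q => u (shear p T g q)) (Icc (-a, c₁) (a, c₂)))
    (hh : ContinuousOn (fun q => h (shear p T g q)) (Icc (-a, c₁) (a, c₂)))
    (hd : ∀ q ∈ Ioo (-a) a ×ˢ Ioo c₁ c₂, DifferentiableAt ℝ u (shear p T g q))
    (hdbar : ∀ q ∈ Ioo (-a) a ×ˢ Ioo c₁ c₂, dbar u (shear p T g q) = h (shear p T g q))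
    (hleft : ∀ t, u (shear p T g (-a, t)) = 0) (hright : ∀ t, u (shear p T g (a, t)) = 0)
    (hbot : ∀ x, u (shear p T g (x, c₁)) = 0) :
    ∫ x in (-a)..a, u (shear p T g (x, c₂)) * (T * (1 + ((deriv g x : ℝ) : ℂ) * I)) =
      -2 * I * ∫ q in Icc (-a, c₁) (a, c₂), h (shear p T g q) := by
  set m : ℝ → ℂ := fun x => T * (1 + ((deriv g x : ℝ) : ℂ) * I) with hm
  have hgd : Differentiable ℝ (deriv g) := hg.differentiable_deriv_two
  have hmd : Differentiable ℝ m := by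
    have : Differentiable ℝ fun x => ((deriv g x : ℝ) : ℂ) := fun x =>
      (hgd x).hasDerivAt.ofReal_comp.differentiableAt
    exact ((this.mul_const I).const_add 1).const_mul T
  -- In sheared coordinates `u dκ = P dx - Q dt`, so the divergence `∂ₓQ + ∂ₜP` equals `-2i ∂̄u`.
  set P : ℝ × ℝ → ℂ := fun q => u (shear p T g q) * m q.1 with hP
  set Q : ℝ × ℝ → ℂ := fun q => -(u (shear p T g q) * (T * I)) with hQ
  have hΨd : Differentiable ℝ (shear p T g) := (contDiff_shear hg).differentiable (by norm_num)
  have hud : ∀ q ∈ Ioo (-a) a ×ˢ Ioo c₁ c₂,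
      DifferentiableAt ℝ (fun q => u (shear p T g q)) q := fun q hq => (hd q hq).comp q (hΨd q)
  have hPd : ∀ q ∈ Ioo (-a) a ×ˢ Ioo c₁ c₂, DifferentiableAt ℝ P q := fun q hq =>
    (hud q hq).mul ((hmd q.1).comp q differentiableAt_fst)
  have hQd : ∀ q ∈ Ioo (-a) a ×ˢ Ioo c₁ c₂, DifferentiableAt ℝ Q q := fun q hq =>
    ((hud q hq).mul_const _).neg
  have hdiv : ∀ q ∈ Ioo (-a) a ×ˢ Ioo c₁ c₂,
      fderiv ℝ Q q (1, 0) + fderiv ℝ P q (0, 1) = -2 * I * h (shear p T g q) := by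
    rintro ⟨x, t⟩ hq
    set L := fderiv ℝ u (shear p T g (x, t)) with hL
    have hL' : HasFDerivAt u L (shear p T g (x, t)) := (hd _ hq).hasFDerivAt
    have e1 : fderiv ℝ Q (x, t) (1, 0) = -(L (m x) * (T * I)) := by
      have h1 : HasDerivAt (fun x => Q (x, t)) (fderiv ℝ Q (x, t) (1, 0)) x :=
        (hQd _ hq).hasFDerivAt.comp_hasDerivAt x
          ((hasDerivAt_id x).prodMk (hasDerivAt_const x t))
      exact h1.unique ((hL'.comp_hasDerivAt x (hasDerivAt_shear_fst hg x t)).mul_const (T * I)).neg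
    have e2 : fderiv ℝ P (x, t) (0, 1) = L (T * I) * m x := by
      have h1 : HasDerivAt (fun t => P (x, t)) (fderiv ℝ P (x, t) (0, 1)) t :=
        (hPd _ hq).hasFDerivAt.comp_hasDerivAt t
          ((hasDerivAt_const t x).prodMk (hasDerivAt_id t))
      exact h1.unique ((hL'.comp_hasDerivAt t (hasDerivAt_shear_snd x t)).mul_const (m x))
    rw [e1, e2, ← hdbar _ hq, dbar, ← wirtinger_identity L hT (deriv g x)]
    ring
  -- The divergence is known only in the open rectangle; the edges are a null set.
  have hae : (Ioo (-a) a ×ˢ Ioo c₁ c₂ : Set (ℝ × ℝ)) =ᵐ[volume] Icc (-a, c₁) (a, c₂) := by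
    rw [← Icc_prod_Icc]
    exact Measure.set_prod_ae_eq Ioo_ae_eq_Icc Ioo_ae_eq_Icc
  have hms : MeasurableSet (Ioo (-a) a ×ˢ Ioo c₁ c₂ : Set (ℝ × ℝ)) :=
    measurableSet_Ioo.prod measurableSet_Ioo
  have hint : IntegrableOn (fun q => -2 * I * h (shear p T g q)) (Icc (-a, c₁) (a, c₂)) :=
    (hh.const_mul _).integrableOn_compact isCompact_Icc
  have hint' : IntegrableOn (fun q => fderiv ℝ Q q (1, 0) + fderiv ℝ P q (0, 1))
      (Icc (-a, c₁) (a, c₂)) := by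
    refine IntegrableOn.congr_set_ae ?_ hae.symm
    exact (hint.congr_set_ae hae).congr_fun (fun q hq => (hdiv q hq).symm) hms
  have main := integral_divergence_prod_Icc_of_hasFDerivAt_off_countable_of_le Q P
    (fderiv ℝ Q) (fderiv ℝ P) (-a, c₁) (a, c₂) ⟨by simpa using by linarith, hc⟩ ∅ countable_empty
    (hu.mul_const _).neg (hu.mul (hmd.continuous.comp continuous_fst).continuousOn)
    (fun q hq => (hQd q hq.1).hasFDerivAt) (fun q hq => (hPd q hq.1).hasFDerivAt) hint'
  rw [← setIntegral_congr_set hae, setIntegral_congr_fun hms hdiv, setIntegral_congr_set hae,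
    integral_const_mul] at main
  rw [main]
  simp [hP, hQ, hleft, hright, hbot, hm]

end Rectangle

lemma dbar_of_notMem_tsupport {φ : ℂ → ℂ} {κ : ℂ} (h : κ ∉ tsupport φ) : dbar φ κ = 0 := by
  have : fderiv ℝ φ κ = 0 := by
    rw [(notMem_tsupport_iff_eventuallyEq.1 h).fderiv_eq]
    simp
  simp [dbar, this]

lemma tsupport_dbar_subset (φ : ℂ → ℂ) : tsupport (dbar φ) ⊆ tsupport φ := by
  refine closure_minimal (fun κ hκ => ?_) (isClosed_tsupport φ)
  by_contra h
  exact hκ (dbar_of_notMem_tsupport h)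

lemma continuous_dbar {φ : ℂ → ℂ} (hφ : ContDiff ℝ 1 φ) : Continuous (dbar φ) := by
  have h := hφ.continuous_fderiv (by norm_num)
  unfold dbar
  fun_prop

lemma dbar_add {φ ψ : ℂ → ℂ} {κ : ℂ} (hφ : DifferentiableAt ℝ φ κ) (hψ : DifferentiableAt ℝ ψ κ) :
    dbar (φ + ψ) κ = dbar φ κ + dbar ψ κ := by
  simp only [dbar, fderiv_add hφ hψ, _root_.add_apply]
  ring

/-- Nothing is known about `f` outside `V`, but there `χ` vanishes locally. In this way the poles of
`f` are cut out. -/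
lemma continuousOn_mul_of_tsupport {χ f : ℂ → ℂ} {V S : Set ℂ} (hV : IsOpen V)
    (hχ : Continuous χ) (hf : ContinuousOn f (V ∩ S)) (h : tsupport χ ⊆ V) :
    ContinuousOn (fun κ => χ κ * f κ) S := by
  intro κ hκ
  by_cases hmem : κ ∈ tsupport χ
  · refine hχ.continuousWithinAt.mul ?_
    exact (hf κ ⟨h hmem, hκ⟩).mono_of_mem_nhdsWithin
      (inter_mem_nhdsWithin _ (hV.mem_nhds (h hmem)) |> fun h => by rwa [inter_comm])
  · refine ContinuousAt.continuousWithinAt ?_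
    refine continuousAt_const.congr (f := fun _ => (0 : ℂ)) ?_
    filter_upwards [notMem_tsupport_iff_eventuallyEq.1 hmem] with x hx
    simp [hx]

lemma dbar_mul_analytic {φ f : ℂ → ℂ} {κ : ℂ} (hφ : DifferentiableAt ℝ φ κ)
    (hf : DifferentiableAt ℂ f κ) :
    DifferentiableAt ℝ (fun κ => φ κ * f κ) κ ∧ dbar (fun κ => φ κ * f κ) κ = f κ * dbar φ κ := by
  have h1 := hf.hasDerivAt.complexToReal_fderiv
  have h2 := hφ.hasFDerivAt.fun_mul h1
  refine ⟨h2.differentiableAt, ?_⟩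
  rw [dbar, h2.fderiv, dbar]
  simp
  linear_combination (φ κ * deriv f κ / 2) * I_mul_I

lemma dbar_mul_of_tsupport {φ f : ℂ → ℂ} {D V : Set ℂ} (hV : IsOpen V) (hD : IsOpen D)
    (hφ : Differentiable ℝ φ) (hf : DifferentiableOn ℂ f (V ∩ D)) (h : tsupport φ ⊆ V) {κ : ℂ}
    (hκ : κ ∈ D) :
    DifferentiableAt ℝ (fun κ => φ κ * f κ) κ ∧ dbar (fun κ => φ κ * f κ) κ = dbar φ κ * f κ := by
  by_cases hmem : κ ∈ tsupport φ
  · have := dbar_mul_analytic (hφ κ)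
      (hf.differentiableAt ((hV.inter hD).mem_nhds ⟨h hmem, hκ⟩))
    exact ⟨this.1, this.2.trans (mul_comm _ _)⟩
  · have h0 : (fun κ => φ κ * f κ) =ᶠ[𝓝 κ] fun _ => 0 := by
      filter_upwards [notMem_tsupport_iff_eventuallyEq.1 hmem] with x hx
      simp [hx]
    refine ⟨(differentiableAt_const _).congr_of_eventuallyEq h0, ?_⟩
    rw [dbar, h0.fderiv_eq, dbar_of_notMem_tsupport hmem]
    simp

/-- Stokes' theorem for the function `f` in the domain `D`, tested against `φ`. -/
def StokesHolds (D : Set ℂ) (f φ : ℂ → ℂ) : Prop :=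
  IntegrableOn (fun κ => φ κ * f κ * boundaryTangent D κ) (frontier D)
      (Measure.hausdorffMeasure 1) ∧
    IntegrableOn (fun κ => dbar φ κ * f κ) D ∧
    ∫ κ in frontier D, φ κ * f κ * boundaryTangent D κ ∂(Measure.hausdorffMeasure 1) =
      -2 * I * ∫ κ in D, dbar φ κ * f κ

lemma StokesHolds.zero (D : Set ℂ) (f : ℂ → ℂ) : StokesHolds D f 0 := by
  have : dbar 0 = 0 := by
    funext κ
    refine dbar_of_notMem_tsupport ?_
    simp
  simp [StokesHolds, this]

lemma StokesHolds.add {D : Set ℂ} {f φ ψ : ℂ → ℂ} (hφ : Differentiable ℝ φ)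
    (hψ : Differentiable ℝ ψ) (h1 : StokesHolds D f φ) (h2 : StokesHolds D f ψ) :
    StokesHolds D f (φ + ψ) := by
  have e1 : (fun κ => (φ + ψ) κ * f κ * boundaryTangent D κ) = fun κ =>
      φ κ * f κ * boundaryTangent D κ + ψ κ * f κ * boundaryTangent D κ := by
    funext κ; simp only [Pi.add_apply]; ring
  have e2 : (fun κ => dbar (φ + ψ) κ * f κ) = fun κ => dbar φ κ * f κ + dbar ψ κ * f κ := by
    funext κ; rw [dbar_add (hφ κ) (hψ κ)]; ring
  refine ⟨?_, ?_, ?_⟩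
  · rw [e1]; exact h1.1.add h2.1
  · rw [e2]; exact h1.2.1.add h2.2.1
  · rw [e1, e2, integral_add h1.1 h2.1, integral_add h1.2.1 h2.2.1, h1.2.2, h2.2.2]
    ring

lemma StokesHolds.sum {ι : Type*} {D : Set ℂ} {f : ℂ → ℂ} (s : Finset ι) {φ : ι → ℂ → ℂ}
    (hφ : ∀ i, Differentiable ℝ (φ i)) (h : ∀ i, StokesHolds D f (φ i)) :
    StokesHolds D f (∑ i ∈ s, φ i) := by
  classical
  induction s using Finset.induction_on with
  | empty => simpa using StokesHolds.zero D f
  | insert i s hi ih =>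
    rw [Finset.sum_insert hi]
    refine (h i).add (hφ i) ?_ ih
    exact Differentiable.sum fun i _ => hφ i

section Local

variable {D V : Set ℂ} {f φ : ℂ → ℂ}

lemma stokesHolds_of_tsupport_subset_compl (hD : IsOpen D) (h : tsupport φ ⊆ (closure D)ᶜ) :
    StokesHolds D f φ := by
  have h1 : ∀ κ ∈ closure D, φ κ = 0 := fun κ hκ =>
    image_eq_zero_of_notMem_tsupport fun h2 => h h2 hκ
  have h2 : ∀ κ ∈ closure D, dbar φ κ = 0 := fun κ hκ =>
    dbar_of_notMem_tsupport fun h2 => h h2 hκ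
  have e1 : ∀ κ ∈ frontier D, φ κ * f κ * boundaryTangent D κ = 0 := fun κ hκ => by
    rw [h1 κ (frontier_subset_closure hκ)]; ring
  have e2 : ∀ κ ∈ D, dbar φ κ * f κ = 0 := fun κ hκ => by
    rw [h2 κ (subset_closure hκ), zero_mul]
  refine ⟨?_, ?_, ?_⟩
  · exact integrableOn_empty.of_forall_sdiff_eq_zero isClosed_frontier.measurableSet
      fun κ hκ => e1 κ hκ.1
  · exact integrableOn_empty.of_forall_sdiff_eq_zero hD.measurableSet fun κ hκ => e2 κ hκ.1
  · rw [setIntegral_eq_zero_of_forall_eq_zero e1, setIntegral_eq_zero_of_forall_eq_zero e2,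
      mul_zero]

/-- The interior case: `φ f` extends by zero to the plane, and the rectangle theorem on a large
square has no edge contribution. -/
lemma stokesHolds_of_tsupport_subset (hD : IsOpen D) (hV : IsOpen V)
    (hf : DifferentiableOn ℂ f (V ∩ D)) (hφ : ContDiff ℝ 1 φ) (hc : HasCompactSupport φ)
    (h : tsupport φ ⊆ V ∩ D) : StokesHolds D f φ := by
  have hfc : ContinuousOn f ((V ∩ D) ∩ univ) := by simpa using hf.continuousOn
  have hu : Continuous fun κ => φ κ * f κ := by
    rw [← continuousOn_univ]
    exact continuousOn_mul_of_tsupport (hV.inter hD) hφ.continuous hfc h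
  have hh : Continuous fun κ => dbar φ κ * f κ := by
    rw [← continuousOn_univ]
    exact continuousOn_mul_of_tsupport (hV.inter hD) (continuous_dbar hφ) hfc
      ((tsupport_dbar_subset φ).trans h)
  have hd := fun κ => dbar_mul_of_tsupport (hV.inter hD) isOpen_univ
    (hφ.differentiable (by norm_num)) (by simpa using hf) h (mem_univ κ)
  have hcs : HasCompactSupport fun κ => dbar φ κ * f κ :=
    (hc.mono' ((subset_tsupport _).trans (tsupport_dbar_subset φ))).mul_right
  have e1 : ∀ κ ∈ frontier D, φ κ * f κ * boundaryTangent D κ = 0 := fun κ hκ => by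
    rw [hD.frontier_eq] at hκ
    have h0 : φ κ = 0 := image_eq_zero_of_notMem_tsupport fun h2 => hκ.2 (h h2).2
    rw [h0, zero_mul, zero_mul]
  have e2 : ∀ κ, κ ∉ D → dbar φ κ * f κ = 0 := fun κ hκ => by
    rw [dbar_of_notMem_tsupport fun h2 => hκ (h h2).2, zero_mul]
  refine ⟨?_, (hh.integrable_of_hasCompactSupport hcs).integrableOn, ?_⟩
  · exact integrableOn_empty.of_forall_sdiff_eq_zero isClosed_frontier.measurableSet
      fun κ hκ => e1 κ hκ.1
  rw [setIntegral_eq_zero_of_forall_eq_zero e1, setIntegral_eq_integral_of_forall_compl_eq_zero e2]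
  obtain ⟨R, hR⟩ := hc.isBounded.subset_ball 0
  set a := max R 0 with ha
  have hsupp : ∀ κ, a ≤ |κ.re| ∨ a ≤ |κ.im| → κ ∉ tsupport φ := by
    rintro κ hκ hmem
    have h1 := hR hmem
    rw [mem_ball_zero_iff] at h1
    have h2 : R ≤ a := le_max_left _ _
    rcases hκ with h3 | h3
    · linarith [abs_re_le_norm κ]
    · linarith [abs_im_le_norm κ]
  have hshear : ∀ q, shear 0 1 (fun _ => 0) q = q.1 + q.2 * I := fun q => by simp [shear]
  have hzero : ∀ q : ℝ × ℝ, a ≤ |q.1| ∨ a ≤ |q.2| →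
      shear 0 1 (fun _ => 0) q ∉ tsupport φ := fun q hq => by
    refine hsupp _ ?_
    rw [hshear]
    simpa using hq
  have hvan : ∀ q : ℝ × ℝ, a ≤ |q.1| ∨ a ≤ |q.2| →
      φ (shear 0 1 (fun _ => 0) q) * f (shear 0 1 (fun _ => 0) q) = 0 := fun q hq => by
    rw [image_eq_zero_of_notMem_tsupport (hzero q hq), zero_mul]
  have ha0 : 0 ≤ a := le_max_right _ _
  have key := integral_shear_rectangle (p := 0) (T := 1) (g := fun _ => 0) (a := a) (c₁ := -a)
    (c₂ := a) (u := fun κ => φ κ * f κ) (h := fun κ => dbar φ κ * f κ) (by simp) contDiff_const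
    ha0 (by linarith) (hu.comp (continuous_shear continuous_const)).continuousOn
    (hh.comp (continuous_shear continuous_const)).continuousOn
    (fun q _ => (hd _).1) (fun q _ => (hd _).2)
    (fun t => hvan _ (Or.inl (by simpa using le_abs_self a)))
    (fun t => hvan _ (Or.inl (by simpa using le_abs_self a)))
    (fun t => hvan _ (Or.inr (by simpa using le_abs_self a)))
  have hl : ∀ x : ℝ, φ (shear 0 1 (fun _ => 0) (x, a)) = 0 := fun x =>
    image_eq_zero_of_notMem_tsupport (hzero _ (Or.inr (by simpa using le_abs_self a)))
  simp only [hl, zero_mul, intervalIntegral.integral_zero] at key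
  have hone : ‖(1 : ℂ)‖ = 1 := norm_one
  have hcz : Continuous fun _ : ℝ => (0 : ℝ) := continuous_const
  refine key.trans ?_
  rw [setIntegral_eq_integral_of_forall_compl_eq_zero]
  · congr 1
    exact ((measurePreserving_shear (p := 0) hone hcz).integral_comp
      (shearHomeomorph 0 hone hcz).measurableEmbedding (fun κ => dbar φ κ * f κ))
  · intro q hq
    rw [dbar_of_notMem_tsupport (hzero q ?_), zero_mul]
    by_contra! hcon
    exact hq ⟨⟨(abs_lt.1 hcon.1).1.le, (abs_lt.1 hcon.2).1.le⟩,
      ⟨(abs_lt.1 hcon.1).2.le, (abs_lt.1 hcon.2).2.le⟩⟩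

end Local

/-- In the chart `D` becomes the rectangle `-c < t < 0`. As `φ` vanishes on the other three edges,
only the edge `t = 0` contributes. Area is preserved by the shear, and arc length times unit tangent
is `γ'(x) dx`. -/
theorem IsBoundaryChart.stokesHolds {D V : Set ℂ} {f φ : ℂ → ℂ} {p T : ℂ} {g : ℝ → ℝ} {a c : ℝ}
    (hch : IsBoundaryChart D p T g a c) (hD : IsOpen D) (hV : IsOpen V)
    (hf : DifferentiableOn ℂ f (V ∩ D)) (hfc : ContinuousOn f (V ∩ closure D))
    (hφ : ContDiff ℝ 1 φ) (h : tsupport φ ⊆ V)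
    (hbox : tsupport φ ⊆ shear p T g '' {q | |q.1| < a ∧ |q.2| < c}) : StokesHolds D f φ := by
  have hg := hch.contDiff
  have hT := hch.norm_eq
  have ha := hch.width_pos
  have hc := hch.height_pos
  have hΨc : Continuous (shear p T g) := continuous_shear hg.continuous
  have hΨinj : Function.Injective (shear p T g) := (shearHomeomorph p hT hg.continuous).injective
  have hzero : ∀ q : ℝ × ℝ, ¬ (|q.1| < a ∧ |q.2| < c) → shear p T g q ∉ tsupport φ := by
    intro q hq hmem
    obtain ⟨q', hq', he⟩ := hbox hmem
    exact hq (hΨinj he ▸ hq')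
  have hinD : ∀ q ∈ Ioo (-a) a ×ˢ Ioo (-c) 0, shear p T g q ∈ D := fun q hq =>
    (hch.mem_iff q.1 q.2 (abs_lt.2 hq.1)
      (abs_lt.2 ⟨hq.2.1, hq.2.2.trans hc⟩)).2 hq.2.2
  have hmaps : MapsTo (shear p T g) (Icc (-a, -c) (a, 0)) (closure D) := by
    have h1 : MapsTo (shear p T g) (Ioo (-a) a ×ˢ Ioo (-c) 0) D := hinD
    have h2 := h1.closure hΨc
    rwa [closure_prod_eq, closure_Ioo (by linarith), closure_Ioo (by linarith), Icc_prod_Icc] at h2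
  have hu : ContinuousOn (fun κ => φ κ * f κ) (closure D) :=
    continuousOn_mul_of_tsupport hV hφ.continuous hfc h
  have hh : ContinuousOn (fun κ => dbar φ κ * f κ) (closure D) :=
    continuousOn_mul_of_tsupport hV (continuous_dbar hφ) hfc ((tsupport_dbar_subset φ).trans h)
  have hu' : ContinuousOn (fun q => φ (shear p T g q) * f (shear p T g q)) (Icc (-a, -c) (a, 0)) :=
    hu.comp hΨc.continuousOn hmaps
  have hh' : ContinuousOn (fun q => dbar φ (shear p T g q) * f (shear p T g q))
      (Icc (-a, -c) (a, 0)) := hh.comp hΨc.continuousOn hmaps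
  have hd := fun κ (hκ : κ ∈ D) =>
    dbar_mul_of_tsupport hV hD (hφ.differentiable (by norm_num)) hf h hκ
  have hvan : ∀ q : ℝ × ℝ, ¬ (|q.1| < a ∧ |q.2| < c) →
      φ (shear p T g q) * f (shear p T g q) = 0 := fun q hq => by
    rw [image_eq_zero_of_notMem_tsupport (hzero q hq), zero_mul]
  have key := integral_shear_rectangle (p := p) (u := fun κ => φ κ * f κ)
    (h := fun κ => dbar φ κ * f κ) hT hg ha.le (by linarith) hu' hh'
    (fun q hq => (hd _ (hinD q hq)).1) (fun q hq => (hd _ (hinD q hq)).2)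
    (fun t => hvan _ fun hcon => absurd hcon.1 (by simpa using le_abs_self a))
    (fun t => hvan _ fun hcon => absurd hcon.1 (by simpa using le_abs_self a))
    (fun x => hvan _ fun hcon => absurd hcon.2 (by simpa using le_abs_self c))
  -- the area integral
  have hae : (Ioo (-a) a ×ˢ Ioo (-c) 0 : Set (ℝ × ℝ)) =ᵐ[volume] Icc (-a, -c) (a, 0) := by
    rw [← Icc_prod_Icc]
    exact Measure.set_prod_ae_eq Ioo_ae_eq_Icc Ioo_ae_eq_Icc
  have hemb : MeasurableEmbedding (shear p T g) :=
    (shearHomeomorph p hT hg.continuous).measurableEmbedding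
  have hmp := measurePreserving_shear (p := p) hT hg.continuous
  have hsub : shear p T g '' (Ioo (-a) a ×ˢ Ioo (-c) 0) ⊆ D := image_subset_iff.2 hinD
  have hoff : ∀ κ ∈ D \ shear p T g '' (Ioo (-a) a ×ˢ Ioo (-c) 0), dbar φ κ * f κ = 0 := by
    rintro κ ⟨hκ, hκ'⟩
    suffices h0 : κ ∉ tsupport φ by rw [dbar_of_notMem_tsupport h0, zero_mul]
    intro hmem
    obtain ⟨q, hq, rfl⟩ := hbox hmem
    exact hκ' ⟨q, ⟨abs_lt.1 hq.1, (abs_lt.1 hq.2).1, (hch.mem_iff q.1 q.2 hq.1 hq.2).1 hκ⟩, rfl⟩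
  have harea : ∫ κ in D, dbar φ κ * f κ =
      ∫ q in Icc (-a, -c) (a, 0), dbar φ (shear p T g q) * f (shear p T g q) := by
    rw [setIntegral_eq_of_subset_of_forall_sdiff_eq_zero hD.measurableSet hsub hoff,
      hmp.setIntegral_image_emb hemb, setIntegral_congr_set hae]
  have hareaint : IntegrableOn (fun κ => dbar φ κ * f κ) D := by
    refine IntegrableOn.of_forall_sdiff_eq_zero ?_ hD.measurableSet hoff
    rw [hmp.integrableOn_image hemb]
    exact (hh'.integrableOn_compact isCompact_Icc).congr_set_ae hae
  -- the boundary integral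
  set γ : ℝ → ℂ := fun x => shear p T g (x, 0) with hγ
  set m : ℝ → ℂ := fun x => T * (1 + ((deriv g x : ℝ) : ℂ) * I) with hm
  have hmc : Continuous m := by
    have := hg.continuous_deriv (by norm_num)
    fun_prop
  have hγd : ∀ x, HasDerivAt γ (m x) x := fun x => hasDerivAt_shear_fst hg x 0
  have hm0 : ∀ x, m x ≠ 0 := fun x hx => by
    have hT0 : T ≠ 0 := norm_pos_iff.1 (by rw [hT]; exact one_pos)
    simpa using congrArg Complex.re ((mul_eq_zero.1 hx).resolve_left hT0)
  have hγinj : Function.Injective γ := fun x y hxy => (Prod.mk.inj (hΨinj hxy)).1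
  have hfr := frontier_shear_iff hT hg.continuous hch.mem_iff
  have hbsub : γ '' Ioo (-a) a ⊆ frontier D := by
    rintro _ ⟨x, hx, rfl⟩
    exact (hfr x 0 (abs_lt.2 hx) (by simpa using hc)).2 rfl
  have hboff : ∀ κ ∈ frontier D \ γ '' Ioo (-a) a, φ κ * f κ * boundaryTangent D κ = 0 := by
    rintro κ ⟨hκ, hκ'⟩
    suffices h0 : κ ∉ tsupport φ by
      rw [image_eq_zero_of_notMem_tsupport h0, zero_mul, zero_mul]
    intro hmem
    obtain ⟨⟨x, t⟩, hq, rfl⟩ := hbox hmem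
    have ht : t = 0 := (hfr x t hq.1 hq.2).1 hκ
    subst ht
    exact hκ' ⟨x, abs_lt.1 hq.1, rfl⟩
  have htan : ∀ x ∈ Ioo (-a) a, (‖m x‖ : ℂ) * (φ (γ x) * f (γ x) * boundaryTangent D (γ x)) =
      φ (γ x) * f (γ x) * m x := fun x hx => by
    have := hch.tangent x (abs_lt.2 hx)
    linear_combination (φ (γ x) * f (γ x)) * this
  have hbc : ContinuousOn (fun x => φ (γ x) * f (γ x) * m x) (Icc (-a) a) := by
    refine ContinuousOn.mul ?_ hmc.continuousOn
    exact hu'.comp (Continuous.prodMk_left (0 : ℝ)).continuousOn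
      fun x hx => ⟨⟨hx.1, by simpa using hc.le⟩, ⟨hx.2, le_rfl⟩⟩
  refine ⟨?_, hareaint, ?_⟩
  · refine IntegrableOn.of_forall_sdiff_eq_zero ?_ isClosed_frontier.measurableSet hboff
    rw [integrableOn_curve_iff hγd hmc hm0 hγinj measurableSet_Ioo]
    exact ((hbc.integrableOn_compact isCompact_Icc).mono_set Ioo_subset_Icc_self).congr_fun
      (fun x hx => (htan x hx).symm) measurableSet_Ioo
  · rw [setIntegral_eq_of_subset_of_forall_sdiff_eq_zero isClosed_frontier.measurableSet hbsub hboff,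
      setIntegral_curve hγd hmc hm0 hγinj measurableSet_Ioo,
      setIntegral_congr_fun measurableSet_Ioo htan, harea, ← key,
      intervalIntegral.integral_of_le (by linarith), integral_Ioc_eq_integral_Ioo]

/-- **Stokes' theorem** for a holomorphic function on a domain with smooth boundary, tested against
a compactly supported function. -/
theorem stokesHolds {D V : Set ℂ} {f φ : ℂ → ℂ} (hD : IsOpen D) (hsm : HasSmoothBoundary D)
    (hV : IsOpen V) (hf : DifferentiableOn ℂ f (V ∩ D)) (hfc : ContinuousOn f (V ∩ closure D))
    (hφ : ContDiff ℝ 1 φ) (hc : HasCompactSupport φ) (h : tsupport φ ⊆ V) : StokesHolds D f φ := by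
  -- Stokes' theorem holds for test functions supported near a given point, be it interior, on the
  -- boundary or exterior.
  have hloc : ∀ p : ℂ, p ∈ tsupport φ → ∃ U, IsOpen U ∧ p ∈ U ∧ ∀ ψ : ℂ → ℂ, ContDiff ℝ 1 ψ →
      HasCompactSupport ψ → tsupport ψ ⊆ V → tsupport ψ ⊆ U → StokesHolds D f ψ := by
    intro p hp
    by_cases hpD : p ∈ D
    · exact ⟨V ∩ D, hV.inter hD, ⟨h hp, hpD⟩, fun ψ h1 h2 _ h3 =>
        stokesHolds_of_tsupport_subset hD hV hf h1 h2 h3⟩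
    by_cases hpc : p ∈ closure D
    · have hpf : p ∈ frontier D := by rw [hD.frontier_eq]; exact ⟨hpc, hpD⟩
      obtain ⟨ρ, hρ⟩ := hsm p hpf
      obtain ⟨T, g, a, c, hch⟩ := exists_isBoundaryChart hpf hρ
      refine ⟨shear p T g '' {q | |q.1| < a ∧ |q.2| < c}, ?_,
        ⟨(0, 0), ⟨by simpa using hch.width_pos, by simpa using hch.height_pos⟩,
          by simp [shear, hch.apply_zero]⟩, fun ψ h1 _ h2 h3 => ?_⟩
      · refine (shearHomeomorph p hch.norm_eq hch.contDiff.continuous).isOpenMap _ ?_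
        exact (isOpen_lt (continuous_abs.comp continuous_fst) continuous_const).inter
          (isOpen_lt (continuous_abs.comp continuous_snd) continuous_const)
      · exact hch.stokesHolds hD hV hf hfc h1 h2 h3
    · exact ⟨(closure D)ᶜ, isClosed_closure.isOpen_compl, hpc, fun ψ _ _ _ h3 =>
        stokesHolds_of_tsupport_subset_compl hD h3⟩
  choose! U hUo hpU hU using hloc
  obtain ⟨t, ht⟩ := hc.isCompact.elim_finite_subcover (fun p : tsupport φ => U p)
    (fun p => hUo p p.2) fun p hp => mem_iUnion.2 ⟨⟨p, hp⟩, hpU p hp⟩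
  -- The partition is indexed by a finite subcover, so `φ` is a finite sum of localized test
  -- functions.
  obtain ⟨χ, hχ⟩ := SmoothPartitionOfUnity.exists_isSubordinate (modelWithCornersSelf ℝ ℂ)
    (isClosed_tsupport φ) (fun i : t => U i.1) (fun i => hUo i.1 i.1.2) fun p hp => by
      obtain ⟨i, hi, hpi⟩ := mem_iUnion₂.1 (ht hp)
      exact mem_iUnion.2 ⟨⟨i, hi⟩, hpi⟩
  set ψ : t → ℂ → ℂ := fun i κ => (χ i κ : ℂ) * φ κ with hψ
  have hψd : ∀ i, ContDiff ℝ 1 (ψ i) := fun i =>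
    (ofRealCLM.contDiff.comp ((χ i).contMDiff.contDiff.of_le (by simp))).mul hφ
  have hsupp1 : ∀ i, tsupport (ψ i) ⊆ tsupport φ := fun i => tsupport_mul_subset_right
  have hsupp2 : ∀ i, tsupport (ψ i) ⊆ U i.1 := fun i => by
    refine Subset.trans ?_ (hχ i)
    refine closure_mono fun κ hκ => ?_
    rw [Function.mem_support] at hκ ⊢
    intro h0
    exact hκ (by simp [hψ, h0])
  have hsum : φ = ∑ i, ψ i := by
    funext κ
    rw [Finset.sum_apply]
    by_cases hκ : κ ∈ tsupport φ
    · have := χ.sum_eq_one hκ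
      rw [finsum_eq_sum_of_fintype] at this
      simp only [hψ, ← Finset.sum_mul]
      rw [← ofReal_sum, this]
      simp
    · simp [hψ, image_eq_zero_of_notMem_tsupport hκ]
  rw [hsum]
  refine StokesHolds.sum _ (fun i => (hψd i).differentiable (by norm_num)) fun i => ?_
  exact hU i.1 i.1.2 (ψ i) (hψd i) (hc.mono' ((subset_tsupport _).trans (hsupp1 i)))
    ((hsupp1 i).trans h) (hsupp2 i)

/-! ### Radial cutoff functions -/

/-- A smooth function which is `1` for `|κ - c| ≤ r` and `0` for `|κ - c| ≥ 2 r`. -/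
noncomputable def cutoff (c : ℂ) (r : ℝ) (κ : ℂ) : ℂ :=
  (Real.smoothTransition (2 - ‖κ - c‖ ^ 2 / r ^ 2) : ℝ)

section Cutoff

variable {c κ : ℂ} {r : ℝ}

/-- The cutoff is a function of the squared norm, which is smooth also at the centre. -/
lemma contDiff_cutoff : ContDiff ℝ 1 (cutoff c r) := by
  refine ofRealCLM.contDiff.comp (Real.smoothTransition.contDiff.comp ?_)
  exact contDiff_const.sub (((contDiff_id.sub contDiff_const).norm_sq ℝ).div_const _)

lemma cutoff_eq_one (hr : 0 < r) (h : ‖κ - c‖ ≤ r) : cutoff c r κ = 1 := by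
  rw [cutoff, Real.smoothTransition.one_of_one_le, ofReal_one]
  have : ‖κ - c‖ ^ 2 / r ^ 2 ≤ 1 := by
    rw [div_le_one (by positivity)]
    gcongr
  linarith

lemma cutoff_eq_zero (hr : 0 < r) (h : 2 * r ≤ ‖κ - c‖) : cutoff c r κ = 0 := by
  rw [cutoff, Real.smoothTransition.zero_of_nonpos, ofReal_zero]
  have : 2 ≤ ‖κ - c‖ ^ 2 / r ^ 2 := by
    rw [le_div_iff₀ (by positivity)]
    nlinarith
  linarith

lemma norm_cutoff_le_one : ‖cutoff c r κ‖ ≤ 1 := by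
  rw [cutoff, norm_real, Real.norm_of_nonneg (Real.smoothTransition.nonneg _)]
  exact Real.smoothTransition.le_one _

lemma tsupport_cutoff_subset (hr : 0 < r) : tsupport (cutoff c r) ⊆ Metric.closedBall c (2 * r) := by
  refine closure_minimal (fun κ hκ => ?_) Metric.isClosed_closedBall
  rw [mem_closedBall_iff_norm]
  by_contra! h
  exact hκ (cutoff_eq_zero hr h.le)

lemma hasCompactSupport_cutoff (hr : 0 < r) : HasCompactSupport (cutoff c r) :=
  (isCompact_closedBall c (2 * r)).of_isClosed_subset (isClosed_tsupport _)
    (tsupport_cutoff_subset hr)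

lemma hasDerivAt_smoothTransition (x : ℝ) :
    HasDerivAt Real.smoothTransition (deriv Real.smoothTransition x) x :=
  ((Real.smoothTransition.contDiff (n := 1)).differentiable (by norm_num) x).hasDerivAt

/-- Chain rule with `∂̄ |w|² = w` for `w = κ - c`. -/
lemma dbar_cutoff (c : ℂ) (r : ℝ) (κ : ℂ) : dbar (cutoff c r) κ =
    -((deriv Real.smoothTransition (2 - ‖κ - c‖ ^ 2 / r ^ 2) / r ^ 2 : ℝ) : ℂ) * (κ - c) := by
  set η := deriv Real.smoothTransition (2 - ‖κ - c‖ ^ 2 / r ^ 2) with hη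
  have h1 : HasFDerivAt (fun κ : ℂ => ‖κ - c‖ ^ 2) (2 • innerSL ℝ (κ - c)) κ := by
    have := ((hasFDerivAt_id (𝕜 := ℝ) κ).sub_const c).norm_sq
    simpa using! this
  have h2 : HasFDerivAt (fun κ : ℂ => 2 - ‖κ - c‖ ^ 2 / r ^ 2)
      (-((r ^ 2)⁻¹ • (2 • innerSL ℝ (κ - c)))) κ := by
    have := (h1.const_mul (r ^ 2)⁻¹).const_sub 2
    simpa [div_eq_inv_mul] using! this
  have h3 := (hasDerivAt_smoothTransition (2 - ‖κ - c‖ ^ 2 / r ^ 2)).comp_hasFDerivAt κ h2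
  have h4 : HasFDerivAt (cutoff c r) (ofRealCLM.comp
      (η • (-((r ^ 2)⁻¹ • (2 • innerSL ℝ (κ - c)))))) κ :=
    ofRealCLM.hasFDerivAt.comp κ h3
  rw [dbar, h4.fderiv]
  have e1 : inner ℝ (κ - c) 1 = (κ - c).re := by simp [Complex.inner]
  have e2 : inner ℝ (κ - c) I = (κ - c).im := by
    simp [Complex.inner]; ring
  simp only [ContinuousLinearMap.comp_apply, ofRealCLM_apply, _root_.smul_apply,
    _root_.neg_apply, innerSL_apply_apply, e1, e2]
  conv_rhs => rw [← re_add_im (κ - c)]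
  simp only [smul_eq_mul, nsmul_eq_mul]
  push_cast
  field_simp
  ring

lemma dbar_cutoff_of_lt (hr : 0 < r) (h : ‖κ - c‖ < r) : dbar (cutoff c r) κ = 0 := by
  have : cutoff c r =ᶠ[𝓝 κ] fun _ => 1 := by
    filter_upwards [Metric.isOpen_ball.mem_nhds (mem_ball_iff_norm.2 h)] with x hx
    exact cutoff_eq_one hr (mem_ball_iff_norm.1 hx).le
  rw [dbar, this.fderiv_eq]
  simp

lemma dbar_cutoff_of_gt (hr : 0 < r) (h : 2 * r < ‖κ - c‖) : dbar (cutoff c r) κ = 0 := by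
  refine dbar_of_notMem_tsupport fun hmem => ?_
  have := mem_closedBall_iff_norm.1 (tsupport_cutoff_subset hr hmem)
  linarith

lemma exists_norm_dbar_cutoff_le :
    ∃ M : ℝ, 0 ≤ M ∧ ∀ (c : ℂ) (r : ℝ), 0 < r → ∀ κ, ‖dbar (cutoff c r) κ‖ ≤ M / r := by
  have hcont : Continuous (deriv Real.smoothTransition) :=
    (Real.smoothTransition.contDiff (n := 1)).continuous_deriv le_rfl
  -- For `‖κ - c‖ ≤ 2 r` the argument `2 - ‖κ - c‖² / r²` lies in `[-2, 2]`.
  obtain ⟨M, hM⟩ := (isCompact_Icc (a := (-2 : ℝ)) (b := 2)).exists_bound_of_continuousOn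
    hcont.continuousOn
  have hM0 : 0 ≤ M := (norm_nonneg _).trans (hM 0 (by simp))
  refine ⟨M * 2, by positivity, fun c r hr κ => ?_⟩
  rcases le_or_gt ‖κ - c‖ (2 * r) with h | h
  · rw [dbar_cutoff, norm_mul, norm_neg, norm_real, norm_div, norm_pow,
      Real.norm_of_nonneg hr.le]
    have h1 : ‖κ - c‖ ^ 2 / r ^ 2 ≤ 4 := by
      rw [div_le_iff₀ (by positivity)]
      nlinarith [norm_nonneg (κ - c)]
    have h2 : 0 ≤ ‖κ - c‖ ^ 2 / r ^ 2 := by positivity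
    have h3 := hM (2 - ‖κ - c‖ ^ 2 / r ^ 2) ⟨by linarith, by linarith⟩
    calc _ ≤ M / r ^ 2 * (2 * r) := by gcongr
      _ = M * 2 / r := by field_simp
  · rw [dbar_cutoff_of_gt hr h, norm_zero]
    positivity

lemma dbar_cutoff_mul_inv (c : ℂ) (r : ℝ) (κ : ℂ) : dbar (cutoff c r) κ * (κ - c)⁻¹ =
    -((deriv Real.smoothTransition (2 - ‖κ - c‖ ^ 2 / r ^ 2) / r ^ 2 : ℝ) : ℂ) := by
  rcases eq_or_ne κ c with rfl | h
  -- At the centre the left side is zero by the convention `0⁻¹ = 0`, and the right side is zero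
  -- because the transition function is constant near `2`.
  · have : deriv Real.smoothTransition 2 = 0 := by
      have : Real.smoothTransition =ᶠ[𝓝 2] fun _ => 1 := by
        filter_upwards [lt_mem_nhds (by norm_num : (1 : ℝ) < 2)] with x hx
        exact Real.smoothTransition.one_of_one_le hx.le
      rw [this.deriv_eq]; simp
    simp [this]
  · rw [dbar_cutoff, mul_inv_cancel_right₀ (sub_ne_zero.2 h)]

lemma integrable_dbar_cutoff_mul_inv (hr : 0 < r) :
    Integrable fun κ => dbar (cutoff c r) κ * (κ - c)⁻¹ := by
  refine Continuous.integrable_of_hasCompactSupport ?_ ?_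
  · simp only [dbar_cutoff_mul_inv]
    have hcont : Continuous (deriv Real.smoothTransition) :=
      (Real.smoothTransition.contDiff (n := 1)).continuous_deriv le_rfl
    fun_prop
  · exact ((hasCompactSupport_cutoff hr).mono'
      ((subset_tsupport _).trans (tsupport_dbar_subset _))).mul_right

/-- The integrand is radial. In polar coordinates, `r dr` turns it into a multiple of the derivative
of the cutoff profile, which falls from `1` to `0`. -/
lemma integral_dbar_cutoff_mul_inv (hr : 0 < r) :
    ∫ κ, dbar (cutoff c r) κ * (κ - c)⁻¹ = -Real.pi := by
  simp only [dbar_cutoff_mul_inv]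
  rw [integral_sub_right_eq_self (fun w : ℂ =>
    -((deriv Real.smoothTransition (2 - ‖w‖ ^ 2 / r ^ 2) / r ^ 2 : ℝ) : ℂ)) c, integral_neg,
    integral_complex_ofReal, integral_fun_norm_addHaar volume (fun y : ℝ =>
    deriv Real.smoothTransition (2 - y ^ 2 / r ^ 2) / r ^ 2)]
  have hball : volume.real (Metric.ball (0 : ℂ) 1) = Real.pi := by
    simp [Measure.real, Complex.volume_ball]
  have hder : ∀ y : ℝ, HasDerivAt (fun y : ℝ => Real.smoothTransition (2 - y ^ 2 / r ^ 2))
      (deriv Real.smoothTransition (2 - y ^ 2 / r ^ 2) * (-(2 * y / r ^ 2))) y := fun y => by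
    have h1 : HasDerivAt (fun y : ℝ => 2 - y ^ 2 / r ^ 2) (-(2 * y / r ^ 2)) y := by
      simpa using ((hasDerivAt_pow 2 y).div_const (r ^ 2)).const_sub 2
    exact (hasDerivAt_smoothTransition _).comp y h1
  have hcd : ContDiff ℝ 1 fun y : ℝ => Real.smoothTransition (2 - y ^ 2 / r ^ 2) :=
    Real.smoothTransition.contDiff.comp (by fun_prop)
  have hcs : HasCompactSupport fun y : ℝ => Real.smoothTransition (2 - y ^ 2 / r ^ 2) := by
    refine HasCompactSupport.of_support_subset_isCompact (isCompact_closedBall (0 : ℝ) (2 * r)) ?_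
    intro y hy
    rw [mem_closedBall_zero_iff]
    by_contra! h
    refine hy (Real.smoothTransition.zero_of_nonpos ?_)
    have h2 : 2 ≤ y ^ 2 / r ^ 2 := by
      rw [le_div_iff₀ (by positivity), ← sq_abs y, ← Real.norm_eq_abs]
      nlinarith
    linarith
  have key := hcs.integral_Ioi_deriv_eq hcd 0
  simp only [(hder _).deriv] at key
  have e : ∀ y : ℝ, y ^ (Module.finrank ℝ ℂ - 1) •
      (deriv Real.smoothTransition (2 - y ^ 2 / r ^ 2) / r ^ 2) =
      (-1 / 2) * (deriv Real.smoothTransition (2 - y ^ 2 / r ^ 2) * (-(2 * y / r ^ 2))) := by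
    intro y
    rw [Complex.finrank_real_complex]
    simp only [smul_eq_mul, Nat.add_one_sub_one, pow_one]
    field_simp
  simp only [e]
  rw [integral_const_mul, key, hball, Complex.finrank_real_complex]
  have : Real.smoothTransition (2 - 0 ^ 2 / r ^ 2) = 1 :=
    Real.smoothTransition.one_of_one_le (by norm_num)
  rw [this]
  simp
  ring

end Cutoff

/-! ### The residue theorem -/

lemma dbar_sub_sum {ι : Type*} (s : Finset ι) {φ : ℂ → ℂ} {ψ : ι → ℂ → ℂ} {κ : ℂ}
    (hφ : DifferentiableAt ℝ φ κ) (hψ : ∀ i, DifferentiableAt ℝ (ψ i) κ) :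
    dbar (fun κ => φ κ - ∑ i ∈ s, ψ i κ) κ = dbar φ κ - ∑ i ∈ s, dbar (ψ i) κ := by
  have h : HasFDerivAt (fun κ => φ κ - ∑ i ∈ s, ψ i κ)
      (fderiv ℝ φ κ - ∑ i ∈ s, fderiv ℝ (ψ i) κ) κ :=
    hφ.hasFDerivAt.sub (HasFDerivAt.fun_sum fun i _ => (hψ i).hasFDerivAt)
  simp only [dbar, h.fderiv, _root_.sub_apply, _root_.sum_apply]
  rw [← Finset.sum_div, Finset.sum_add_distrib, ← Finset.mul_sum]
  ring

/-- `f` has at most a simple pole at the point `c` of `D`, and `u` is the analytic function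
`f(κ) (κ - c)`. -/
def HasPoleFactor (D : Set ℂ) (f u : ℂ → ℂ) (c : ℂ) : Prop :=
  ∃ ρ > 0, Metric.ball c ρ ⊆ D ∧ DifferentiableOn ℂ u (Metric.ball c ρ) ∧
    ∀ κ ∈ Metric.ball c ρ, κ ≠ c → f κ = u κ * (κ - c)⁻¹

/-- Split `f` near `c` into the holomorphic `dslope u c` and `u(c)/(κ - c)`. The first part
contributes zero by Stokes' theorem in the boundaryless plane, the second `-π u(c)`. -/
lemma integral_dbar_cutoff_mul_pole {D : Set ℂ} {f u : ℂ → ℂ} {c : ℂ} {ρ ε : ℝ} (hε : 0 < ε)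
    (hερ : 2 * ε < ρ) (hball : Metric.ball c ρ ⊆ D) (hu : DifferentiableOn ℂ u (Metric.ball c ρ))
    (hf : ∀ κ ∈ Metric.ball c ρ, κ ≠ c → f κ = u κ * (κ - c)⁻¹) :
    IntegrableOn (fun κ => dbar (cutoff c ε) κ * f κ) D ∧
      ∫ κ in D, dbar (cutoff c ε) κ * f κ = -Real.pi * u c := by
  have hρ : 0 < ρ := by linarith
  have hvan : ∀ κ, κ ∉ Metric.ball c ρ → dbar (cutoff c ε) κ = 0 := fun κ hκ => by
    rw [mem_ball_iff_norm, not_lt] at hκ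
    exact dbar_cutoff_of_gt hε (by linarith)
  have hst : StokesHolds univ (dslope u c) (cutoff c ε) := by
    refine stokesHolds_of_tsupport_subset isOpen_univ (Metric.isOpen_ball (x := c) (ε := ρ)) ?_
      contDiff_cutoff (hasCompactSupport_cutoff hε) ?_
    · rw [inter_univ]
      exact (Complex.differentiableOn_dslope (Metric.ball_mem_nhds c hρ)).2 hu
    · rw [inter_univ]
      exact (tsupport_cutoff_subset hε).trans (Metric.closedBall_subset_ball hερ)
  have hi1 : Integrable fun κ => dbar (cutoff c ε) κ * dslope u c κ := by
    rw [← integrableOn_univ]; exact hst.2.1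
  have hv1 : ∫ κ, dbar (cutoff c ε) κ * dslope u c κ = 0 := by
    have := hst.2.2
    rw [frontier_univ, Measure.restrict_empty, integral_zero_measure, setIntegral_univ] at this
    simpa using this.symm
  have heq : (fun κ => dbar (cutoff c ε) κ * f κ) = fun κ =>
      dbar (cutoff c ε) κ * dslope u c κ + u c * (dbar (cutoff c ε) κ * (κ - c)⁻¹) := by
    funext κ
    by_cases hκ : κ ∈ Metric.ball c ρ
    · rcases eq_or_ne κ c with rfl | hne
      -- The value of `f` at the pole itself is arbitrary, but the cutoff is constant there.
      · rw [dbar_cutoff_of_lt hε (by simpa using hε)]; ring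
      · rw [hf κ hκ hne, dslope_of_ne _ hne, slope_def_module, smul_eq_mul]; ring
    · rw [hvan κ hκ]; ring
  have hi2 := (integrable_dbar_cutoff_mul_inv (c := c) hε).const_mul (u c)
  have hi : Integrable fun κ => dbar (cutoff c ε) κ * f κ := by rw [heq]; exact hi1.add hi2
  refine ⟨hi.integrableOn, ?_⟩
  rw [setIntegral_eq_integral_of_forall_compl_eq_zero fun κ hκ => by
    rw [hvan κ fun h => hκ (hball h), zero_mul], heq, integral_add hi1 hi2, hv1,
    integral_const_mul, integral_dbar_cutoff_mul_inv hε]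
  ring

section Residues

variable {D : Set ℂ} {r : ℕ} {c : Fin r → ℂ} {f : ℂ → ℂ} {u : Fin r → ℂ → ℂ}

/-- The residue theorem in a domain with smooth boundary, with a smooth cutoff at infinity. -/
theorem eventually_integral_cutoff (hD : IsOpen D) (hsm : HasSmoothBoundary D)
    (hc : Function.Injective c) (hfd : DifferentiableOn ℂ f (D \ range c))
    (hfc : ContinuousOn f (closure D \ range c)) (hpole : ∀ s, HasPoleFactor D f (u s) (c s)) :
    ∀ᶠ R : ℝ in atTop,
      IntegrableOn (fun κ => dbar (cutoff 0 R) κ * f κ) D ∧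
      ∫ κ in frontier D, cutoff 0 R κ * f κ * boundaryTangent D κ ∂(Measure.hausdorffMeasure 1) =
        -2 * I * (∫ κ in D, dbar (cutoff 0 R) κ * f κ) -
          2 * Real.pi * I * ∑ s, u s (c s) := by
  choose ρ hρ hball hu hfu using hpole
  -- `2 ε` keeps the small cutoffs inside the pole discs; separation `3 ε` makes the `ε`-disc at one
  -- pole disjoint from the supports of the cutoffs at the others.
  obtain ⟨ε, ⟨hε1, hε2⟩, hε⟩ : ∃ ε : ℝ, ((∀ s, 2 * ε < ρ s) ∧
      ∀ s t, s ≠ t → 3 * ε ≤ ‖c s - c t‖) ∧ 0 < ε := by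
    have h1 : ∀ k : ℝ, ∀ b > 0, ∀ᶠ ε in 𝓝[>] (0 : ℝ), k * ε < b := fun k b hb => by
      have : Tendsto (fun ε : ℝ => k * ε) (𝓝[>] 0) (𝓝 (k * 0)) :=
        ((continuous_const_mul k).tendsto 0).mono_left nhdsWithin_le_nhds
      rw [mul_zero] at this
      exact this.eventually (gt_mem_nhds hb)
    refine (((eventually_all.2 fun s => h1 2 _ (hρ s)).and (eventually_all.2 fun s =>
      eventually_all.2 fun t => ?_)).and self_mem_nhdsWithin).exists
    by_cases hst : s = t
    · exact Eventually.of_forall fun _ h => absurd hst h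
    · filter_upwards [h1 3 _ (norm_pos_iff.2 (sub_ne_zero.2 (hc.ne hst)))] with ε h _ using h.le
  have hlarge : ∀ᶠ R : ℝ in atTop, ∀ s, ‖c s‖ + 2 * ε ≤ R :=
    eventually_all.2 fun s => eventually_ge_atTop _
  filter_upwards [hlarge, eventually_gt_atTop 0] with R hR hR0
  have hcd : ∀ (c : ℂ) (r : ℝ), Differentiable ℝ (cutoff c r) := fun c r =>
    contDiff_cutoff.differentiable (by norm_num)
  -- This `φ` vanishes near every pole, so Stokes' theorem applies to `f` off the poles.
  set φ : ℂ → ℂ := fun κ => cutoff 0 R κ - ∑ s, cutoff (c s) ε κ with hφ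
  have hφc : ContDiff ℝ 1 φ := contDiff_cutoff.sub (ContDiff.sum fun s _ => contDiff_cutoff)
  have hφs : HasCompactSupport φ := by
    refine HasCompactSupport.of_support_subset_isCompact (isCompact_closedBall (0 : ℂ) (2 * R)) ?_
    intro κ hκ
    rw [mem_closedBall_zero_iff]
    by_contra! h
    refine hκ ?_
    simp only [hφ]
    rw [cutoff_eq_zero hR0 (by rw [sub_zero]; exact h.le), zero_sub, neg_eq_zero]
    refine Finset.sum_eq_zero fun s _ => cutoff_eq_zero hε ?_
    have := norm_sub_norm_le κ (c s)
    linarith [hR s]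
  have hφ0 : tsupport φ ⊆ (range c)ᶜ := by
    rintro κ hκ ⟨s, rfl⟩
    refine notMem_tsupport_iff_eventuallyEq.2 ?_ hκ
    filter_upwards [Metric.ball_mem_nhds (c s) hε] with κ hκ
    rw [mem_ball_iff_norm] at hκ
    have h1 : cutoff 0 R κ = 1 := by
      refine cutoff_eq_one hR0 ?_
      have := norm_sub_norm_le κ (c s)
      rw [sub_zero]
      linarith [hR s]
    simp only [hφ, Pi.zero_apply]
    rw [h1, Finset.sum_eq_single s, cutoff_eq_one hε hκ.le, sub_self]
    · intro t _ hts
      refine cutoff_eq_zero hε ?_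
      have h2 := hε2 t s hts
      have h3 := norm_sub_norm_le (c t - c s) (κ - c s)
      rw [show c t - c s - (κ - c s) = -(κ - c t) by ring, norm_neg] at h3
      linarith
    · simp
  have hst : StokesHolds D f φ := by
    refine stokesHolds hD hsm (finite_range c).isClosed.isOpen_compl ?_ ?_ hφc hφs hφ0
    · rwa [inter_comm, ← sdiff_eq]
    · rwa [inter_comm, ← sdiff_eq]
  have hdb : ∀ κ, dbar φ κ * f κ =
      dbar (cutoff 0 R) κ * f κ - ∑ s, dbar (cutoff (c s) ε) κ * f κ := fun κ => by
    rw [hφ, dbar_sub_sum _ (hcd _ _ κ) fun s => hcd _ _ κ, sub_mul, Finset.sum_mul]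
  have hps := fun s => integral_dbar_cutoff_mul_pole hε (hε1 s) (hball s) (hu s) (hfu s)
  have hsi : IntegrableOn (fun κ => ∑ s, dbar (cutoff (c s) ε) κ * f κ) D :=
    integrable_finsetSum _ fun s _ => (hps s).1
  have hRi : IntegrableOn (fun κ => dbar (cutoff 0 R) κ * f κ) D := by
    have h1 := hst.2.1
    simp only [hdb] at h1
    convert! h1.add hsi using 1
    funext κ
    simp
  -- The small cutoffs are supported in the open set `D` and do not reach its frontier.
  have hbd : ∀ κ ∈ frontier D, φ κ * f κ * boundaryTangent D κ =
      cutoff 0 R κ * f κ * boundaryTangent D κ := fun κ hκ => by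
    have : ∑ s, cutoff (c s) ε κ = 0 := Finset.sum_eq_zero fun s _ => by
      refine cutoff_eq_zero hε ?_
      by_contra! hlt
      rw [hD.frontier_eq] at hκ
      exact hκ.2 (hball s (mem_ball_iff_norm.2 (hlt.trans (hε1 s))))
    simp only [hφ, this, sub_zero]
  refine ⟨hRi, ?_⟩
  rw [← setIntegral_congr_fun isClosed_frontier.measurableSet hbd, hst.2.2]
  simp only [hdb]
  rw [integral_sub hRi hsi, integral_finsetSum _ fun s _ => (hps s).1]
  simp only [(hps _).2]
  rw [← Finset.mul_sum]
  ring

/-- **The residue theorem** in an unbounded domain with smooth boundary. -/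
theorem integral_frontier_eq_residues (hD : IsOpen D) (hsm : HasSmoothBoundary D)
    (hc : Function.Injective c) (hfd : DifferentiableOn ℂ f (D \ range c))
    (hfc : ContinuousOn f (closure D \ range c)) (hpole : ∀ s, HasPoleFactor D f (u s) (c s))
    (hint : IntegrableOn (fun κ => f κ * boundaryTangent D κ) (frontier D)
      (Measure.hausdorffMeasure 1))
    (hdecay : ∀ ε > 0, ∀ᶠ R : ℝ in atTop, ∀ κ ∈ D, R ≤ ‖κ‖ → ‖κ‖ * ‖f κ‖ ≤ ε) :
    ∫ κ in frontier D, f κ * boundaryTangent D κ ∂(Measure.hausdorffMeasure 1) =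
      -(2 * Real.pi * I * ∑ s, u s (c s)) := by
  have hev := eventually_integral_cutoff hD hsm hc hfd hfc hpole
  have hlim1 : Tendsto (fun R : ℝ => ∫ κ in frontier D,
      cutoff 0 R κ * f κ * boundaryTangent D κ ∂(Measure.hausdorffMeasure 1)) atTop
      (𝓝 (∫ κ in frontier D, f κ * boundaryTangent D κ ∂(Measure.hausdorffMeasure 1))) := by
    refine tendsto_integral_filter_of_dominated_convergence
      (fun κ => ‖f κ * boundaryTangent D κ‖) ?_ ?_ hint.norm ?_
    · refine Eventually.of_forall fun R => ?_
      simp only [mul_assoc]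
      exact contDiff_cutoff.continuous.aestronglyMeasurable.mul hint.aestronglyMeasurable
    · refine Eventually.of_forall fun R => Eventually.of_forall fun κ => ?_
      rw [mul_assoc, norm_mul]
      exact mul_le_of_le_one_left (norm_nonneg _) norm_cutoff_le_one
    · refine Eventually.of_forall fun κ => tendsto_const_nhds.congr' ?_
      filter_upwards [eventually_ge_atTop ‖κ‖, eventually_gt_atTop 0] with R h1 h2
      rw [cutoff_eq_one h2 (by rwa [sub_zero]), one_mul]
  -- The gradient is `O(1/R)`, `f` is `o(1/R)` where it is nonzero, and the area is `O(R²)`.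
  have hlim2 : Tendsto (fun R : ℝ => ∫ κ in D, dbar (cutoff 0 R) κ * f κ) atTop (𝓝 0) := by
    obtain ⟨M, hM0, hM⟩ := exists_norm_dbar_cutoff_le
    rw [Metric.tendsto_nhds]
    intro δ hδ
    -- The summand `1` covers the case `M = 0` and makes the final inequality strict.
    set ε := δ / (4 * Real.pi * M + 1) with hε
    have hεpos : 0 < ε := by have := Real.pi_pos; positivity
    filter_upwards [hdecay ε hεpos, eventually_gt_atTop 0] with R hR hR0
    rw [dist_zero_right]
    have hoff : ∀ κ ∈ D \ (D ∩ Metric.closedBall 0 (2 * R)), dbar (cutoff 0 R) κ * f κ = 0 := by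
      rintro κ ⟨h1, h2⟩
      have h3 : κ ∉ Metric.closedBall 0 (2 * R) := fun h => h2 ⟨h1, h⟩
      rw [mem_closedBall_iff_norm, not_le] at h3
      rw [dbar_cutoff_of_gt hR0 h3, zero_mul]
    rw [setIntegral_eq_of_subset_of_forall_sdiff_eq_zero hD.measurableSet inter_subset_left hoff]
    have hvol : volume (Metric.closedBall (0 : ℂ) (2 * R)) < ∞ := measure_closedBall_lt_top
    have hbound : ∀ κ ∈ D ∩ Metric.closedBall 0 (2 * R),
        ‖dbar (cutoff 0 R) κ * f κ‖ ≤ M / R * (ε / R) := by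
      rintro κ ⟨h1, -⟩
      rcases lt_or_ge ‖κ‖ R with h | h
      · rw [dbar_cutoff_of_lt hR0 (by rwa [sub_zero]), zero_mul, norm_zero]
        positivity
      · rw [norm_mul]
        have h3 := hR κ h1 h
        have h4 : ‖f κ‖ ≤ ε / R := by
          rw [le_div_iff₀ hR0]
          nlinarith [norm_nonneg (f κ)]
        exact mul_le_mul (hM 0 R hR0 κ) h4 (norm_nonneg _) (by positivity)
    have h1 := norm_setIntegral_le_of_norm_le_const
      ((measure_mono inter_subset_right).trans_lt hvol) hbound
    have h2 : volume.real (D ∩ Metric.closedBall 0 (2 * R)) ≤ 4 * Real.pi * R ^ 2 := by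
      refine (measureReal_mono inter_subset_right hvol.ne).trans ?_
      rw [Measure.real, Complex.volume_closedBall]
      simp [hR0.le]
      apply le_of_eq
      ring
    calc _ ≤ M / R * (ε / R) * (4 * Real.pi * R ^ 2) := h1.trans (by gcongr)
      _ = ε * (4 * Real.pi * M) := by field_simp
      _ < ε * (4 * Real.pi * M + 1) := by nlinarith
      _ = δ := by
        have := Real.pi_pos
        rw [hε]; field_simp
  have hlim3 := ((hlim2.const_mul (-2 * I)).sub_const (2 * Real.pi * I * ∑ s, u s (c s))).congr'
    (hev.mono fun R h => h.2.symm)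
  rw [mul_zero, zero_sub] at hlim3
  exact tendsto_nhds_unique hlim1 hlim3

end Residues

/-! ### The upper part of a domain which contains the real line -/

lemma isOpen_upper {K : Set ℂ} (hK : IsOpen K) : IsOpen (upper K) :=
  hK.inter (isOpen_lt continuous_const continuous_im)

lemma measurableSet_upper {S : Set ℂ} (hS : MeasurableSet S) : MeasurableSet (upper S) :=
  hS.inter (isOpen_lt continuous_const continuous_im).measurableSet

lemma frontier_upper {K : Set ℂ} (hK : IsOpen K) (hreal : ∀ k : ℝ, (k : ℂ) ∈ K) :
    frontier (upper K) = range ofReal ∪ upper (frontier K) := by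
  have hre : ∀ κ : ℂ, κ.im = 0 → κ = (κ.re : ℂ) := fun κ h => by
    apply Complex.ext <;> simp [h]
  ext κ
  rw [(isOpen_upper hK).frontier_eq]
  constructor
  · rintro ⟨h1, h2⟩
    have h3 : κ ∈ closure K := closure_mono (fun _ h => h.1) h1
    have h4 : 0 ≤ κ.im := by
      have : upper K ⊆ {κ : ℂ | 0 ≤ κ.im} := fun _ h => h.2.le
      exact closure_minimal this (isClosed_le continuous_const continuous_im) h1
    rcases h4.eq_or_lt with h5 | h5
    · exact Or.inl ⟨κ.re, (hre κ h5.symm).symm⟩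
    · refine Or.inr ⟨?_, h5⟩
      rw [hK.frontier_eq]
      exact ⟨h3, fun h => h2 ⟨h, h5⟩⟩
  · rintro (⟨k, rfl⟩ | ⟨h1, h2⟩)
    · refine ⟨?_, fun h => by simpa using h.2⟩
      have hlim : Tendsto (fun t : ℝ => (k : ℂ) + t * I) (𝓝[>] 0) (𝓝 (k : ℂ)) := by
        have : Continuous fun t : ℝ => (k : ℂ) + t * I := by fun_prop
        simpa using (this.tendsto 0).mono_left nhdsWithin_le_nhds
      refine mem_closure_of_tendsto hlim ?_
      filter_upwards [hlim.eventually (hK.mem_nhds (hreal k)), self_mem_nhdsWithin] with t h1 h2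
      exact ⟨h1, by simpa using h2⟩
    · rw [hK.frontier_eq] at h1
      refine ⟨?_, fun h => h1.2 h.1⟩
      refine mem_closure_iff_nhds.2 fun t ht => ?_
      obtain ⟨y, hy, hyK⟩ := mem_closure_iff_nhds.1 h1.1 (t ∩ {κ | 0 < κ.im})
        (inter_mem ht ((isOpen_lt continuous_const continuous_im).mem_nhds h2))
      exact ⟨y, hy.1, hyK, hy.2⟩

lemma hasGradientAt_neg_im (p : ℂ) : HasGradientAt (fun κ : ℂ => -κ.im) (-I) p := by
  rw [hasGradientAt_iff_hasFDerivAt]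
  have h : (InnerProductSpace.toDual ℝ ℂ) (-I) = -imCLM := by
    ext v
    simp [Complex.inner]
  rw [h]
  exact imCLM.hasFDerivAt.neg

lemma isDefiningFunction_upper_ofReal {K : Set ℂ} (hK : IsOpen K) (hreal : ∀ k : ℝ, (k : ℂ) ∈ K)
    (k : ℝ) : IsDefiningFunction (upper K) k (fun κ : ℂ => -κ.im) := by
  refine ⟨imCLM.contDiff.neg, ?_, ?_⟩
  · rw [(hasGradientAt_neg_im _).gradient]
    simp
  · filter_upwards [hK.mem_nhds (hreal k)] with κ hκ
    simp [upper, hκ]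

lemma IsDefiningFunction.upper {K : Set ℂ} {p : ℂ} {ρ : ℂ → ℝ} (h : IsDefiningFunction K p ρ)
    (hp : 0 < p.im) : IsDefiningFunction (upper K) p ρ := by
  refine ⟨h.contDiff, h.gradient_ne_zero, ?_⟩
  filter_upwards [h.mem_iff, (isOpen_lt continuous_const continuous_im).mem_nhds hp] with κ h1 h2
  rw [← h1]
  exact ⟨fun h => h.1, fun h => ⟨h, h2⟩⟩

lemma HasSmoothBoundary.upper {K : Set ℂ} (h : HasSmoothBoundary K) (hK : IsOpen K)
    (hreal : ∀ k : ℝ, (k : ℂ) ∈ K) : HasSmoothBoundary (upper K) := by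
  intro p hp
  rw [frontier_upper hK hreal] at hp
  rcases hp with ⟨k, rfl⟩ | ⟨hp, him⟩
  · exact ⟨_, isDefiningFunction_upper_ofReal hK hreal k⟩
  · obtain ⟨ρ, hρ⟩ := h p hp
    exact ⟨ρ, hρ.upper him⟩

/-- The outward normal on the real line is `-i`, and `-i · (-i) = -1`. -/
lemma boundaryTangent_upper_ofReal {K : Set ℂ} (hK : IsOpen K) (hreal : ∀ k : ℝ, (k : ℂ) ∈ K)
    (k : ℝ) : boundaryTangent (upper K) k = -1 := by
  have hk : (k : ℂ) ∈ frontier (upper K) := by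
    rw [frontier_upper hK hreal]; exact Or.inl ⟨k, rfl⟩
  rw [boundaryTangent, outwardNormal_eq hk (isDefiningFunction_upper_ofReal hK hreal k),
    (hasGradientAt_neg_im _).gradient]
  simp

lemma boundaryTangent_upper {K : Set ℂ} (h : HasSmoothBoundary K) (hK : IsOpen K)
    (hreal : ∀ k : ℝ, (k : ℂ) ∈ K) {κ : ℂ} (hκ : κ ∈ upper (frontier K)) :
    boundaryTangent (upper K) κ = boundaryTangent K κ := by
  have hk : κ ∈ frontier (upper K) := by
    rw [frontier_upper hK hreal]; exact Or.inr hκ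
  obtain ⟨ρ, hρ⟩ := h κ hκ.1
  rw [boundaryTangent, boundaryTangent, outwardNormal_eq hk (hρ.upper hκ.2),
    outwardNormal_eq hκ.1 hρ]

lemma norm_boundaryTangent {K : Set ℂ} (h : HasSmoothBoundary K) {κ : ℂ} (hκ : κ ∈ frontier K) :
    ‖boundaryTangent K κ‖ = 1 := by
  obtain ⟨ρ, hρ⟩ := h κ hκ
  rw [boundaryTangent, outwardNormal_eq hκ hρ, norm_mul, norm_neg, norm_I, one_mul, norm_div,
    norm_real, norm_norm, div_self (norm_ne_zero_iff.2 hρ.gradient_ne_zero)]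

/-- One defining function serves at all nearby boundary points, and its normalized gradient is
continuous. This provides measurability along `Γ`. -/
lemma continuousOn_boundaryTangent {K : Set ℂ} (h : HasSmoothBoundary K) :
    ContinuousOn (boundaryTangent K) (frontier K) := by
  intro p hp
  obtain ⟨ρ, hρ⟩ := h p hp
  have hgc : Continuous (gradient ρ) := by
    have h1 : Continuous (fderiv ℝ ρ) := hρ.contDiff.continuous_fderiv (by simp)
    exact (InnerProductSpace.toDual ℝ ℂ).symm.continuous.comp h1
  have hc : ContinuousAt (fun κ => -I * (gradient ρ κ / (‖gradient ρ κ‖ : ℂ))) p := by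
    refine continuousAt_const.mul (hgc.continuousAt.div
      (continuous_ofReal.comp hgc.norm).continuousAt ?_)
    simpa using hρ.gradient_ne_zero
  refine hc.continuousWithinAt.congr_of_eventuallyEq ?_ (by rw [boundaryTangent, outwardNormal_eq hp hρ])
  filter_upwards [nhdsWithin_le_nhds (hgc.continuousAt.eventually_ne hρ.gradient_ne_zero),
    nhdsWithin_le_nhds hρ.mem_iff.eventually_nhds, self_mem_nhdsWithin] with κ h1 h2 h3
  rw [boundaryTangent, outwardNormal_eq h3 ⟨hρ.contDiff, h1, h2⟩]

lemma contourIntegrable_iff {K : Set ℂ} (h : HasSmoothBoundary K) {f : ℂ → ℂ}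
    (hf : ContinuousOn f (frontier K)) :
    ContourIntegrable K f ↔
      ∫⁻ κ in upper (frontier K), ‖f κ‖ₑ ∂(Measure.hausdorffMeasure 1) < ∞ := by
  have hm : MeasurableSet (upper (frontier K)) :=
    measurableSet_upper isClosed_frontier.measurableSet
  have hsm : AEStronglyMeasurable (fun κ => f κ * boundaryTangent K κ)
      ((Measure.hausdorffMeasure 1).restrict (upper (frontier K))) :=
    ((hf.mul (continuousOn_boundaryTangent h)).mono fun _ h => h.1).aestronglyMeasurable hm
  rw [ContourIntegrable, IntegrableOn, Integrable, and_iff_right hsm, HasFiniteIntegral]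
  rw [setLIntegral_congr_fun hm fun κ hκ => ?_]
  have := norm_boundaryTangent h hκ.1
  simp only [enorm_mul]
  rw [← ofReal_norm (boundaryTangent K κ), this, ENNReal.ofReal_one, mul_one]

/-- The boundary of the upper part of `K` consists of the real line, traversed from right to left,
and of the upper part of the boundary of `K`. -/
theorem integral_frontier_upper {K : Set ℂ} (hsm : HasSmoothBoundary K) (hK : IsOpen K)
    (hreal : ∀ k : ℝ, (k : ℂ) ∈ K) {f : ℂ → ℂ} (h1 : Integrable fun k : ℝ => f k)
    (h2 : ContourIntegrable K f) :
    IntegrableOn (fun κ => f κ * boundaryTangent (upper K) κ) (frontier (upper K))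
        (Measure.hausdorffMeasure 1) ∧
      ∫ κ in frontier (upper K), f κ * boundaryTangent (upper K) κ ∂(Measure.hausdorffMeasure 1) =
        contourIntegral K f - ∫ k : ℝ, f k := by
  have hmΓ : MeasurableSet (upper (frontier K)) :=
    measurableSet_upper isClosed_frontier.measurableSet
  have hd : ∀ x : ℝ, HasDerivAt (fun x : ℝ => (x : ℂ)) 1 x := fun x => (hasDerivAt_id x).ofReal_comp
  have e1 : ∀ k : ℝ, (‖(1 : ℂ)‖ : ℂ) * (f k * boundaryTangent (upper K) k) = -f k := fun k => by
    rw [boundaryTangent_upper_ofReal hK hreal]; simp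
  have e2 : EqOn (fun κ => f κ * boundaryTangent K κ)
      (fun κ => f κ * boundaryTangent (upper K) κ) (upper (frontier K)) := fun κ hκ => by
    simp only [boundaryTangent_upper hsm hK hreal hκ]
  have hi1 : IntegrableOn (fun κ => f κ * boundaryTangent (upper K) κ) (ofReal '' univ)
      (Measure.hausdorffMeasure 1) := by
    rw [integrableOn_curve_iff hd continuous_const (fun _ => one_ne_zero) ofReal_injective
      MeasurableSet.univ, integrableOn_univ]
    simp only [e1]
    exact h1.neg
  have hi2 : IntegrableOn (fun κ => f κ * boundaryTangent (upper K) κ) (upper (frontier K))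
      (Measure.hausdorffMeasure 1) := IntegrableOn.congr_fun h2 e2 hmΓ
  have hdisj : Disjoint (ofReal '' univ) (upper (frontier K)) := by
    rw [Set.disjoint_left]
    rintro _ ⟨k, -, rfl⟩ h
    simpa using h.2
  rw [frontier_upper hK hreal, ← image_univ]
  refine ⟨hi1.union hi2, ?_⟩
  rw [setIntegral_union hdisj hmΓ hi1 hi2, setIntegral_curve hd continuous_const
    (fun _ => one_ne_zero) ofReal_injective MeasurableSet.univ, setIntegral_univ, contourIntegral,
    setIntegral_congr_fun hmΓ e2]
  simp only [e1]
  rw [integral_neg]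
  ring

/-! ### The inverse branches of the dispersion relation -/

/-- Suppose `Ω'` vanishes at `σ(z)`. If it vanishes identically nearby, `Ω` is locally constant,
contradicting `Ω(σ(y)) = y`. If the zero is isolated, `σ` is holomorphic on a punctured
neighbourhood of `z`, hence at `z` by continuity, and the chain rule gives `0 = 1`. -/
lemma deriv_ne_zero_of_continuous_rightInverse {Ω σ : ℂ → ℂ} {K A : Set ℂ}
    (hΩ : AnalyticOnNhd ℂ Ω K) (hA : IsOpen A) (hσ : ContinuousOn σ A)
    (hmem : ∀ z ∈ A, σ z ∈ K) (hinv : ∀ z ∈ A, Ω (σ z) = z) {z : ℂ} (hz : z ∈ A) :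
    deriv Ω (σ z) ≠ 0 := by
  have hcont : ∀ z ∈ A, ContinuousAt σ z := fun z hz => hσ.continuousAt (hA.mem_nhds hz)
  have hev : ∀ z ∈ A, ∀ᶠ y in 𝓝 z, Ω (σ y) = y := fun z hz => by
    filter_upwards [hA.mem_nhds hz] with y hy using hinv y hy
  have hΩz : HasDerivAt Ω (deriv Ω (σ z)) (σ z) :=
    (hΩ _ (hmem z hz)).differentiableAt.hasDerivAt
  intro h0
  rcases (hΩ _ (hmem z hz)).deriv.eventually_eq_zero_or_eventually_ne_zero with h | h
  · have hconst : ∀ᶠ κ in 𝓝 (σ z), Ω κ = Ω (σ z) := by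
      obtain ⟨r, hr, hball⟩ := Metric.eventually_nhds_iff_ball.1
        (h.and (hΩ _ (hmem z hz)).eventually_analyticAt)
      filter_upwards [Metric.ball_mem_nhds _ hr] with κ hκ
      exact Metric.isOpen_ball.is_const_of_deriv_eq_zero (convex_ball (σ z) r).isPreconnected
        (fun x hx => (hball x hx).2.differentiableAt.differentiableWithinAt)
        (fun x hx => (hball x hx).1) hκ (Metric.mem_ball_self hr)
    have hz' : ∀ᶠ y in 𝓝[≠] z, False := by
      filter_upwards [nhdsWithin_le_nhds ((hcont z hz).eventually hconst),
        nhdsWithin_le_nhds (hev z hz), self_mem_nhdsWithin] with y h1 h2 h3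
      exact h3 (by rw [← h2, h1, hinv z hz]; rfl)
    exact hz'.exists.elim fun _ h => h
  · have hdiff : ∀ᶠ y in 𝓝[≠] z, DifferentiableAt ℂ σ y := by
      -- `σ` has a left inverse, hence is injective and preserves punctured neighbourhoods.
      have ht : Tendsto σ (𝓝[≠] z) (𝓝[≠] (σ z)) := by
        refine tendsto_nhdsWithin_iff.2 ⟨(hcont z hz).mono_left nhdsWithin_le_nhds, ?_⟩
        filter_upwards [nhdsWithin_le_nhds (hA.mem_nhds hz), self_mem_nhdsWithin] with y h1 h2 h3
        refine h2 ?_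
        rw [← hinv y h1, show σ y = σ z from h3, hinv z hz]; rfl
      filter_upwards [ht.eventually h, nhdsWithin_le_nhds (hA.mem_nhds hz)] with y h1 h2
      exact (HasDerivAt.of_local_left_inverse (hcont y h2)
        (hΩ _ (hmem y h2)).differentiableAt.hasDerivAt h1 (hev y h2)).differentiableAt
    have han := Complex.analyticAt_of_differentiable_on_punctured_nhds_of_continuousAt hdiff
      (hcont z hz)
    have h1 := hΩz.comp z han.differentiableAt.hasDerivAt
    have h2 : HasDerivAt (Ω ∘ σ) 1 z := (hasDerivAt_id z).congr_of_eventuallyEq (hev z hz)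
    have := h1.unique h2
    rw [h0, zero_mul] at this
    exact zero_ne_one this

section Roots

variable {r : ℕ} {K A : Set ℂ} {Ω : ℂ → ℂ} {kap : Fin r → ℂ → ℂ} {z : ℂ}

lemma IsRootSystem.mem (h : IsRootSystem K Ω A kap) (hz : z ∈ A) (s : Fin r) :
    kap s z ∈ K ∧ Ω (kap s z) = z := by
  have : roots kap z (Sum.inl s) ∈ {κ | κ ∈ K ∧ Ω κ = z} := by
    rw [← h.range_roots z hz]; exact mem_range_self _
  exact this

lemma IsRootSystem.neg_mem (h : IsRootSystem K Ω A kap) (hz : z ∈ A) (s : Fin r) :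
    -kap s z ∈ K ∧ Ω (-kap s z) = z := by
  have : roots kap z (Sum.inr s) ∈ {κ | κ ∈ K ∧ Ω κ = z} := by
    rw [← h.range_roots z hz]; exact mem_range_self _
  exact this

lemma IsRootSystem.exists_eq (h : IsRootSystem K Ω A kap) {κ : ℂ} (hκ : κ ∈ K) (hz : Ω κ ∈ A) :
    ∃ s, κ = kap s (Ω κ) ∨ κ = -kap s (Ω κ) := by
  have : κ ∈ range (roots kap (Ω κ)) := by rw [h.range_roots _ hz]; exact ⟨hκ, rfl⟩
  obtain ⟨s | s, hs⟩ := this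
  · exact ⟨s, Or.inl hs.symm⟩
  · exact ⟨s, Or.inr hs.symm⟩

/-- The existence of continuous inverse branches excludes critical values. -/
lemma IsRootSystem.notMem_criticalValues (h : IsRootSystem K Ω A kap) (hΩ : AnalyticOnNhd ℂ Ω K)
    (hA : IsOpen A) (hz : z ∈ A) : z ∉ Ω '' criticalPoints K Ω := by
  rintro ⟨κ, ⟨hκ, hd⟩, rfl⟩
  obtain ⟨s, hs | hs⟩ := h.exists_eq hκ hz
  · rw [hs] at hd
    exact deriv_ne_zero_of_continuous_rightInverse hΩ hA (h.continuousOn s)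
      (fun y hy => (h.mem hy s).1) (fun y hy => (h.mem hy s).2) hz hd
  · rw [hs] at hd
    exact deriv_ne_zero_of_continuous_rightInverse hΩ hA (h.continuousOn s).neg
      (fun y hy => (h.neg_mem hy s).1) (fun y hy => (h.neg_mem hy s).2) hz hd

lemma IsRootSystem.deriv_ne_zero (h : IsRootSystem K Ω A kap) (hΩ : AnalyticOnNhd ℂ Ω K)
    (hA : IsOpen A) (hz : z ∈ A) (s : Fin r) : deriv Ω (kap s z) ≠ 0 :=
  deriv_ne_zero_of_continuous_rightInverse hΩ hA (h.continuousOn s)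
    (fun _ hy => (h.mem hy s).1) (fun _ hy => (h.mem hy s).2) hz

lemma IsRootSystem.hasDerivAt (h : IsRootSystem K Ω A kap) (hΩ : AnalyticOnNhd ℂ Ω K)
    (hA : IsOpen A) (hz : z ∈ A) (s : Fin r) :
    HasDerivAt (kap s) (deriv Ω (kap s z))⁻¹ z := by
  refine HasDerivAt.of_local_left_inverse ((h.continuousOn s).continuousAt (hA.mem_nhds hz))
    (hΩ _ (h.mem hz s).1).differentiableAt.hasDerivAt (h.deriv_ne_zero hΩ hA hz s) ?_
  filter_upwards [hA.mem_nhds hz] with y hy using (h.mem hy s).2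

lemma IsRootSystem.injective (h : IsRootSystem K Ω A kap) (hΩ : AnalyticOnNhd ℂ Ω K)
    (hA : IsOpen A) (hz : z ∈ A) : Function.Injective fun s => kap s z := fun s t hst => by
  have := h.injective_roots z hz (h.notMem_criticalValues hΩ hA hz)
    (a₁ := Sum.inl s) (a₂ := Sum.inl t) hst
  exact Sum.inl_injective this

/-- A closed disc in `A` is compact, so the continuous branches are bounded on it. Its preimage in
`K` is therefore bounded. -/
lemma IsRootSystem.exists_norm_sub_ge (h : IsRootSystem K Ω A kap) (hA : IsOpen A) (hz : z ∈ A) :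
    ∃ δ > 0, ∃ R : ℝ, ∀ κ ∈ K, R ≤ ‖κ‖ → δ ≤ ‖Ω κ - z‖ := by
  obtain ⟨δ, hδ, hball⟩ := Metric.nhds_basis_closedBall.mem_iff.1 (hA.mem_nhds hz)
  have hb : ∀ s, ∃ B, ∀ y ∈ Metric.closedBall z δ, ‖kap s y‖ ≤ B := fun s =>
    (isCompact_closedBall z δ).exists_bound_of_continuousOn ((h.continuousOn s).mono hball)
  choose B hB using hb
  refine ⟨δ, hδ, ∑ s, |B s| + 1, fun κ hκ hR => ?_⟩
  by_contra! hlt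
  have hmem : Ω κ ∈ Metric.closedBall z δ := mem_closedBall_iff_norm.2 hlt.le
  obtain ⟨s, hs⟩ := h.exists_eq hκ (hball hmem)
  have h1 : ‖κ‖ ≤ B s := by
    rcases hs with hs | hs
    · rw [hs]; exact hB s _ hmem
    · rw [hs, norm_neg]; exact hB s _ hmem
  have h2 : |B s| ≤ ∑ s, |B s| :=
    Finset.single_le_sum (f := fun s => |B s|) (fun i _ => abs_nonneg _) (Finset.mem_univ s)
  linarith [le_abs_self (B s)]

end Roots

/-! ### The decomposition of the self-energy in the upper half-plane -/

/-- Quotients in `[0, ∞]` make this valid for `b = 0` too: the right side is then `∞` unless `g =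
0`. -/
lemma enorm_div_le_mul {g a b : ℂ} {C : ℝ} (hC : 0 < C) (h : ‖b‖ ≤ C * ‖a‖) :
    ‖g / a‖ₑ ≤ ENNReal.ofReal C * (‖g‖ₑ / ‖b‖ₑ) := by
  rcases eq_or_ne g 0 with rfl | hg
  · simp
  rcases eq_or_ne b 0 with rfl | hb
  · rw [enorm_zero, ENNReal.div_zero (by simpa using hg), ENNReal.mul_top (by simpa using hC)]
    exact le_top
  · have hbpos : 0 < ‖b‖ := norm_pos_iff.2 hb
    have hapos : 0 < ‖a‖ := by
      by_contra! h0
      nlinarith [norm_nonneg a]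
    rw [← ofReal_norm, ← ofReal_norm, ← ofReal_norm, ← ENNReal.ofReal_div_of_pos hbpos,
      ← ENNReal.ofReal_mul hC.le, norm_div]
    refine ENNReal.ofReal_le_ofReal ?_
    rw [div_le_iff₀ hapos, mul_div_assoc', div_mul_eq_mul_div, le_div_iff₀ hbpos]
    nlinarith [norm_nonneg g]

/-- This replaces the reference point `z₀` of the hypotheses by `z`, at the cost of a constant. -/
lemma norm_sub_le_mul_norm_sub {w z z₀ : ℂ} {δ : ℝ} (hδ : 0 < δ) (h : δ ≤ ‖w - z‖) :
    ‖w - z₀‖ ≤ (1 + ‖z - z₀‖ / δ) * ‖w - z‖ := by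
  have h1 : ‖w - z₀‖ ≤ ‖w - z‖ + ‖z - z₀‖ := by
    have := norm_add_le (w - z) (z - z₀)
    rwa [sub_add_sub_cancel] at this
  have h2 : ‖z - z₀‖ ≤ ‖z - z₀‖ / δ * ‖w - z‖ := by
    rw [div_mul_eq_mul_div, le_div_iff₀ hδ]
    gcongr
  linarith

lemma exists_norm_sub_ge_of_disjoint {K A : Set ℂ} {Ω : ℂ → ℂ} {z : ℂ} (hA : IsOpen A)
    (hAΓ : Disjoint A (Ω '' frontier K)) (hz : z ∈ A) :
    ∃ δ > 0, ∀ y ∈ Metric.ball z δ, y ∈ A ∧ ∀ κ ∈ frontier K, δ ≤ ‖Ω κ - y‖ := by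
  obtain ⟨δ, hδ, hball⟩ := Metric.isOpen_iff.1 hA z hz
  -- Half the radius: a value of `Ω` within `δ / 2` of `y` would still lie in the disc around `z`,
  -- hence in `A`.
  refine ⟨δ / 2, by positivity, fun y hy => ⟨hball (Metric.ball_subset_ball (by linarith) hy), ?_⟩⟩
  intro κ hκ
  by_contra! hlt
  refine Set.disjoint_left.1 hAΓ (hball ?_) (mem_image_of_mem Ω hκ)
  rw [mem_ball_iff_norm] at hy ⊢
  have := norm_add_le (Ω κ - y) (y - z)
  rw [sub_add_sub_cancel] at this
  linarith

section Model

variable {n r : ℕ} {ω : ℝ → ℝ} {F : ℝ → Fin n → ℂ} {K A : Set ℂ} {Ω : ℂ → ℂ}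
  {G : ℂ → Matrix (Fin n) (Fin n) ℂ} {kap : Fin r → ℂ → ℂ} {z : ℂ}

/-- `ω + 1` is dominated by `|ω - z|` (reference point `-1`), and `|F_j F_l| ≤ |F_j|² + |F_l|²`. -/
lemma IsSymmetricModel.integrable_coupling_div (h : IsSymmetricModel ω F) (hz : z.im ≠ 0)
    (j l : Fin n) : Integrable fun k : ℝ => couplingMatrix F k j l / ((ω k : ℂ) - z) := by
  have hne : ∀ k, (ω k : ℂ) - z ≠ 0 := fun k h0 => hz (by
    have := congrArg Complex.im h0
    simpa using this)
  have hd : 0 < |z.im| := abs_pos.2 hz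
  have hge : ∀ k, |z.im| ≤ ‖(ω k : ℂ) - z‖ := fun k => by
    have := abs_im_le_norm ((ω k : ℂ) - z)
    simpa using this
  set C := 1 + ‖z - (-1)‖ / |z.im| with hC
  have hCpos : 0 < C := by positivity
  refine (((h.normalization j).add (h.normalization l)).const_mul C).mono' ?_ ?_
  · have h1 := h.continuous_formFactor j
    have h2 := h.continuous_formFactor l
    have h3 := h.continuous_dispersion
    refine Continuous.aestronglyMeasurable (Continuous.div ?_ (by fun_prop) hne)
    simp only [couplingMatrix, Matrix.of_apply]
    exact h1.mul (continuous_conj.comp h2)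
  · refine Eventually.of_forall fun k => ?_
    have hω : 0 < ω k + 1 := by linarith [h.dispersion_nonneg k]
    have h1 : ω k + 1 ≤ C * ‖(ω k : ℂ) - z‖ := by
      have := norm_sub_le_mul_norm_sub (z₀ := -1) hd (hge k)
      rwa [sub_neg_eq_add, ← ofReal_one, ← ofReal_add, norm_real, Real.norm_of_nonneg hω.le] at this
    have hpos : 0 < ‖(ω k : ℂ) - z‖ := norm_pos_iff.2 (hne k)
    simp only [couplingMatrix, Matrix.of_apply, norm_div, norm_mul, norm_conj, Pi.add_apply]
    rw [← add_div, mul_div_assoc', div_le_div_iff₀ hpos hω]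
    have h2 : ‖F k j‖ * ‖F k l‖ ≤ ‖F k j‖ ^ 2 + ‖F k l‖ ^ 2 := by
      nlinarith [sq_nonneg (‖F k j‖ - ‖F k l‖), sq_nonneg (‖F k j‖), sq_nonneg (‖F k l‖)]
    calc _ ≤ (‖F k j‖ ^ 2 + ‖F k l‖ ^ 2) * (C * ‖(ω k : ℂ) - z‖) := by gcongr
      _ = _ := by ring

lemma IsAnalyticExtension.continuousOn_contourIntegrand (h : IsAnalyticExtension ω F K Ω G)
    {S : Set ℂ} (hS : S ⊆ closure K) (hne : ∀ κ ∈ S, Ω κ ≠ z) (j l : Fin n) :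
    ContinuousOn (contourIntegrand Ω G z j l) S :=
  ((h.continuous_coupling _ _).mono hS).div
    ((h.continuous_dispersion.mono hS).sub continuousOn_const) fun κ hκ => sub_ne_zero.2 (hne κ hκ)

theorem contourIntegrable_contourIntegrand (hext : IsAnalyticExtension ω F K Ω G)
    (hbdry : BoundaryConditions K Ω G) (hA : IsOpen A) (hAΓ : Disjoint A (Ω '' frontier K))
    (hz : z ∈ A) (j l : Fin n) : ContourIntegrable K (contourIntegrand Ω G z j l) := by
  obtain ⟨δ, hδ, hball⟩ := exists_norm_sub_ge_of_disjoint hA hAΓ hz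
  have hge := (hball z (Metric.mem_ball_self hδ)).2
  obtain ⟨z₀, -, hfin⟩ := hbdry (max j l) (min j l) min_le_max
  rw [contourIntegrable_iff hext.smoothBoundary (hext.continuousOn_contourIntegrand
    frontier_subset_closure (fun κ hκ h0 => ?_) j l)]
  · have hC : 0 < 1 + ‖z - z₀‖ / δ := by positivity
    have hm : MeasurableSet (upper (frontier K)) :=
      measurableSet_upper isClosed_frontier.measurableSet
    refine (setLIntegral_mono' hm fun κ hκ =>
      enorm_div_le_mul hC (norm_sub_le_mul_norm_sub hδ (hge κ hκ.1))).trans_lt ?_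
    rw [lintegral_const_mul' _ _ ENNReal.ofReal_ne_top]
    exact ENNReal.mul_lt_top ENNReal.ofReal_lt_top hfin
  · have := hge κ hκ
    rw [h0, sub_self, norm_zero] at this
    linarith

lemma eventually_norm_mul_contourIntegrand_le (hbdry : BoundaryConditions K Ω G) (hA : IsOpen A)
    (hroots : IsRootSystem K Ω A kap) (hz : z ∈ A) (j l : Fin n) {ε : ℝ} (hε : 0 < ε) :
    ∀ᶠ R : ℝ in atTop, ∀ κ ∈ upper K, R ≤ ‖κ‖ → ‖κ‖ * ‖contourIntegrand Ω G z j l κ‖ ≤ ε := by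
  obtain ⟨z₀, hlim, -⟩ := hbdry (max j l) (min j l) min_le_max
  obtain ⟨δ, hδ, R₁, hR₁⟩ := hroots.exists_norm_sub_ge hA hz
  set C := 1 + ‖z - z₀‖ / δ with hCdef
  have hC : 0 < C := by positivity
  have h1 : ∀ᶠ R : ℝ in atTop, ⨆ κ ∈ {κ | κ ∈ upper K ∧ ‖κ‖ = R}, ENNReal.ofReal R *
      (‖G κ (max j l) (min j l)‖ₑ / ‖Ω κ - z₀‖ₑ) < ENNReal.ofReal (ε / C) :=
    hlim.eventually (gt_mem_nhds (by simpa using div_pos hε hC))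
  obtain ⟨R₂, hR₂⟩ := eventually_atTop.1 h1
  filter_upwards [eventually_ge_atTop R₁, eventually_ge_atTop R₂] with R hR1 hR2 κ hκ hR
  have h2 : ENNReal.ofReal ‖κ‖ * (‖G κ (max j l) (min j l)‖ₑ / ‖Ω κ - z₀‖ₑ) ≤
      ENNReal.ofReal (ε / C) := by
    refine le_trans ?_ (hR₂ ‖κ‖ (hR2.trans hR)).le
    exact le_iSup₂_of_le κ ⟨hκ, rfl⟩ le_rfl
  have h3 : ‖contourIntegrand Ω G z j l κ‖ₑ ≤ _ :=
    enorm_div_le_mul hC (norm_sub_le_mul_norm_sub hδ (hR₁ κ hκ.1 (hR1.trans hR)))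
  have h4 : ENNReal.ofReal (‖κ‖ * ‖contourIntegrand Ω G z j l κ‖) ≤ ENNReal.ofReal ε := by
    rw [ENNReal.ofReal_mul (norm_nonneg _), ofReal_norm (contourIntegrand Ω G z j l κ)]
    calc _ ≤ ENNReal.ofReal ‖κ‖ * (ENNReal.ofReal C *
          (‖G κ (max j l) (min j l)‖ₑ / ‖Ω κ - z₀‖ₑ)) := by gcongr
      _ = ENNReal.ofReal C * (ENNReal.ofReal ‖κ‖ *
          (‖G κ (max j l) (min j l)‖ₑ / ‖Ω κ - z₀‖ₑ)) := by ring
      _ ≤ ENNReal.ofReal C * ENNReal.ofReal (ε / C) := by gcongr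
      _ = ENNReal.ofReal ε := by rw [← ENNReal.ofReal_mul hC.le, mul_div_cancel₀ _ hC.ne']
  exact (ENNReal.ofReal_le_ofReal_iff hε.le).1 h4

/-- `Ω(κ) - z = (κ - c) dslope Ω c κ`, and the slope at `c` is `Ω'(c) ≠ 0`. So the pole factor takes
the value `g(c)/Ω'(c)` at `c`. -/
lemma hasPoleFactor_div {D : Set ℂ} {g Ω : ℂ → ℂ} {c z : ℂ} (hD : IsOpen D) (hc : c ∈ D)
    (hg : AnalyticOnNhd ℂ g D) (hΩ : AnalyticOnNhd ℂ Ω D) (hz : Ω c = z) (hd : deriv Ω c ≠ 0) :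
    HasPoleFactor D (fun κ => g κ / (Ω κ - z)) (fun κ => g κ / dslope Ω c κ) c := by
  have hds : DifferentiableOn ℂ (dslope Ω c) D :=
    (Complex.differentiableOn_dslope (hD.mem_nhds hc)).2 hΩ.differentiableOn
  have hne : ∀ᶠ κ in 𝓝 c, dslope Ω c κ ≠ 0 := by
    refine (hds.continuousOn.continuousAt (hD.mem_nhds hc)).eventually_ne ?_
    rwa [dslope_same]
  obtain ⟨ρ, hρ, hball⟩ := Metric.eventually_nhds_iff_ball.1 (hne.and (hD.mem_nhds hc))
  refine ⟨ρ, hρ, fun κ hκ => (hball κ hκ).2, ?_, fun κ hκ hne => ?_⟩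
  · exact (hg.differentiableOn.mono fun κ hκ => (hball κ hκ).2).div
      (hds.mono fun κ hκ => (hball κ hκ).2) fun κ hκ => (hball κ hκ).1
  · have := sub_smul_dslope Ω c κ
    rw [hz, smul_eq_mul] at this
    beta_reduce
    rw [← this, div_mul_eq_div_div, div_right_comm, div_eq_mul_inv]

lemma IsSymmetricModel.coupling_neg (h : IsSymmetricModel ω F) (k : ℝ) (j l : Fin n) :
    couplingMatrix F (-k) j l = couplingMatrix F k l j := by
  simp [couplingMatrix, h.formFactor_neg, mul_comm]

/-- The substitution `k ↦ -k` transposes `G`. Hence the entries with `j ≥ l` suffice. -/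
lemma IsSymmetricModel.selfEnergy_symm (h : IsSymmetricModel ω F) (z : ℂ) (j l : Fin n) :
    selfEnergy ω F z j l = selfEnergy ω F z l j := by
  simp only [selfEnergy, Matrix.of_apply]
  rw [← integral_neg_eq_self]
  simp only [h.coupling_neg, h.dispersion_neg]

lemma selfEnergy_conj (ω : ℝ → ℝ) (F : ℝ → Fin n → ℂ) (z : ℂ) :
    selfEnergy ω F (conj z) = (selfEnergy ω F z)ᴴ := by
  ext j l
  simp only [selfEnergy, Matrix.of_apply, Matrix.conjTranspose_apply, couplingMatrix]
  rw [star_def, ← integral_conj]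
  congr 1
  funext k
  simp [mul_comm]

/-- The decomposition of the self-energy in the upper half-plane. -/
theorem selfEnergy_eq (hmodel : IsSymmetricModel ω F) (hext : IsAnalyticExtension ω F K Ω G)
    (hbdry : BoundaryConditions K Ω G) (hA : IsOpen A) (hAΓ : Disjoint A (Ω '' frontier K))
    (hroots : IsRootSystem K Ω A kap) (hz : z ∈ upper A) :
    selfEnergy ω F z =
      contourTerm K Ω G z + (2 * Real.pi * I) • ∑ s, residueTerm Ω G (kap s z) := by
  ext j l
  set f := contourIntegrand Ω G z j l with hf
  have hcouple : ∀ k : ℝ,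
      f k = couplingMatrix F k (max j l) (min j l) / ((ω k : ℂ) - z) := fun k => by
    rw [hf, contourIntegrand, hext.dispersion_ofReal, hext.coupling_ofReal]
  have hself : selfEnergy ω F z j l = ∫ k : ℝ, f k := by
    have h1 : selfEnergy ω F z j l = selfEnergy ω F z (max j l) (min j l) := by
      rcases le_total l j with h | h
      · rw [max_eq_left h, min_eq_right h]
      · rw [max_eq_right h, min_eq_left h, hmodel.selfEnergy_symm]
    simp only [h1, hcouple]
    rfl
  have hK := hext.isOpen
  have hreal := hext.real_mem
  have hDK : upper K ⊆ K := fun _ h => h.1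
  set c : Fin r → ℂ := fun s => kap s z with hc
  have hcD : ∀ s, c s ∈ upper K := fun s => ⟨(hroots.mem hz.1 s).1, hroots.im_pos z hz s⟩
  have hcz : ∀ s, Ω (c s) = z := fun s => (hroots.mem hz.1 s).2
  have hne1 : ∀ κ ∈ upper K \ range c, Ω κ ≠ z := by
    rintro κ ⟨hκ, hκ'⟩ h0
    obtain ⟨s, hs⟩ := hroots.exists_eq hκ.1 (by rw [h0]; exact hz.1)
    rw [h0] at hs
    rcases hs with hs | hs
    · exact hκ' ⟨s, hs.symm⟩
    · have h1 := hκ.2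
      have h2 := hroots.im_pos z hz s
      rw [hs, neg_im] at h1
      linarith
  -- On the real line `Ω` is real while `Im z > 0`; on `Γ` the value `z` is excluded because `A`
  -- avoids `Ω(Γ)`.
  have hne2 : ∀ κ ∈ closure (upper K) \ range c, Ω κ ≠ z := by
    rintro κ ⟨hκ, hκ'⟩ h0
    by_cases hD : κ ∈ upper K
    · exact hne1 κ ⟨hD, hκ'⟩ h0
    · have hfr : κ ∈ frontier (upper K) := by
        rw [(isOpen_upper hK).frontier_eq]; exact ⟨hκ, hD⟩
      rw [frontier_upper hK hreal] at hfr
      rcases hfr with ⟨k, rfl⟩ | hfr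
      · have := hz.2
        rw [← h0, hext.dispersion_ofReal] at this
        simp at this
      · exact Set.disjoint_left.1 hAΓ hz.1 ⟨κ, hfr.1, h0⟩
  have hfd : DifferentiableOn ℂ f (upper K \ range c) := by
    refine DifferentiableOn.div ?_ ?_ fun κ hκ => sub_ne_zero.2 (hne1 κ hκ)
    · exact (hext.analytic_coupling _ _).differentiableOn.mono fun _ h => h.1.1
    · exact (hext.analytic_dispersion.differentiableOn.mono fun _ h => h.1.1).sub_const z
  have hfc : ContinuousOn f (closure (upper K) \ range c) :=
    hext.continuousOn_contourIntegrand (sdiff_subset.trans (closure_mono hDK)) hne2 j l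
  have hpole : ∀ s, HasPoleFactor (upper K) f
      (fun κ => G κ (max j l) (min j l) / dslope Ω (c s) κ) (c s) := fun s =>
    hasPoleFactor_div (isOpen_upper hK) (hcD s) ((hext.analytic_coupling _ _).mono hDK)
      (hext.analytic_dispersion.mono hDK) (hcz s)
      (hroots.deriv_ne_zero hext.analytic_dispersion hA hz.1 s)
  have hint := integral_frontier_upper (f := f) hext.smoothBoundary hK hreal
    (by simp only [hcouple]; exact hmodel.integrable_coupling_div hz.2.ne' _ _)
    (contourIntegrable_contourIntegrand hext hbdry hA hAΓ hz.1 j l)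
  have key := integral_frontier_eq_residues (c := c) (isOpen_upper hK)
    (hext.smoothBoundary.upper hK hreal) (hroots.injective hext.analytic_dispersion hA hz.1) hfd hfc
    hpole hint.1 fun ε hε =>
      eventually_norm_mul_contourIntegrand_le hbdry hA hroots hz.1 j l hε
  rw [hint.2] at key
  simp only [dslope_same] at key
  rw [hself, Matrix.add_apply, Matrix.smul_apply, Matrix.sum_apply]
  simp only [smul_eq_mul, contourTerm, residueTerm, Matrix.of_apply]
  linear_combination -key

end Model

/-! ### The analytic continuation of the self-energy -/

section Continuation

variable {n r : ℕ} {ω : ℝ → ℝ} {F : ℝ → Fin n → ℂ} {K A : Set ℂ} {Ω : ℂ → ℂ}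
  {G : ℂ → Matrix (Fin n) (Fin n) ℂ} {kap : Fin r → ℂ → ℂ} {z : ℂ}

/-- The sum of the contour term and of the residues, as a function on `A`. -/
noncomputable def continuation (K : Set ℂ) (Ω : ℂ → ℂ) (G : ℂ → Matrix (Fin n) (Fin n) ℂ)
    (kap : Fin r → ℂ → ℂ) (z : ℂ) : Matrix (Fin n) (Fin n) ℂ :=
  contourTerm K Ω G z + (2 * Real.pi * I) • ∑ s, residueTerm Ω G (kap s z)

/-- Differentiation under the integral. For `y` in the disc, `|Ω - y| ≥ δ` and `|Ω - z| ≤ 2 |Ω -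
y|`, so `2/δ` times the integrand at `z` dominates the derivative. -/
lemma differentiableAt_contourTerm (hext : IsAnalyticExtension ω F K Ω G)
    (hbdry : BoundaryConditions K Ω G) (hA : IsOpen A) (hAΓ : Disjoint A (Ω '' frontier K))
    (hz : z ∈ A) (j l : Fin n) : DifferentiableAt ℂ (fun z => contourTerm K Ω G z j l) z := by
  obtain ⟨δ, hδ, hball⟩ := exists_norm_sub_ge_of_disjoint hA hAΓ hz
  have hmΓ : MeasurableSet (upper (frontier K)) :=
    measurableSet_upper isClosed_frontier.measurableSet
  have hint : ∀ y ∈ A, ContourIntegrable K (contourIntegrand Ω G y j l) := fun y hy =>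
    contourIntegrable_contourIntegrand hext hbdry hA hAΓ hy j l
  have hne : ∀ y ∈ Metric.ball z δ, ∀ κ ∈ frontier K, Ω κ - y ≠ 0 := fun y hy κ hκ h0 => by
    have := (hball y hy).2 κ hκ
    rw [h0, norm_zero] at this
    linarith
  set f' : ℂ → ℂ → ℂ := fun y κ =>
    contourIntegrand Ω G y j l κ / (Ω κ - y) * boundaryTangent K κ with hf'
  have hzb := Metric.mem_ball_self (x := z) hδ
  have hcont : ContinuousOn (f' z) (frontier K) := by
    refine ContinuousOn.mul (ContinuousOn.div ?_ ?_ (hne z hzb))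
      (continuousOn_boundaryTangent hext.smoothBoundary)
    · exact hext.continuousOn_contourIntegrand frontier_subset_closure
        (fun κ hκ => sub_ne_zero.1 (hne z hzb κ hκ)) j l
    · exact (hext.continuous_dispersion.mono frontier_subset_closure).sub continuousOn_const
  have key := hasDerivAt_integral_of_dominated_loc_of_deriv_le
    (μ := (Measure.hausdorffMeasure 1).restrict (upper (frontier K)))
    (F := fun y κ => contourIntegrand Ω G y j l κ * boundaryTangent K κ) (F' := f')
    (bound := fun κ => 2 / δ * ‖contourIntegrand Ω G z j l κ * boundaryTangent K κ‖)
    (s := Metric.ball z δ) (x₀ := z) (Metric.ball_mem_nhds z hδ) ?_ (hint z hz) ?_ ?_ ?_ ?_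
  · exact key.2.differentiableAt
  · filter_upwards [hA.mem_nhds hz] with y hy
    exact (hint y hy).aestronglyMeasurable
  · exact (hcont.mono fun _ h => h.1).aestronglyMeasurable hmΓ
  · filter_upwards [ae_restrict_mem hmΓ] with κ hκ y hy
    have h1 := (hball y hy).2 κ hκ.1
    have h2 := hne y hy κ hκ.1
    have h3 := hne z hzb κ hκ.1
    have h5 : 0 < ‖Ω κ - y‖ := norm_pos_iff.2 h2
    have h6 : 0 < ‖Ω κ - z‖ := norm_pos_iff.2 h3
    have h4 : ‖Ω κ - z‖ ≤ 2 * ‖Ω κ - y‖ := by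
      have := norm_add_le (Ω κ - y) (y - z)
      rw [sub_add_sub_cancel] at this
      have := mem_ball_iff_norm.1 hy
      linarith
    simp only [hf', contourIntegrand, norm_mul, norm_div]
    rw [← mul_assoc]
    refine mul_le_mul_of_nonneg_right ?_ (norm_nonneg _)
    have h7 : ‖Ω κ - y‖⁻¹ ≤ δ⁻¹ := inv_anti₀ hδ h1
    have h8 : ‖Ω κ - y‖⁻¹ ≤ 2 * ‖Ω κ - z‖⁻¹ := by
      rw [← div_eq_mul_inv, le_div_iff₀ h6, inv_mul_le_iff₀ h5]
      linarith
    simp only [div_eq_mul_inv]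
    calc _ ≤ ‖G κ (max j l) (min j l)‖ * (2 * ‖Ω κ - z‖⁻¹) * δ⁻¹ := by gcongr
      _ = _ := by ring
  · exact (Integrable.norm (hint z hz)).const_mul _
  · filter_upwards [ae_restrict_mem hmΓ] with κ hκ y hy
    have h2 := hne y hy κ hκ.1
    have h3 : HasDerivAt (fun y => Ω κ - y) (-1) y := (hasDerivAt_id y).const_sub _
    have h4 := ((hasDerivAt_const y (G κ (max j l) (min j l))).div h3 h2).mul_const
      (boundaryTangent K κ)
    refine h4.congr_deriv ?_
    simp only [hf', contourIntegrand]
    field_simp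
    ring

lemma differentiableAt_residueTerm (hext : IsAnalyticExtension ω F K Ω G) (hA : IsOpen A)
    (hroots : IsRootSystem K Ω A kap) (hz : z ∈ A) (s : Fin r) (j l : Fin n) :
    DifferentiableAt ℂ (fun z => residueTerm Ω G (kap s z) j l) z := by
  have h1 := (hroots.hasDerivAt hext.analytic_dispersion hA hz s).differentiableAt
  have hmem := (hroots.mem hz s).1
  refine DifferentiableAt.div ?_ ?_ (hroots.deriv_ne_zero hext.analytic_dispersion hA hz s)
  · exact (hext.analytic_coupling (max j l) (min j l) _ hmem).differentiableAt.comp z h1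
  · exact (hext.analytic_dispersion _ hmem).deriv.differentiableAt.comp z h1

theorem analyticOnNhd_continuation (hext : IsAnalyticExtension ω F K Ω G)
    (hbdry : BoundaryConditions K Ω G) (hA : IsOpen A) (hAΓ : Disjoint A (Ω '' frontier K))
    (hroots : IsRootSystem K Ω A kap) (j l : Fin n) :
    AnalyticOnNhd ℂ (fun z => continuation K Ω G kap z j l) A := by
  refine DifferentiableOn.analyticOnNhd (fun z hz => ?_) hA
  refine DifferentiableAt.differentiableWithinAt ?_
  simp only [continuation, Matrix.add_apply, Matrix.smul_apply, Matrix.sum_apply, smul_eq_mul]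
  exact (differentiableAt_contourTerm hext hbdry hA hAΓ hz j l).add
    ((DifferentiableAt.fun_sum fun s _ =>
      differentiableAt_residueTerm hext hA hroots hz s j l).const_mul _)

theorem isContinuation_continuation (hmodel : IsSymmetricModel ω F)
    (hext : IsAnalyticExtension ω F K Ω G) (hbdry : BoundaryConditions K Ω G) (hA : IsOpen A)
    (hAΓ : Disjoint A (Ω '' frontier K)) (hroots : IsRootSystem K Ω A kap) :
    IsContinuation ω F A (continuation K Ω G kap) :=
  ⟨analyticOnNhd_continuation hext hbdry hA hAΓ hroots, fun _ hz =>
    (selfEnergy_eq hmodel hext hbdry hA hAΓ hroots hz).symm⟩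

lemma IsContinuation.eqOn {S S' : ℂ → Matrix (Fin n) (Fin n) ℂ} (hS : IsContinuation ω F A S)
    (hS' : IsContinuation ω F A S') (hA : IsOpen A) (hconn : IsPreconnected A)
    (hne : (upper A).Nonempty) : EqOn S' S A := by
  obtain ⟨z₀, hz₀⟩ := hne
  have hentry : ∀ j l, EqOn (fun z => S' z j l) (fun z => S z j l) A := fun j l => by
    refine (hS'.1 j l).eqOn_of_preconnected_of_eventuallyEq (hS.1 j l) hconn hz₀.1 ?_
    filter_upwards [(isOpen_upper hA).mem_nhds hz₀] with z hz
    rw [hS'.2 z hz, hS.2 z hz]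
  intro z hz
  ext j l
  exact hentry j l hz

end Continuation

/-! ### Reflection at the imaginary axis -/

/-- The reflection at the imaginary axis. -/
noncomputable def reflection : ℂ ≃ᵢ ℂ :=
  (conjLIE.trans (LinearIsometryEquiv.neg ℝ)).toIsometryEquiv

lemma reflection_apply (κ : ℂ) : reflection κ = -conj κ := rfl

lemma neg_conj_neg_conj (κ : ℂ) : -conj (-conj κ) = κ := by simp

section Reflection

variable {K : Set ℂ} {κ : ℂ}

lemma neg_conj_mem_iff (hsymm : ∀ κ ∈ K, -conj κ ∈ K) : -conj κ ∈ K ↔ κ ∈ K :=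
  ⟨fun h => by simpa using hsymm _ h, hsymm κ⟩

lemma neg_conj_mem_frontier (hsymm : ∀ κ ∈ K, -conj κ ∈ K) (hκ : κ ∈ frontier K) :
    -conj κ ∈ frontier K := by
  have h1 : reflection.toHomeomorph ⁻¹' K = K := by
    ext κ
    exact neg_conj_mem_iff hsymm
  have h2 := reflection.toHomeomorph.preimage_frontier K
  rw [h1] at h2
  rw [← h2] at hκ
  exact hκ

/-- Reflection maps the outward normal `N` to `-conj N`; multiplication by `-i` turns this into the
conjugate of `-i N`. -/
lemma boundaryTangent_neg_conj (hsm : HasSmoothBoundary K) (hsymm : ∀ κ ∈ K, -conj κ ∈ K)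
    (hκ : κ ∈ frontier K) : boundaryTangent K (-conj κ) = conj (boundaryTangent K κ) := by
  obtain ⟨ρ, hρ⟩ := hsm κ hκ
  set e : ℂ →L[ℝ] ℂ := -(conjCLE : ℂ →L[ℝ] ℂ) with he
  have hea : ∀ x, e x = -conj x := fun x => by simp [he]
  have hκ' : e (-conj κ) = κ := by rw [hea, neg_conj_neg_conj]
  have hgrad : HasGradientAt (fun x => ρ (e x)) (-conj (gradient ρ κ)) (-conj κ) := by
    rw [hasGradientAt_iff_hasFDerivAt]
    have h1 : HasFDerivAt ρ (fderiv ℝ ρ κ) (e (-conj κ)) := by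
      rw [hκ']; exact (hρ.contDiff.differentiable (by simp) κ).hasFDerivAt
    refine (h1.comp (-conj κ) e.hasFDerivAt).congr_fderiv ?_
    ext v
    rw [ContinuousLinearMap.comp_apply, fderiv_eq_inner_gradient, hea,
      InnerProductSpace.toDual_apply_apply, Complex.inner, Complex.inner]
    simp
  have hdef : IsDefiningFunction K (-conj κ) fun x => ρ (e x) := by
    refine ⟨hρ.contDiff.comp e.contDiff, ?_, ?_⟩
    · rw [hgrad.gradient]
      simpa using hρ.gradient_ne_zero
    · have h1 : Tendsto e (𝓝 (-conj κ)) (𝓝 κ) := by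
        have := e.continuous.tendsto (-conj κ)
        rwa [hκ'] at this
      filter_upwards [h1.eventually hρ.mem_iff] with x hx
      rw [← hx, hea, neg_conj_mem_iff hsymm]
  rw [boundaryTangent, boundaryTangent, outwardNormal_eq hκ hρ,
    outwardNormal_eq (neg_conj_mem_frontier hsymm hκ) hdef, hgrad.gradient]
  simp [neg_div]

/-- Substitute `κ ↦ -conj κ`, an isometry of `Γ⁺`: integrand and tangent both become their
conjugates. -/
lemma conj_contourIntegral (hsm : HasSmoothBoundary K) (hsymm : ∀ κ ∈ K, -conj κ ∈ K) {f : ℂ → ℂ}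
    (hf : ∀ κ ∈ frontier K, f (-conj κ) = conj (f κ)) :
    conj (contourIntegral K f) = contourIntegral K f := by
  have hm : MeasurableSet (upper (frontier K)) :=
    measurableSet_upper isClosed_frontier.measurableSet
  have hpre : reflection ⁻¹' upper (frontier K) = upper (frontier K) := by
    have h1 : ∀ κ ∈ upper (frontier K), reflection κ ∈ upper (frontier K) := fun κ hκ =>
      ⟨neg_conj_mem_frontier hsymm hκ.1, by simpa [reflection_apply] using hκ.2⟩
    ext κ
    refine ⟨fun h => ?_, h1 κ⟩
    have := h1 _ h
    rwa [reflection_apply, reflection_apply, neg_conj_neg_conj] at this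
  have h2 := (reflection.measurePreserving_hausdorffMeasure 1).setIntegral_preimage_emb
    reflection.toHomeomorph.measurableEmbedding (fun κ => f κ * boundaryTangent K κ)
    (upper (frontier K))
  rw [hpre] at h2
  rw [contourIntegral, ← integral_conj, ← h2]
  refine setIntegral_congr_fun hm fun κ hκ => ?_
  simp only [reflection_apply]
  rw [hf κ hκ.1, boundaryTangent_neg_conj hsm hsymm hκ.1, map_mul]

lemma hasDerivAt_conj_neg_conj {g : ℂ → ℂ} (hg : DifferentiableAt ℂ g (-conj κ)) :
    HasDerivAt (fun κ => conj (g (-conj κ))) (-conj (deriv g (-conj κ))) κ := by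
  have h1 : HasDerivAt (conj ∘ g ∘ conj) (conj (deriv g (-conj κ))) (conj (-conj κ)) :=
    hg.hasDerivAt.conj_conj
  rw [map_neg, conj_conj] at h1
  have h2 := h1.comp κ (hasDerivAt_neg κ)
  simpa [Function.comp_def] using! h2

/-- The reflection principle. -/
lemma apply_neg_conj {g : ℂ → ℂ} (hg : AnalyticOnNhd ℂ g K) (hK : IsOpen K)
    (hconn : IsPreconnected K) (hreal : ∀ k : ℝ, (k : ℂ) ∈ K) (hsymm : ∀ κ ∈ K, -conj κ ∈ K)
    (hgreal : ∀ k : ℝ, g (-k : ℝ) = conj (g k)) (hκ : κ ∈ K) : g (-conj κ) = conj (g κ) := by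
  have hd : DifferentiableOn ℂ (fun κ => conj (g (-conj κ))) K := fun κ hκ =>
    (hasDerivAt_conj_neg_conj
      (hg _ (hsymm κ hκ)).differentiableAt).differentiableAt.differentiableWithinAt
  -- Both sides agree on the real line, which accumulates at `0`; the identity theorem does the
  -- rest.
  have h0 : ∃ᶠ z in 𝓝[≠] (0 : ℂ), conj (g (-conj z)) = g z := by
    have hlim : Tendsto (fun t : ℝ => (t : ℂ)) (𝓝[≠] 0) (𝓝[≠] 0) := by
      refine tendsto_nhdsWithin_iff.2 ⟨?_, ?_⟩
      · have := continuous_ofReal.tendsto 0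
        rw [ofReal_zero] at this
        exact this.mono_left nhdsWithin_le_nhds
      · filter_upwards [self_mem_nhdsWithin] with t ht
        simpa using ht
    refine hlim.frequently (Eventually.frequently (Eventually.of_forall fun t => ?_))
    have := hgreal t
    rw [ofReal_neg] at this
    rw [conj_ofReal, this, conj_conj]
  have := (hd.analyticOnNhd hK).eqOn_of_preconnected_of_frequently_eq hg hconn
    (by simpa using hreal 0) h0 hκ
  simp only at this
  rw [← this, conj_conj]

lemma apply_neg_conj_of_mem_closure {g : ℂ → ℂ} (hgc : ContinuousOn g (closure K))
    (hsymm : ∀ κ ∈ K, -conj κ ∈ K) (hg : ∀ κ ∈ K, g (-conj κ) = conj (g κ))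
    (hκ : κ ∈ closure K) : g (-conj κ) = conj (g κ) := by
  have hc : Continuous fun κ : ℂ => -conj κ := continuous_conj.neg
  have hmaps : MapsTo (fun κ : ℂ => -conj κ) (closure K) (closure K) :=
    MapsTo.closure hsymm hc
  exact Set.EqOn.of_subset_closure (s := K) (t := closure K) hg (hgc.comp hc.continuousOn hmaps)
    (continuous_conj.comp_continuousOn hgc) subset_closure Subset.rfl hκ

lemma deriv_neg_conj {g : ℂ → ℂ} (hK : IsOpen K) (hgd : AnalyticOnNhd ℂ g K)
    (hsymm : ∀ κ ∈ K, -conj κ ∈ K) (hg : ∀ κ ∈ K, g (-conj κ) = conj (g κ)) (hκ : κ ∈ K) :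
    deriv g (-conj κ) = -conj (deriv g κ) := by
  have h1 := hasDerivAt_conj_neg_conj (hgd _ (hsymm κ hκ)).differentiableAt
  have h2 : g =ᶠ[𝓝 κ] fun κ => conj (g (-conj κ)) := by
    filter_upwards [hK.mem_nhds hκ] with y hy
    rw [hg y hy, conj_conj]
  rw [h2.deriv_eq, h1.deriv, map_neg, conj_conj, neg_neg]

end Reflection

section SymmetricModel

variable {n r : ℕ} {ω : ℝ → ℝ} {F : ℝ → Fin n → ℂ} {K A : Set ℂ} {Ω : ℂ → ℂ}
  {G : ℂ → Matrix (Fin n) (Fin n) ℂ} {kap : Fin r → ℂ → ℂ} {κ : ℂ} {E : ℝ}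

lemma dispersion_neg_conj (hmodel : IsSymmetricModel ω F) (hext : IsAnalyticExtension ω F K Ω G)
    (hsymm : ∀ κ ∈ K, -conj κ ∈ K) (hκ : κ ∈ K) : Ω (-conj κ) = conj (Ω κ) :=
  apply_neg_conj hext.analytic_dispersion hext.isOpen hext.isConnected.isPreconnected hext.real_mem
    hsymm (fun k => by
      rw [hext.dispersion_ofReal, hext.dispersion_ofReal, hmodel.dispersion_neg, conj_ofReal]) hκ

lemma coupling_neg_conj (hmodel : IsSymmetricModel ω F) (hext : IsAnalyticExtension ω F K Ω G)
    (hsymm : ∀ κ ∈ K, -conj κ ∈ K) (j l : Fin n) (hκ : κ ∈ K) :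
    G (-conj κ) j l = conj (G κ j l) :=
  apply_neg_conj (g := fun κ => G κ j l) (hext.analytic_coupling j l) hext.isOpen
    hext.isConnected.isPreconnected hext.real_mem hsymm (fun k => by
      rw [hext.coupling_ofReal, hext.coupling_ofReal, hmodel.coupling_neg]
      simp [couplingMatrix, mul_comm]) hκ

/-- The entries are real by reflection, and the matrix is symmetric by its definition through `max`
and `min`. -/
lemma conjTranspose_contourTerm (hmodel : IsSymmetricModel ω F)
    (hext : IsAnalyticExtension ω F K Ω G) (hsymm : ∀ κ ∈ K, -conj κ ∈ K) (E : ℝ) :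
    (contourTerm K Ω G E)ᴴ = contourTerm K Ω G E := by
  ext j l
  rw [Matrix.conjTranspose_apply]
  simp only [contourTerm, Matrix.of_apply]
  have hcomm : contourIntegrand Ω G E l j = contourIntegrand Ω G E j l := by
    funext κ
    rw [contourIntegrand, contourIntegrand, max_comm, min_comm]
  rw [hcomm, star_def]
  refine conj_contourIntegral hext.smoothBoundary hsymm fun κ hκ => ?_
  have hκ' := frontier_subset_closure hκ
  rw [contourIntegrand, contourIntegrand,
    apply_neg_conj_of_mem_closure hext.continuous_dispersion hsymm
      (fun κ hκ => dispersion_neg_conj hmodel hext hsymm hκ) hκ',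
    apply_neg_conj_of_mem_closure (g := fun κ => G κ (max j l) (min j l))
      (hext.continuous_coupling _ _) hsymm
      (fun κ hκ => coupling_neg_conj hmodel hext hsymm _ _ hκ) hκ']
  simp

lemma residueTerm_symm (Ω : ℂ → ℂ) (G : ℂ → Matrix (Fin n) (Fin n) ℂ) (κ : ℂ) (j l : Fin n) :
    residueTerm Ω G κ j l = residueTerm Ω G κ l j := by
  simp only [residueTerm, Matrix.of_apply, max_comm j l, min_comm j l]

lemma residueTerm_neg_conj (hmodel : IsSymmetricModel ω F) (hext : IsAnalyticExtension ω F K Ω G)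
    (hsymm : ∀ κ ∈ K, -conj κ ∈ K) (hκ : κ ∈ K) (j l : Fin n) :
    residueTerm Ω G (-conj κ) j l = -conj (residueTerm Ω G κ j l) := by
  simp only [residueTerm, Matrix.of_apply]
  rw [coupling_neg_conj hmodel hext hsymm _ _ hκ, deriv_neg_conj hext.isOpen
    hext.analytic_dispersion hsymm (fun κ hκ => dispersion_neg_conj hmodel hext hsymm hκ) hκ,
    map_div₀, div_neg]

lemma IsRootSystem.im_nonneg (hroots : IsRootSystem K Ω A kap) (hA : IsOpen A)
    (hE : (E : ℂ) ∈ A) (s : Fin r) : 0 ≤ (kap s E).im := by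
  have hlim : Tendsto (fun δ : ℝ => (E : ℂ) + δ * I) (𝓝[>] 0) (𝓝 (E : ℂ)) := by
    have : Continuous fun δ : ℝ => (E : ℂ) + δ * I := by fun_prop
    simpa using (this.tendsto 0).mono_left nhdsWithin_le_nhds
  have h1 := (continuous_im.tendsto _).comp
    (((hroots.continuousOn s).continuousAt (hA.mem_nhds hE)).tendsto.comp hlim)
  refine ge_of_tendsto h1 ?_
  filter_upwards [hlim.eventually (hA.mem_nhds hE), self_mem_nhdsWithin] with δ h2 h3
  exact (hroots.im_pos _ ⟨h2, by simpa using h3⟩ s).le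

/-- Since `E` is real, `κ ↦ -conj κ` permutes the roots in the upper half-plane. It takes the
symmetric matrix `Z` to `-conj Z = -Z†`. -/
lemma conjTranspose_sum_residueTerm (hmodel : IsSymmetricModel ω F)
    (hext : IsAnalyticExtension ω F K Ω G) (hA : IsOpen A) (hroots : IsRootSystem K Ω A kap)
    (hsymm : ∀ κ ∈ K, -conj κ ∈ K) (hE : (E : ℂ) ∈ A) :
    (∑ s with 0 < (kap s E).im, residueTerm Ω G (kap s E))ᴴ =
      -∑ s with 0 < (kap s E).im, residueTerm Ω G (kap s E) := by
  classical
  have hinj := hroots.injective hext.analytic_dispersion hA hE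
  -- The reflection acts on roots rather than on indices, so the sum is rewritten over the set of
  -- roots, the branches being distinct.
  set P : Finset ℂ := (Finset.univ.filter fun s => 0 < (kap s E).im).image fun s => kap s E with hP
  have hmem : ∀ κ, κ ∈ P ↔ κ ∈ K ∧ Ω κ = E ∧ 0 < κ.im := by
    intro κ
    simp only [hP, Finset.mem_image, Finset.mem_filter, Finset.mem_univ, true_and]
    constructor
    · rintro ⟨s, hs, rfl⟩
      exact ⟨(hroots.mem hE s).1, (hroots.mem hE s).2, hs⟩
    · rintro ⟨h1, h2, h3⟩
      obtain ⟨s, hs⟩ := hroots.exists_eq h1 (by rwa [h2])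
      rw [h2] at hs
      rcases hs with rfl | rfl
      · exact ⟨s, h3, rfl⟩
      · have := hroots.im_nonneg hA hE s
        rw [neg_im] at h3
        linarith
  have hrefl : ∀ κ ∈ P, -conj κ ∈ P := fun κ hκ => by
    rw [hmem] at hκ ⊢
    refine ⟨hsymm κ hκ.1, ?_, by simpa using hκ.2.2⟩
    rw [dispersion_neg_conj hmodel hext hsymm hκ.1, hκ.2.1, conj_ofReal]
  have hsum : ∑ s with 0 < (kap s E).im, residueTerm Ω G (kap s E) =
      ∑ κ ∈ P, residueTerm Ω G κ := by
    rw [hP, Finset.sum_image hinj.injOn]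
  rw [hsum]
  ext j l
  rw [Matrix.conjTranspose_apply, Matrix.neg_apply, Matrix.sum_apply, Matrix.sum_apply, star_def,
    map_sum, ← Finset.sum_neg_distrib]
  refine Finset.sum_bij' (fun κ _ => -conj κ) (fun κ _ => -conj κ) hrefl hrefl
    (fun κ _ => neg_conj_neg_conj κ) (fun κ _ => neg_conj_neg_conj κ) fun κ hκ => ?_
  rw [residueTerm_neg_conj hmodel hext hsymm ((hmem κ).1 hκ).1, neg_neg, residueTerm_symm]

/-- The factor `2πi` is purely imaginary and exchanges hermitian and anti-hermitian components. -/
lemma hermitianPart_add_sum {ι : Type*} (s : Finset ι) {H : Matrix (Fin n) (Fin n) ℂ} (hH : Hᴴ = H)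
    (Z : ι → Matrix (Fin n) (Fin n) ℂ) :
    hermitianPart (H + (2 * Real.pi * I) • ∑ i ∈ s, Z i) =
      H + (2 * Real.pi * I) • ∑ i ∈ s, antihermitianPart (Z i) := by
  have h1 : conj (2 * Real.pi * I : ℂ) = -(2 * Real.pi * I) := by
    rw [map_mul, map_mul, conj_I, conj_ofReal, map_ofNat, mul_neg]
  simp only [hermitianPart, antihermitianPart, Matrix.conjTranspose_add, Matrix.conjTranspose_smul,
    hH, star_def, h1, ← Finset.smul_sum, Finset.sum_sub_distrib, Matrix.conjTranspose_sum]
  module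

lemma antihermitianPart_add_sum {ι : Type*} (s : Finset ι) {H : Matrix (Fin n) (Fin n) ℂ}
    (hH : Hᴴ = H) (Z : ι → Matrix (Fin n) (Fin n) ℂ) :
    antihermitianPart (H + (2 * Real.pi * I) • ∑ i ∈ s, Z i) =
      (2 * Real.pi * I) • ∑ i ∈ s, hermitianPart (Z i) := by
  have h1 : conj (2 * Real.pi * I : ℂ) = -(2 * Real.pi * I) := by
    rw [map_mul, map_mul, conj_I, conj_ofReal, map_ofNat, mul_neg]
  simp only [hermitianPart, antihermitianPart, Matrix.conjTranspose_add, Matrix.conjTranspose_smul,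
    hH, star_def, h1, ← Finset.smul_sum, Finset.sum_add_distrib, Matrix.conjTranspose_sum]
  module

lemma hermitianPart_conjTranspose (M : Matrix (Fin n) (Fin n) ℂ) :
    hermitianPart Mᴴ = hermitianPart M := by
  rw [hermitianPart, hermitianPart, Matrix.conjTranspose_conjTranspose, add_comm]

lemma antihermitianPart_conjTranspose (M : Matrix (Fin n) (Fin n) ℂ) :
    antihermitianPart Mᴴ = -antihermitianPart M := by
  rw [antihermitianPart, antihermitianPart, Matrix.conjTranspose_conjTranspose]
  module

lemma continuation_eq_add (hroots : IsRootSystem K Ω A kap) (hA : IsOpen A) (hE : (E : ℂ) ∈ A) :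
    continuation K Ω G kap E =
      (contourTerm K Ω G E +
        (2 * Real.pi * I) • ∑ s with 0 < (kap s E).im, residueTerm Ω G (kap s E)) +
        (2 * Real.pi * I) • ∑ s with (kap s E).im = 0, residueTerm Ω G (kap s E) := by
  have h1 : (Finset.univ.filter fun s => (kap s E).im = 0) =
      Finset.univ.filter fun s => ¬ 0 < (kap s E).im := by
    refine Finset.filter_congr fun s _ => ?_
    have := hroots.im_nonneg hA hE s
    rw [not_lt]
    exact ⟨fun h => h.le, fun h => le_antisymm h this⟩
  rw [continuation, h1, add_assoc, ← smul_add, Finset.sum_filter_add_sum_filter_not]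

end SymmetricModel

end FriedrichsLee

/-! ### Assembly of the proposition -/

theorem proposition1 {n r : ℕ} (ω : ℝ → ℝ) (F : ℝ → Fin n → ℂ) (K : Set ℂ) (Ω : ℂ → ℂ)
    (G : ℂ → Matrix (Fin n) (Fin n) ℂ) (A : Set ℂ) (kap : Fin r → ℂ → ℂ)
    (hmodel : IsSymmetricModel ω F)
    (hext : IsAnalyticExtension ω F K Ω G)
    (hbdry : BoundaryConditions K Ω G)
    (hAopen : IsOpen A) (hAconn : IsConnected A)
    (hAΓ : Disjoint A (Ω '' frontier K))
    (hroots : IsRootSystem K Ω A kap) :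
    -- the integrals that occur converge absolutely
    ((∀ z ∈ upper A, ∀ j l,
        Integrable fun k : ℝ => couplingMatrix F k j l / ((ω k : ℂ) - z)) ∧
      ∀ z ∈ A, ∀ j l, ContourIntegrable K (contourIntegrand Ω G z j l)) ∧
    -- (i) the decomposition of the self-energy
    (∀ z ∈ upper A \ Ω '' criticalPoints K Ω,
      selfEnergy ω F z = contourTerm K Ω G z +
        (2 * Real.pi * I) • ∑ s, residueTerm Ω G (kap s z) ∧
      selfEnergy ω F (conj z) = (selfEnergy ω F z)ᴴ) ∧
    -- (ii) the boundary values on the real line, if `K` is symmetric about the imaginary axis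
    ((∀ κ ∈ K, -conj κ ∈ K) → ∀ E : ℝ, (E : ℂ) ∈ A →
      (∀ s, 0 ≤ (kap s E).im) ∧
      ∃ Splus Sminus : Matrix (Fin n) (Fin n) ℂ,
        Tendsto (fun δ : ℝ => selfEnergy ω F (E + δ * I)) (𝓝[>] 0) (𝓝 Splus) ∧
        Tendsto (fun δ : ℝ => selfEnergy ω F (E - δ * I)) (𝓝[>] 0) (𝓝 Sminus) ∧
        (∀ S ∈ ({Splus, Sminus} : Set (Matrix (Fin n) (Fin n) ℂ)),
          hermitianPart S = contourTerm K Ω G E + (2 * Real.pi * I) •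
            ((∑ s with 0 < (kap s E).im, residueTerm Ω G (kap s E)) +
              (∑ s with (kap s E).im = 0, antihermitianPart (residueTerm Ω G (kap s E))))) ∧
        antihermitianPart Splus = (2 * Real.pi * I) •
          ∑ s with (kap s E).im = 0, hermitianPart (residueTerm Ω G (kap s E)) ∧
        antihermitianPart Sminus = -((2 * Real.pi * I) •
          ∑ s with (kap s E).im = 0, hermitianPart (residueTerm Ω G (kap s E))) ∧
        Splus - Sminus = (2 * Real.pi * I) •
          ∑ s with (kap s E).im = 0,
            (residueTerm Ω G (kap s E) + (residueTerm Ω G (kap s E))ᴴ)) ∧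
    -- (iii) the analytic continuation from the upper to the lower part of `A`
    (∃ S : ℂ → Matrix (Fin n) (Fin n) ℂ, IsContinuation ω F A S ∧
      (∀ z ∈ lower A \ Ω '' criticalPoints K Ω,
        S z = contourTerm K Ω G z + (2 * Real.pi * I) • ∑ s, residueTerm Ω G (kap s z)) ∧
      ∀ S' : ℂ → Matrix (Fin n) (Fin n) ℂ, (upper A).Nonempty → IsContinuation ω F A S' →
        EqOn S' S A) := by
  have hΩ := hext.analytic_dispersion
  have hcont := isContinuation_continuation hmodel hext hbdry hAopen hAΓ hroots
  refine ⟨⟨fun z hz j l => hmodel.integrable_coupling_div hz.2.ne' j l, fun z hz j l =>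
    contourIntegrable_contourIntegrand hext hbdry hAopen hAΓ hz j l⟩, fun z hz =>
    ⟨selfEnergy_eq hmodel hext hbdry hAopen hAΓ hroots hz.1, selfEnergy_conj ω F z⟩,
    fun hsymm E hE => ⟨hroots.im_nonneg hAopen hE, ?_⟩,
    continuation K Ω G kap, hcont, fun z _ => rfl,
    fun S' hne hS' => hcont.eqOn hS' hAopen hAconn.isPreconnected hne⟩
  have hlim : Tendsto (fun δ : ℝ => (E : ℂ) + δ * I) (𝓝[>] 0) (𝓝 (E : ℂ)) := by
    have : Continuous fun δ : ℝ => (E : ℂ) + δ * I := by fun_prop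
    simpa using (this.tendsto 0).mono_left nhdsWithin_le_nhds
  have hSc : ContinuousAt (continuation K Ω G kap) E :=
    continuousAt_pi.2 fun j => continuousAt_pi.2 fun l => (hcont.1 j l E hE).continuousAt
  have hev : ∀ᶠ δ : ℝ in 𝓝[>] 0,
      continuation K Ω G kap (E + δ * I) = selfEnergy ω F (E + δ * I) := by
    filter_upwards [hlim.eventually (hAopen.mem_nhds hE), self_mem_nhdsWithin] with δ h1 h2
    exact hcont.2 _ ⟨h1, by simpa using h2⟩
  have hplus : Tendsto (fun δ : ℝ => selfEnergy ω F (E + δ * I)) (𝓝[>] 0)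
      (𝓝 (continuation K Ω G kap E)) := (hSc.tendsto.comp hlim).congr' hev
  -- From below, `Σ(E - iδ)` is the adjoint of `Σ(E + iδ)`, and taking adjoints is continuous.
  have hminus : Tendsto (fun δ : ℝ => selfEnergy ω F (E - δ * I)) (𝓝[>] 0)
      (𝓝 (continuation K Ω G kap E)ᴴ) := by
    have h1 := (continuous_id.matrix_conjTranspose.tendsto _).comp hplus
    refine h1.congr fun δ => ?_
    simp only [Function.comp_apply, id]
    rw [← selfEnergy_conj]
    congr 1
    simp [sub_eq_add_neg]
  have hsplit := continuation_eq_add (G := G) hroots hAopen hE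
  -- `H` collects the contour term and the nonreal roots, and is hermitian; what remains are the
  -- real roots.
  set H := contourTerm K Ω G E +
    (2 * Real.pi * I) • ∑ s with 0 < (kap s E).im, residueTerm Ω G (kap s E) with hHdef
  have hH : Hᴴ = H := by
    have h1 : conj (2 * Real.pi * I : ℂ) = -(2 * Real.pi * I) := by
      rw [map_mul, map_mul, conj_I, conj_ofReal, map_ofNat, mul_neg]
    rw [hHdef, Matrix.conjTranspose_add, Matrix.conjTranspose_smul,
      conjTranspose_contourTerm hmodel hext hsymm,
      conjTranspose_sum_residueTerm hmodel hext hAopen hroots hsymm hE, star_def, h1, neg_smul_neg]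
  have hherm : hermitianPart (continuation K Ω G kap E) =
      contourTerm K Ω G E + (2 * Real.pi * I) •
        ((∑ s with 0 < (kap s E).im, residueTerm Ω G (kap s E)) +
          (∑ s with (kap s E).im = 0, antihermitianPart (residueTerm Ω G (kap s E)))) := by
    rw [hsplit, hermitianPart_add_sum _ hH, hHdef, add_assoc, ← smul_add]
  have hanti : antihermitianPart (continuation K Ω G kap E) = (2 * Real.pi * I) •
      ∑ s with (kap s E).im = 0, hermitianPart (residueTerm Ω G (kap s E)) := by
    rw [hsplit, antihermitianPart_add_sum _ hH]
  refine ⟨_, _, hplus, hminus, ?_, hanti, ?_, ?_⟩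
  · rintro S (rfl | rfl)
    · exact hherm
    · rw [hermitianPart_conjTranspose, hherm]
  · rw [antihermitianPart_conjTranspose, hanti]
  · have h2 : continuation K Ω G kap E - (continuation K Ω G kap E)ᴴ =
        (2 : ℂ) • antihermitianPart (continuation K Ω G kap E) := by
      rw [antihermitianPart]; module
    rw [h2, hanti]
    simp only [hermitianPart, ← Finset.smul_sum]
    module
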